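/- For a finite group $G$, let $\Gamma(G)$ be the subgroup lattice graph of $G$: its vertices are the subgroups of $G$, and two distinct subgroups $H_1, H_2$ are joined by an edge if and only if one of them, say $H_1$, is contained in the other and there is no subgroup $K$ with $H_1 < K < H_2$. For a finite graph $\Gamma$, let the genus $\gamma(\Gamma)$ be the minimum $g \ge 0$ such that $\Gamma$ can be embedded in the closed connected orientable surface $S_g$ of genus $g$, meaning that for some finite cell structure on $S_g$ the vertices of $\Gamma$ can be placed injectively on 0-cells and its edges injectively on 1-cells, with matching ends. Let $\mathbb{Z}_n$ denote the cyclic group of order $n$. For every odd prime $p$, $$\gamma\bigl(\Gamma(\mathbb{Z}_{p^3}\times \mathbb{Z}_{p^2})\bigr) = 2\left\lceil \frac{p-2}{4}\right\rceil .$$ For $p = 2$, $\gamma\bigl(\Gamma(\mathbb{Z}_{8}\times \mathbb{Z}_{4})\bigr) = 1$. -/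

import Mathlib

/-- The subgroup lattice graph of a group `G` (written additively): the vertices are the subgroups
of `G`, and two subgroups are joined by an edge iff one of them is properly contained in the other
with no subgroup strictly in between. -/
def subgroupLatticeGraph (G : Type*) [AddGroup G] : SimpleGraph (AddSubgroup G) where
  Adj H₁ H₂ :=
    (H₁ < H₂ ∧ ¬ ∃ K : AddSubgroup G, H₁ < K ∧ K < H₂) ∨
    (H₂ < H₁ ∧ ¬ ∃ K : AddSubgroup G, H₂ < K ∧ K < H₁)
  symm := ⟨fun _ _ h => h.symm⟩
  loopless := ⟨fun _ h => h.elim (fun h => lt_irrefl _ h.1) (fun h => lt_irrefl _ h.1)⟩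

/-- A connected closed oriented surface with a cell structure, presented by gluing finitely many
oriented polygons along their sides. `D` is the finite set of all sides of all the polygons, each
side being directed along the boundary orientation of its polygon.

* `next d` is the side that follows `d` on the boundary of the polygon of `d`, so the polygons
  (the 2-cells, "faces") are the cycles of `next`.
* `opp d` is the side to which `d` is glued, with directions reversed (so that the orientations of
  the polygons fit together). The closed 1-cells ("edges") are the pairs `{d, opp d}`.

Every closed connected orientable surface arises in this way (for instance from a triangulation),
and each such gluing is a closed connected oriented surface. -/
structure PolygonalSurface (D : Type) where
  next : Equiv.Perm D
  opp : Equiv.Perm D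
  opp_opp : ∀ d, opp (opp d) = d
  opp_ne : ∀ d, opp d ≠ d
  nonempty : Nonempty D
  connected : ∀ x y : D, ∃ g ∈ Subgroup.closure ({next, opp} : Set (Equiv.Perm D)), g x = y

namespace PolygonalSurface

variable {D : Type} (S : PolygonalSurface D)

/-- The permutation carrying a directed side `d` to the next directed side, going around the
starting point of `d`: the side `opp d` ends where `d` starts, and `next (opp d)` starts there. -/
def rot : Equiv.Perm D := S.next * S.opp

/-- The 0-cells of the surface: directed sides up to having the same starting point. -/
def Vertex : Type := Quotient (Equiv.Perm.SameCycle.setoid S.rot)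

/-- The 1-cells of the surface. -/
def Edge : Type := Quotient (Equiv.Perm.SameCycle.setoid S.opp)

/-- The 2-cells of the surface. -/
def Face : Type := Quotient (Equiv.Perm.SameCycle.setoid S.next)

/-- The starting point of a directed side. -/
def start (d : D) : S.Vertex := Quotient.mk (Equiv.Perm.SameCycle.setoid S.rot) d

/-- The Euler characteristic of the surface. -/
noncomputable def eulerChar : ℤ :=
  (Nat.card S.Vertex : ℤ) - (Nat.card S.Edge : ℤ) + (Nat.card S.Face : ℤ)

/-- The surface is the closed orientable surface of genus `g`. -/
def IsGenus (g : ℕ) : Prop := S.eulerChar = 2 - 2 * (g : ℤ)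

/-- An embedding of a simple graph in the surface: distinct vertices of the graph go to distinct
points (0-cells), and distinct edges go to distinct 1-cells, with matching ends. A directed edge
of the graph goes to a directed 1-cell with the same starting point, and the reversed
edge to the reversed 1-cell. Cells of the surface that are not used by the graph are
allowed, so the components of the complement of the graph need not be discs. -/
structure Embedding {V : Type*} (Γ : SimpleGraph V) where
  onVertex : V → S.Vertex
  onDart : Γ.Dart → D
  onVertex_injective : Function.Injective onVertex
  onDart_injective : Function.Injective onDart
  start_onDart : ∀ e : Γ.Dart, S.start (onDart e) = onVertex e.fst
  onDart_symm : ∀ e : Γ.Dart, onDart e.symm = S.opp (onDart e)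

end PolygonalSurface

/-- The graph `Γ` embeds in the closed orientable surface of genus `g`, that is, in the surface
equipped with some finite cell structure. -/
def EmbedsInGenus {V : Type*} (Γ : SimpleGraph V) (g : ℕ) : Prop :=
  ∃ (D : Type) (_ : Finite D) (S : PolygonalSurface D), S.IsGenus g ∧ Nonempty (S.Embedding Γ)

/-- The graph `Γ` has genus `g`: `g` is the minimum of all `h` such that `Γ` embeds in the closed
orientable surface of genus `h`. -/
def HasGenus {V : Type*} (Γ : SimpleGraph V) (g : ℕ) : Prop :=
  IsLeast {h : ℕ | EmbedsInGenus Γ h} g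

/-! Put m = ⌈(p-2)/4⌉. Lifting subgroups to lattices between p³ℤ × p²ℤ and ℤ² turns the graph into
an explicit model (`LatticeVertex.exists_equiv`). It has two halves, each with three hubs and p
gadgets; a gadget is a corner joined to hubs 0 and 1, a centre joined to hubs 1 and 2, and p paths
of length two from corner to centre. Five hub edges, three rungs and two diagonals, link the halves.

Lower bound. Keeping one path per gadget, each half contains a subdivision of K_{3,p}, and the two
are disjoint. A surface is encoded by permutations, and `defect` is twice the total genus of the
components. It does not increase when edges are deleted (`defect_mono`) and is additive over
invariant pieces (`defect_sum`), so the contributions of the halves add up. Every face of K_{3,n}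
has at least four sides, so Euler's formula and the parity of the defect give genus at least
⌈(n-2)/4⌉ for each (`TripodMap.le_two_mul_defect`, `EmbedsInGenus.card_mul_le`), in total 2m. For p
= 2 this is zero, but a subdivided K_{3,3} appears whose third tripod passes through the other half.

Upper bound. A gadget costs no genus once its centre is drawn joined to all three hubs: the corner
is placed in a face beside the centre, between the sides to hubs 0 and 1, and the paths run parallel
to the edge from corner to centre (`LatticeBase.exists_surface`). It remains to draw the base,
namely two copies of K_{3,p} and the five hub edges. For odd p let k = 2m+1. The graph K_{3,2k}
quadrangulates the surface of genus m. Removing one vertex of degree three from each of two copies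
leaves two hexagonal faces with the hubs at alternate corners; a tube between them carries the hub
edges and the genus becomes 2m (`TubeSurface.le_eulerChar`). Each copy retains 2k-1 = 4m+1 vertices
of degree three, and p ≤ 4m+1 because p is odd. For p = 2 an explicit torus serves. -/

/-! ### Counting classes of a relation -/

/-- The number of classes of the equivalence relation generated by `r`. -/
noncomputable def classCount {D : Type*} (r : D → D → Prop) : ℕ := Nat.card (Quot r)

theorem classCount_le_of_surjective {D : Type*} [Finite D] {r : D → D → Prop} {M : Type*}
    (f : D → M) (hf : ∀ x y, r x y → f x = f y) (hs : Function.Surjective f) :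
    Nat.card M ≤ classCount r := by
  have : Function.Surjective (Quot.lift f hf) := fun m => by
    obtain ⟨x, rfl⟩ := hs m
    exact ⟨Quot.mk _ x, rfl⟩
  exact Nat.card_le_card_of_surjective _ this

theorem classCount_eq_of_label {D : Type*} [Finite D] {r : D → D → Prop} {M : Type*}
    (f : D → M) (hf : ∀ x y, r x y → f x = f y) (hs : Function.Surjective f)
    (hi : ∀ x y, f x = f y → Quot.mk r x = Quot.mk r y) :
    classCount r = Nat.card M := by
  refine Nat.card_congr (Equiv.ofBijective (Quot.lift f hf) ⟨?_, fun m => ?_⟩)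
  · rintro ⟨x⟩ ⟨y⟩ h
    exact hi x y h
  · obtain ⟨x, rfl⟩ := hs m
    exact ⟨Quot.mk _ x, rfl⟩

theorem classCount_congr {D : Type*} {r s : D → D → Prop}
    (h₁ : ∀ x y, r x y → Quot.mk s x = Quot.mk s y)
    (h₂ : ∀ x y, s x y → Quot.mk r x = Quot.mk r y) : classCount r = classCount s := by
  refine Nat.card_congr
    ⟨Quot.lift (Quot.mk s) h₁, Quot.lift (Quot.mk r) h₂, ?_, ?_⟩ <;> rintro ⟨x⟩ <;> rfl

/-- The relation `r` with one more related pair. -/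
def joinPair {D : Type*} (r : D → D → Prop) (a b : D) : D → D → Prop :=
  fun x y => r x y ∨ (x = a ∧ y = b)

theorem classCount_joinPair_of_eq {D : Type*} {r : D → D → Prop} {a b : D}
    (h : Quot.mk r a = Quot.mk r b) : classCount r = classCount (joinPair r a b) := by
  refine classCount_congr (fun x y hxy => Quot.sound (Or.inl hxy)) ?_
  rintro x y (hxy | ⟨rfl, rfl⟩)
  · exact Quot.sound hxy
  · exact h

/-- After the merger every class is represented by a class of `r` other than that of `b`, the merged
one by the class of `a`. So the classes of `r` are the new ones plus one extra point, the class of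
`b`. -/
theorem classCount_joinPair_of_ne {D : Type*} [Finite D] {r : D → D → Prop} {a b : D}
    (h : Quot.mk r a ≠ Quot.mk r b) : classCount r = classCount (joinPair r a b) + 1 := by
  classical
  let up : Quot r → Quot (joinPair r a b) :=
    Quot.lift (Quot.mk _) (fun x y hxy => Quot.sound (Or.inl hxy))
  let down : Quot (joinPair r a b) → Quot r :=
    Quot.lift (fun x => if Quot.mk r x = Quot.mk r b then Quot.mk r a else Quot.mk r x) (by
      rintro x y (hxy | ⟨rfl, rfl⟩)
      · have : Quot.mk r x = Quot.mk r y := Quot.sound hxy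
        simp only [this]
      · simp)
  have hdu : ∀ q : Quot r, q ≠ Quot.mk r b → down (up q) = q := by
    rintro ⟨x⟩ hq
    exact if_neg hq
  have hud : ∀ q, up (down q) = q := by
    rintro ⟨x⟩
    change up (if Quot.mk r x = Quot.mk r b then Quot.mk r a else Quot.mk r x) = _
    split_ifs with hx
    · have h1 : up (Quot.mk r a) = up (Quot.mk r b) := Quot.sound (Or.inr ⟨rfl, rfl⟩)
      rw [h1, ← hx]
    · rfl
  have hd : ∀ q, down q ≠ Quot.mk r b := by
    rintro ⟨x⟩
    change (if Quot.mk r x = Quot.mk r b then Quot.mk r a else Quot.mk r x) ≠ _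
    split_ifs with hx
    · exact h
    · exact hx
  let e : Option (Quot (joinPair r a b)) ≃ Quot r :=
    { toFun := fun o => o.elim (Quot.mk r b) down
      invFun := fun q => if q = Quot.mk r b then none else some (up q)
      left_inv := by
        rintro (_ | q)
        · simp
        · simp [hd, hud]
      right_inv := by
        intro q
        by_cases hq : q = Quot.mk r b
        · simp [hq]
        · simp [hq, hdu] }
  rw [classCount, classCount, ← Nat.card_congr e, Finite.card_option]

theorem classCount_sum {D ι : Type*} [Finite D] [Fintype ι] {r : D → D → Prop} (f : D → ι)
    (hf : ∀ x y, r x y → f x = f y) :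
    classCount r = ∑ i, classCount (fun x y : {d // f d = i} => r x y) := by
  let e : Quot r ≃ Σ i, Quot (fun x y : {d // f d = i} => r x y) :=
    { toFun := Quot.lift (fun x => ⟨f x, Quot.mk _ ⟨x, rfl⟩⟩) (by
        intro x y hxy
        have h := hf x y hxy
        have key : ∀ i (hx : f x = i) (hy : f y = i),
            (⟨f x, Quot.mk _ ⟨x, rfl⟩⟩ : Σ i, Quot (fun x y : {d // f d = i} => r x y))
              = ⟨f y, Quot.mk _ ⟨y, rfl⟩⟩ := by
          intro i hx hy
          have e1 : ∀ z (hz : f z = i),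
            (⟨f z, Quot.mk _ ⟨z, rfl⟩⟩ : Σ i, Quot (fun x y : {d // f d = i} => r x y))
              = ⟨i, Quot.mk _ ⟨z, hz⟩⟩ := by
            rintro z rfl
            rfl
          rw [e1 x hx, e1 y hy]
          congr 1
          exact Quot.sound hxy
        exact key _ h rfl)
      invFun := fun q => Quot.lift (fun x : {d // f d = q.1} => Quot.mk r x.1) (fun x y hxy => Quot.sound hxy) q.2
      left_inv := by
        rintro ⟨x⟩
        rfl
      right_inv := by
        rintro ⟨i, ⟨⟨x, rfl⟩⟩⟩
        rfl }
  have : ∀ i, Finite (Quot (fun x y : {d // f d = i} => r x y)) := fun i => inferInstance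
  rw [classCount, Nat.card_congr e, Nat.card_sigma]
  rfl

/-! ### Cycles of permutations -/

/-- The relation joining each point to its image. -/
def stepRel {D : Type*} (σ : Equiv.Perm D) : D → D → Prop := fun x y => σ x = y

/-- The number of cycles of a permutation, fixed points included. -/
noncomputable def cycleCount {D : Type*} (σ : Equiv.Perm D) : ℕ := classCount (stepRel σ)

theorem quot_stepRel_eq_iff {D : Type*} (σ : Equiv.Perm D) (x y : D) :
    Quot.mk (stepRel σ) x = Quot.mk (stepRel σ) y ↔ σ.SameCycle x y := by
  constructor
  · intro h
    have := congrArg (Quot.lift (Quotient.mk (Equiv.Perm.SameCycle.setoid σ)) (fun x y hxy => by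
      apply Quotient.sound
      exact ⟨1, by simpa [stepRel] using hxy⟩)) h
    exact Quotient.exact this
  · rintro ⟨n, rfl⟩
    induction n using Int.induction_on with
    | zero => rfl
    | succ n ih =>
      rw [ih, add_comm, zpow_add, zpow_one]
      exact Quot.sound rfl
    | pred n ih =>
      rw [ih]
      refine (Quot.sound ?_).symm
      change σ _ = _
      rw [← Equiv.Perm.mul_apply, ← zpow_one_add]
      congr 2
      ring

theorem card_quotient_sameCycle {D : Type*} (σ : Equiv.Perm D) :
    Nat.card (Quotient (Equiv.Perm.SameCycle.setoid σ)) = cycleCount σ := by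
  refine Nat.card_congr
    ⟨Quotient.lift (Quot.mk (stepRel σ)) (fun x y h => (quot_stepRel_eq_iff σ x y).2 h),
      Quot.lift (Quotient.mk _) (fun x y h => Quotient.sound
        ((quot_stepRel_eq_iff σ x y).1 (Quot.sound h))), ?_, ?_⟩
  · rintro ⟨x⟩
    rfl
  · rintro ⟨x⟩
    rfl

theorem stepRel_joinPair_mul_swap {D : Type*} [DecidableEq D] (σ : Equiv.Perm D) (a b x y : D)
    (h : stepRel (σ * Equiv.swap a b) x y) :
    Quot.mk (joinPair (stepRel σ) a b) x = Quot.mk (joinPair (stepRel σ) a b) y := by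
  have hab : Quot.mk (joinPair (stepRel σ) a b) a = Quot.mk (joinPair (stepRel σ) a b) b :=
    Quot.sound (Or.inr ⟨rfl, rfl⟩)
  have hs : ∀ z, Quot.mk (joinPair (stepRel σ) a b) z = Quot.mk (joinPair (stepRel σ) a b) (σ z) :=
    fun z => Quot.sound (Or.inl rfl)
  have h' : σ (Equiv.swap a b x) = y := h
  rw [← h', ← hs]
  rcases eq_or_ne x a with rfl | hxa
  · rw [Equiv.swap_apply_left, hab]
  · rcases eq_or_ne x b with rfl | hxb
    · rw [Equiv.swap_apply_right, hab]
    · rw [Equiv.swap_apply_of_ne_of_ne hxa hxb]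

/-- The two permutations differ only at `a` and `b`, so they generate the same equivalence once
these points are identified. The change in the number of cycles is thus decided by whether `a` and
`b` share a cycle before and after. -/
theorem classCount_joinPair_mul_swap {D : Type*} [DecidableEq D] (σ : Equiv.Perm D) (a b : D) :
    classCount (joinPair (stepRel (σ * Equiv.swap a b)) a b)
      = classCount (joinPair (stepRel σ) a b) := by
  refine classCount_congr ?_ ?_
  · rintro x y (h | ⟨rfl, rfl⟩)
    · exact stepRel_joinPair_mul_swap σ a b x y h
    · exact Quot.sound (Or.inr ⟨rfl, rfl⟩)
  · rintro x y (h | ⟨rfl, rfl⟩)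
    · refine stepRel_joinPair_mul_swap (σ * Equiv.swap a b) a b x y ?_
      rwa [mul_assoc, Equiv.swap_mul_self, mul_one]
    · exact Quot.sound (Or.inr ⟨rfl, rfl⟩)

/-- Follow `σ` from `a` until it first meets `a` or `b`; from `b`, the permutation
`σ * swap a b` takes the same steps. -/
theorem exists_first_return {D : Type*} [Finite D] [DecidableEq D] (σ : Equiv.Perm D) (a b : D) :
    ∃ k : ℕ, 0 < k ∧ ((σ ^ k) a = a ∨ (σ ^ k) a = b) ∧
      (∀ i, 0 < i → i < k → (σ ^ i) a ≠ a ∧ (σ ^ i) a ≠ b) ∧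
      ∀ i, 0 < i → i ≤ k → ((σ * Equiv.swap a b) ^ i) b = (σ ^ i) a := by
  have hex : ∃ k : ℕ, 0 < k ∧ ((σ ^ k) a = a ∨ (σ ^ k) a = b) :=
    ⟨orderOf σ, orderOf_pos σ, Or.inl (by rw [pow_orderOf_eq_one]; rfl)⟩
  classical
  refine ⟨Nat.find hex, (Nat.find_spec hex).1, (Nat.find_spec hex).2, ?_, ?_⟩
  · intro i hi hik
    have := Nat.find_min hex hik
    push Not at this
    exact this hi
  · intro i
    induction i with
    | zero => intro h; exact absurd h (lt_irrefl _)
    | succ i ih =>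
      intro _ hik
      rcases Nat.eq_zero_or_pos i with rfl | hi
      · simp
      · have h1 := ih hi (by omega)
        have h2 := Nat.find_min hex (show i < Nat.find hex by omega)
        push Not at h2
        have h3 := h2 hi
        rw [pow_succ', Equiv.Perm.mul_apply, h1, Equiv.Perm.mul_apply,
          Equiv.swap_apply_of_ne_of_ne h3.1 h3.2, pow_succ', Equiv.Perm.mul_apply]

/-- The `σ`-cycle of `a` returns to `a` without meeting `b`; started from `b`, the new permutation
runs through this cycle and ends in `a`. -/
theorem sameCycle_mul_swap_of_not {D : Type*} [Finite D] [DecidableEq D] (σ : Equiv.Perm D)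
    {a b : D} (h : ¬ σ.SameCycle a b) : (σ * Equiv.swap a b).SameCycle a b := by
  obtain ⟨k, hk, hkab, -, hstep⟩ := exists_first_return σ a b
  have h1 : (σ ^ k) a = a := hkab.resolve_right fun h' => h ⟨k, by simpa using h'⟩
  refine Equiv.Perm.SameCycle.symm ⟨k, ?_⟩
  rw [zpow_natCast, hstep k hk le_rfl, h1]

/-- The first return from `a` hits `b`, so the new cycle of `b` is exactly the arc strictly after
`a` up to `b`, which omits `a`. -/
theorem not_sameCycle_mul_swap {D : Type*} [Finite D] [DecidableEq D] (σ : Equiv.Perm D)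
    {a b : D} (hab : a ≠ b) (h : σ.SameCycle a b) : ¬ (σ * Equiv.swap a b).SameCycle a b := by
  obtain ⟨k, hk, hkab, hmin, hstep⟩ := exists_first_return σ a b
  have hb : (σ ^ k) a = b := by
    -- A first return to `a` itself would make the whole cycle of `a` miss `b`.
    rcases hkab with h1 | h1
    · exfalso
      obtain ⟨n, hn⟩ := h.exists_nat_pow_eq
      have h2 : (σ ^ (n % k)) a = b := by
        have h3 : ((σ ^ k) ^ (n / k)) a = a := Equiv.Perm.pow_apply_eq_self_of_apply_eq_self h1 _
        rw [← hn]
        conv_rhs => rw [← Nat.mod_add_div n k, pow_add, pow_mul, Equiv.Perm.mul_apply, h3]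
      rcases Nat.eq_zero_or_pos (n % k) with h0 | h0
      · rw [h0] at h2
        exact hab h2
      · exact (hmin _ h0 (Nat.mod_lt _ hk)).2 h2
    · exact h1
  intro hs
  obtain ⟨n, hn⟩ := hs.symm.exists_nat_pow_eq
  have hfix : ((σ * Equiv.swap a b) ^ k) b = b := by rw [hstep k hk le_rfl, hb]
  have h2 : ((σ * Equiv.swap a b) ^ (n % k)) b = a := by
    have h3 : (((σ * Equiv.swap a b) ^ k) ^ (n / k)) b = b :=
      Equiv.Perm.pow_apply_eq_self_of_apply_eq_self hfix _
    conv_rhs => rw [← hn, ← Nat.mod_add_div n k, pow_add, pow_mul, Equiv.Perm.mul_apply, h3]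
  rcases Nat.eq_zero_or_pos (n % k) with h0 | h0
  · rw [h0] at h2
    exact hab h2.symm
  · have hlt := Nat.mod_lt n hk
    rw [hstep _ h0 hlt.le] at h2
    exact (hmin _ h0 hlt).1 h2

theorem cycleCount_mul_swap_of_sameCycle {D : Type*} [Finite D] [DecidableEq D]
    (σ : Equiv.Perm D) {a b : D} (hab : a ≠ b) (h : σ.SameCycle a b) :
    cycleCount (σ * Equiv.swap a b) = cycleCount σ + 1 := by
  have h1 := classCount_joinPair_of_eq ((quot_stepRel_eq_iff σ a b).2 h)
  have h2 := classCount_joinPair_of_ne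
    (fun h' => not_sameCycle_mul_swap σ hab h ((quot_stepRel_eq_iff _ a b).1 h'))
  rw [cycleCount, cycleCount, h2, h1, classCount_joinPair_mul_swap]

theorem cycleCount_mul_swap_of_not_sameCycle {D : Type*} [Finite D] [DecidableEq D]
    (σ : Equiv.Perm D) {a b : D} (h : ¬ σ.SameCycle a b) :
    cycleCount (σ * Equiv.swap a b) + 1 = cycleCount σ := by
  have h1 := classCount_joinPair_of_ne (fun h' => h ((quot_stepRel_eq_iff σ a b).1 h'))
  have h2 := classCount_joinPair_of_eq
    ((quot_stepRel_eq_iff _ a b).2 (sameCycle_mul_swap_of_not σ h))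
  rw [cycleCount, cycleCount, h2, h1, classCount_joinPair_mul_swap]

/-! ### The defect of a pair of permutations -/

/-- The relation joining each point to its images under two permutations. -/
def stepRel₂ {D : Type*} (α β : Equiv.Perm D) : D → D → Prop := fun x y => α x = y ∨ β x = y

/-- Twice the total genus of the hypermap with vertices, edges and faces the cycles of `α`, `β`
and `α * β`. -/
noncomputable def defect {D : Type*} (α β : Equiv.Perm D) : ℤ :=
  Nat.card D + 2 * classCount (stepRel₂ α β) - cycleCount α - cycleCount β - cycleCount (α * β)

theorem cycleCount_one (D : Type*) [Finite D] : cycleCount (1 : Equiv.Perm D) = Nat.card D :=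
  classCount_eq_of_label id (fun _ _ h => h) Function.surjective_id
    (fun _ _ h => congrArg _ h)

theorem defect_one {D : Type*} [Finite D] (α : Equiv.Perm D) : defect α 1 = 0 := by
  have h : classCount (stepRel₂ α 1) = cycleCount α := by
    refine classCount_congr ?_ (fun x y h => Quot.sound (Or.inl h))
    rintro x y (h | h)
    · exact Quot.sound h
    · exact congrArg _ h
  rw [defect, mul_one, cycleCount_one, h]
  ring

/-- Deleting one edge from a map does not raise the genus. -/
theorem defect_mul_swap {D : Type*} [Finite D] [DecidableEq D] (α β : Equiv.Perm D)
    (hβ : ∀ x, β (β x) = x) {d : D} (hd : β d ≠ d) :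
    defect α (β * Equiv.swap d (β d)) ≤ defect α β ∧
      Even (defect α β - defect α (β * Equiv.swap d (β d))) := by
  have hE : cycleCount (β * Equiv.swap d (β d)) = cycleCount β + 1 :=
    cycleCount_mul_swap_of_sameCycle β hd.symm ⟨1, by simp⟩
  have hJ : classCount (stepRel₂ α β)
      = classCount (joinPair (stepRel₂ α (β * Equiv.swap d (β d))) d (β d)) := by
    refine classCount_congr ?_ ?_
    · rintro x y (h | h)
      · exact Quot.sound (Or.inl (Or.inl h))
      · have hdd : Quot.mk (joinPair (stepRel₂ α (β * Equiv.swap d (β d))) d (β d)) d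
            = Quot.mk _ (β d) := Quot.sound (Or.inr ⟨rfl, rfl⟩)
        rw [← h]
        rcases eq_or_ne x d with rfl | h1
        · exact hdd
        · rcases eq_or_ne x (β d) with rfl | h2
          · rw [hβ]; exact hdd.symm
          · refine Quot.sound (Or.inl (Or.inr ?_))
            rw [Equiv.Perm.mul_apply, Equiv.swap_apply_of_ne_of_ne h1 h2]
    · rintro x y ((h | h) | ⟨rfl, rfl⟩)
      · exact Quot.sound (Or.inl h)
      · rw [← h, Equiv.Perm.mul_apply]
        rcases eq_or_ne x d with rfl | h1
        · rw [Equiv.swap_apply_left, hβ]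
        · rcases eq_or_ne x (β d) with rfl | h2
          · rw [Equiv.swap_apply_right]
          · rw [Equiv.swap_apply_of_ne_of_ne h1 h2]
            exact Quot.sound (Or.inr rfl)
      · exact Quot.sound (Or.inr rfl)
  -- If both sides of the edge lie on one face, deletion splits that face. The defect then drops by
  -- 2 if the ends stay connected, and is unchanged if the edge was a bridge.
  by_cases hF : (α * β).SameCycle d (β d)
  · have hF' := cycleCount_mul_swap_of_sameCycle (α * β) hd.symm hF
    rw [mul_assoc] at hF'
    by_cases hc : Quot.mk (stepRel₂ α (β * Equiv.swap d (β d))) d = Quot.mk _ (β d)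
    · have h1 := classCount_joinPair_of_eq hc
      have h2 : defect α β - defect α (β * Equiv.swap d (β d)) = 2 := by
        rw [defect, defect, hE, hF', h1, hJ]; push_cast; ring
      exact ⟨by omega, by rw [h2]; decide⟩
    · have h1 := classCount_joinPair_of_ne hc
      have h2 : defect α β - defect α (β * Equiv.swap d (β d)) = 0 := by
        rw [defect, defect, hE, hF', h1, hJ]; push_cast; ring
      exact ⟨by omega, by rw [h2]; decide⟩
  -- Two different faces merge. The merged face still connects the ends, so the edge is no bridge
  -- and the defect is unchanged.
  · have hF' := cycleCount_mul_swap_of_not_sameCycle (α * β) hF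
    have hs := (quot_stepRel_eq_iff _ _ _).2 (sameCycle_mul_swap_of_not (α * β) hF)
    rw [mul_assoc] at hF' hs
    have hc : Quot.mk (stepRel₂ α (β * Equiv.swap d (β d))) d = Quot.mk _ (β d) := by
      have := congrArg (Quot.lift (Quot.mk (stepRel₂ α (β * Equiv.swap d (β d)))) (by
        rintro x y rfl
        exact (Quot.sound (r := stepRel₂ α (β * Equiv.swap d (β d))) (Or.inr rfl)).trans
          (Quot.sound (r := stepRel₂ α (β * Equiv.swap d (β d))) (Or.inl rfl)))) hs
      exact this
    have h1 := classCount_joinPair_of_eq hc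
    have h2 : defect α β - defect α (β * Equiv.swap d (β d)) = 0 := by
      rw [defect, defect, hE, ← hF', h1, hJ]; push_cast; ring
    exact ⟨by omega, by rw [h2]; decide⟩

/-- Deleting edges from a map does not raise the genus, and changes twice the genus by an even
number. -/
theorem defect_mono {D : Type*} [Finite D] (α γ : Equiv.Perm D) (hγ : ∀ x, γ (γ x) = x) :
    ∀ β : Equiv.Perm D, (∀ x, β (β x) = x) → (∀ x, γ x = x ∨ γ x = β x) →
      defect α γ ≤ defect α β ∧ Even (defect α β - defect α γ) ∧
      2 * (cycleCount γ : ℤ) + Nat.card {x // γ x ≠ x}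
        = 2 * cycleCount β + Nat.card {x // β x ≠ x} := by
  classical
  suffices H : ∀ n : ℕ, ∀ β : Equiv.Perm D, Nat.card {x // β x ≠ x} = n → (∀ x, β (β x) = x) →
      (∀ x, γ x = x ∨ γ x = β x) → defect α γ ≤ defect α β ∧ Even (defect α β - defect α γ) ∧
      2 * (cycleCount γ : ℤ) + Nat.card {x // γ x ≠ x}
        = 2 * cycleCount β + Nat.card {x // β x ≠ x} from
    fun β => H _ β rfl
  intro n
  induction n using Nat.strong_induction_on with
  | _ n ih =>
    intro β hn hβ hsub
    by_cases heq : γ = β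
    · subst heq
      simp
    · obtain ⟨d, hd⟩ : ∃ d, γ d ≠ β d := by
        by_contra hcon
        push Not at hcon
        exact heq (Equiv.ext hcon)
      have hγd : γ d = d := (hsub d).resolve_right hd
      have hβd : β d ≠ d := fun h => hd (hγd.trans h.symm)
      have hγβ : γ (β d) = β d := by
        rcases hsub (β d) with h | h
        · exact h
        · rw [hβ] at h
          have := hγ (β d)
          rw [h, hγd] at this
          exact absurd this.symm hβd
      have hval : ∀ x, (β * Equiv.swap d (β d)) x = if x = d ∨ x = β d then x else β x := by
        intro x
        rw [Equiv.Perm.mul_apply]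
        rcases eq_or_ne x d with rfl | h1
        · simp [hβ]
        · rcases eq_or_ne x (β d) with rfl | h2
          · simp
          · simp [Equiv.swap_apply_of_ne_of_ne h1 h2, h1, h2]
      have hinv : ∀ x, (β * Equiv.swap d (β d)) ((β * Equiv.swap d (β d)) x) = x := by
        intro x
        rw [hval x]
        split_ifs with h
        · rw [hval, if_pos h]
        · rw [hval, if_neg, hβ]
          rintro (h' | h')
          · exact h (Or.inr (by rw [← h', hβ]))
          · exact h (Or.inl (β.injective h'))
      have hsub' : ∀ x, γ x = x ∨ γ x = (β * Equiv.swap d (β d)) x := by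
        intro x
        rw [hval]
        split_ifs with h
        · left
          rcases h with rfl | rfl
          · exact hγd
          · exact hγβ
        · exact hsub x
      have hcard : Nat.card {x // β x ≠ x}
          = Nat.card {x // (β * Equiv.swap d (β d)) x ≠ x} + 2 := by
        have h1 : {x | β x ≠ x} = insert d (insert (β d) {x | (β * Equiv.swap d (β d)) x ≠ x}) := by
          ext x
          simp only [Set.mem_ofPred_eq, Set.mem_insert_iff, hval]
          by_cases h : x = d ∨ x = β d
          · simp only [h, if_true]
            rcases h with rfl | rfl
            · simp [hβd]
            · simp [hβ, hβd.symm]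
          · simp only [h, if_false]
            push Not at h
            simp [h.1, h.2]
        have h2 := congrArg Set.ncard h1
        rw [Set.ncard_insert_of_notMem, Set.ncard_insert_of_notMem] at h2
        · exact h2
        · simp [hval]
        · simp [hval, hβd.symm]
      obtain ⟨h1, h2⟩ := defect_mul_swap α β hβ hβd
      obtain ⟨h3, h4, h5⟩ := ih _ (by omega) _ rfl hinv hsub'
      have hE : cycleCount (β * Equiv.swap d (β d)) = cycleCount β + 1 :=
        cycleCount_mul_swap_of_sameCycle β hβd.symm ⟨1, by simp⟩
      refine ⟨h3.trans h1, ?_, ?_⟩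
      · have := h2.add h4
        rwa [sub_add_sub_cancel] at this
      · rw [h5, hcard, hE]
        push_cast
        ring

/-- Compare with the map from which all edges have been deleted, whose defect is 0. The last clause
counts the cycles of an involution: a moved point contributes one half and a fixed point contributes
1. -/
theorem defect_nonneg {D : Type*} [Finite D] (α β : Equiv.Perm D) (hβ : ∀ x, β (β x) = x) :
    0 ≤ defect α β ∧ Even (defect α β) ∧
      2 * (cycleCount β : ℤ) + Nat.card {x // β x ≠ x} = 2 * Nat.card D := by
  obtain ⟨h1, h2, h3⟩ := defect_mono α 1 (fun _ => rfl) β hβ (fun _ => Or.inl rfl)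
  rw [defect_one] at h1 h2
  refine ⟨h1, by simpa using h2, ?_⟩
  rw [← h3, cycleCount_one]
  simp

/-- Every term of the defect, the number of components included, is a count that splits over an
invariant partition. This makes the genus bounds of disjoint subgraphs add up. -/
theorem defect_sum {D ι : Type*} [Finite D] [Fintype ι] (α β : Equiv.Perm D) (f : D → ι)
    (hα : ∀ x, f (α x) = f x) (hβ : ∀ x, f (β x) = f x) :
    defect α β = ∑ i, defect (α.subtypePerm (p := fun x => f x = i) (fun x => by rw [hα]))
      (β.subtypePerm (p := fun x => f x = i) (fun x => by rw [hβ])) := by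
  have h1 : ∀ (σ : Equiv.Perm D) (hσ : ∀ x, f (σ x) = f x), cycleCount σ
      = ∑ i, cycleCount (σ.subtypePerm (p := fun x => f x = i) (fun x => by rw [hσ])) := by
    intro σ hσ
    rw [cycleCount, classCount_sum f (fun x y h => by rw [← h, hσ])]
    refine Finset.sum_congr rfl fun i _ => ?_
    rw [cycleCount]
    congr 1
    ext x y
    simp [stepRel, Subtype.ext_iff]
  have h2 : classCount (stepRel₂ α β) = ∑ i, classCount (stepRel₂
      (α.subtypePerm (p := fun x => f x = i) (fun x => by rw [hα]))
      (β.subtypePerm (p := fun x => f x = i) (fun x => by rw [hβ]))) := by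
    rw [classCount_sum f (fun x y h => by
      rcases h with h | h
      · rw [← h, hα]
      · rw [← h, hβ])]
    refine Finset.sum_congr rfl fun i _ => ?_
    congr 1
    ext x y
    simp [stepRel₂, Subtype.ext_iff]
  have h3 : Nat.card D = ∑ i, Nat.card {x // f x = i} := by
    rw [← Nat.card_congr (Equiv.sigmaFiberEquiv f), Nat.card_sigma]
  have h4 := h1 (α * β) (fun x => by rw [Equiv.Perm.mul_apply, hα, hβ])
  simp only [defect]
  rw [h1 α hα, h1 β hβ, h2, h3, h4]
  push_cast
  simp only [Finset.sum_sub_distrib, Finset.sum_add_distrib, Finset.mul_sum]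
  rfl

/-! ### Maps of tripod graphs -/

/-- If `β` fixes everything outside `P`, then the face of `x` meets `P` at the vertex of `β x`
again, away from `β x`, as soon as that vertex has another point of `P`. -/
theorem exists_sameCycle_mul {D : Type*} [Finite D] (α β : Equiv.Perm D) (P : D → Prop)
    (hfix : ∀ x, ¬ P x → β x = x) (x c : D) (hc : α.SameCycle (β x) c) (hP : P c)
    (hne : c ≠ β x) :
    ∃ y, P y ∧ y ≠ β x ∧ α.SameCycle (β x) y ∧ (α * β).SameCycle x y := by
  classical
  obtain ⟨m, hm⟩ := hc.exists_nat_pow_eq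
  have hm0 : 0 < m := by
    rcases Nat.eq_zero_or_pos m with rfl | h
    · exact absurd hm.symm hne
    · exact h
  have hex : ∃ k : ℕ, 0 < k ∧ P ((α ^ k) (β x)) := ⟨m, hm0, by rwa [hm]⟩
  obtain ⟨hk, hPk⟩ := Nat.find_spec hex
  have hmin : ∀ i, 0 < i → i < Nat.find hex → ¬ P ((α ^ i) (β x)) :=
    fun i h0 hi h => Nat.find_min hex hi ⟨h0, h⟩
  generalize Nat.find hex = k at hk hPk hmin
  refine ⟨(α ^ k) (β x), hPk, ?_, ⟨k, by simp⟩, ⟨k, ?_⟩⟩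
  -- If the first return to `P` were `β x` itself, the cycle would meet `P` only in `β x` and could
  -- not contain `c`.
  · intro h
    have h3 : ((α ^ k) ^ (m / k)) (β x) = β x :=
      Equiv.Perm.pow_apply_eq_self_of_apply_eq_self h _
    have h2 : (α ^ (m % k)) (β x) = c := by
      conv_rhs => rw [← hm, ← Nat.mod_add_div m k, pow_add, pow_mul, Equiv.Perm.mul_apply, h3]
    rcases Nat.eq_zero_or_pos (m % k) with h0 | h0
    · rw [h0] at h2
      exact hne h2.symm
    · exact hmin _ h0 (Nat.mod_lt _ hk) (by rwa [h2])
  · rw [zpow_natCast]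
    have : ∀ i, 0 < i → i ≤ k → ((α * β) ^ i) x = (α ^ i) (β x) := by
      intro i
      induction i with
      | zero => intro h; exact absurd h (lt_irrefl _)
      | succ i ih =>
        intro _ hi
        rcases Nat.eq_zero_or_pos i with rfl | h0
        · simp
        · rw [pow_succ', Equiv.Perm.mul_apply, ih h0 (by omega), Equiv.Perm.mul_apply,
            hfix _ (hmin i h0 (by omega)), pow_succ', Equiv.Perm.mul_apply]
    exact this k hk le_rfl

/-- The vertices of the subdivided complete bipartite graph `K_{3,n}`: three hubs, and `n` tripods,
each consisting of a centre and two further vertices on its leg to the last hub. -/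
abbrev TripodVertex (n : ℕ) : Type := Fin 3 ⊕ (Fin n × Fin 3)

/-- The directed edges of the tripods. -/
abbrev TripodDart (n : ℕ) : Type := Fin n × Fin 5 × Bool

namespace TripodDart

/-- The tail of an undirected edge. -/
def tail {n : ℕ} (j : Fin n) : Fin 5 → TripodVertex n :=
  ![.inr (j, 0), .inr (j, 0), .inr (j, 0), .inr (j, 1), .inr (j, 2)]

/-- The head of an undirected edge. -/
def head {n : ℕ} (j : Fin n) : Fin 5 → TripodVertex n :=
  ![.inl 0, .inl 1, .inr (j, 1), .inr (j, 2), .inl 2]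

/-- The reversed dart. -/
def rev {n : ℕ} (t : TripodDart n) : TripodDart n := (t.1, t.2.1, !t.2.2)

/-- The starting point of a dart. -/
def src {n : ℕ} (t : TripodDart n) : TripodVertex n :=
  if t.2.2 then head t.1 t.2.1 else tail t.1 t.2.1

/-- The dart at the centre `j` towards hub `r`. -/
def leave {n : ℕ} (j : Fin n) : Fin 3 → TripodDart n :=
  ![(j, 0, false), (j, 1, false), (j, 2, false)]

/-- The dart at hub `r` towards the centre `j`. -/
def enter {n : ℕ} (j : Fin n) : Fin 3 → TripodDart n :=
  ![(j, 0, true), (j, 1, true), (j, 4, true)]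

theorem exists_dart_of_vertex {n : ℕ} (hn : 2 ≤ n) (v : TripodVertex n) :
    ∃ t : TripodDart n, src t = v := by
  rcases v with r | ⟨j, s⟩
  · refine ⟨enter ⟨0, by omega⟩ r, ?_⟩
    fin_cases r <;> rfl
  · fin_cases s
    · exact ⟨(j, 0, false), rfl⟩
    · exact ⟨(j, 3, false), rfl⟩
    · exact ⟨(j, 4, false), rfl⟩

end TripodDart

/-- A drawing of the tripod graph as a map: `α` rotates around the vertices, and `β` reverses the
darts of the graph and fixes everything else. -/
structure TripodMap (n : ℕ) {D : Type*} (α β : Equiv.Perm D) where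
  dart : TripodDart n → D
  label : D → TripodVertex n
  dart_injective : Function.Injective dart
  map_dart : ∀ t, β (dart t) = dart (TripodDart.rev t)
  map_eq_self : ∀ x, (¬ ∃ t, dart t = x) → β x = x
  label_dart : ∀ t, label (dart t) = TripodDart.src t
  label_map : ∀ x, label (α x) = label x
  sameCycle : ∀ x y, label x = label y → α.SameCycle x y

namespace TripodMap

open TripodDart

variable {n : ℕ} {D : Type*} [Finite D] {α β : Equiv.Perm D} (T : TripodMap n α β)

/-- A face that traverses `t` does not backtrack at the end of `t` if another dart starts there:
sides off the graph are fixed by `β`, so the face rotates past them to the next dart. -/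
theorem exists_turn (t : TripodDart n)
    (h : ∃ t' : TripodDart n, src t' = src (rev t) ∧ t' ≠ rev t) :
    ∃ t' : TripodDart n, src t' = src (rev t) ∧ t' ≠ rev t ∧
      (α * β).SameCycle (T.dart t) (T.dart t') := by
  obtain ⟨c, hc, hne⟩ := h
  obtain ⟨y, ⟨t', rfl⟩, h2, h3, h4⟩ := exists_sameCycle_mul α β (fun x => ∃ t, T.dart t = x)
    T.map_eq_self (T.dart t) (T.dart c)
    (by rw [T.map_dart]; exact T.sameCycle _ _ (by rw [T.label_dart, T.label_dart, hc]))
    ⟨c, rfl⟩ (by rw [T.map_dart]; exact fun h => hne (T.dart_injective h))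
  refine ⟨t', ?_, ?_, h4⟩
  · rw [T.map_dart] at h3
    obtain ⟨m, hm⟩ := h3.exists_nat_pow_eq
    have : ∀ m : ℕ, T.label ((α ^ m) (T.dart (rev t))) = T.label (T.dart (rev t)) := by
      intro m
      induction m with
      | zero => rfl
      | succ m ih => rw [pow_succ', Equiv.Perm.mul_apply, T.label_map, ih]
    rw [← T.label_dart, ← T.label_dart, ← hm, this]
  · rintro rfl
    exact h2 (T.map_dart t).symm

theorem turn_center (j : Fin n) (m : Fin 3) :
    ∃ r, r ≠ m ∧ (α * β).SameCycle (T.dart (rev (leave j m))) (T.dart (leave j r)) := by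
  have hrr : rev (rev (leave j m)) = leave j m := by simp [rev]
  obtain ⟨⟨j', m', b⟩, h1, h2, h3⟩ := T.exists_turn (rev (leave j m)) (by
    rw [hrr]
    refine ⟨leave j (m + 1), ?_, ?_⟩
    · fin_cases m <;> rfl
    · fin_cases m <;> simp [leave])
  rw [hrr] at h1 h2
  fin_cases m <;> fin_cases m' <;> cases b <;>
    simp [leave, src, tail, head] at h1 h2 <;> subst h1 <;>
    first
    | exact absurd rfl h2
    | exact ⟨0, by decide, h3⟩
    | exact ⟨1, by decide, h3⟩
    | exact ⟨2, by decide, h3⟩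

theorem turn_hub (hn : 2 ≤ n) (j : Fin n) (r : Fin 3) :
    ∃ j', j' ≠ j ∧ (α * β).SameCycle (T.dart (rev (enter j r))) (T.dart (enter j' r)) := by
  have hrr : rev (rev (enter j r)) = enter j r := by simp [rev]
  obtain ⟨j₁, hj₁⟩ : ∃ j₁ : Fin n, j₁ ≠ j := by
    have : Nontrivial (Fin n) := Fin.nontrivial_iff_two_le.2 hn
    exact exists_ne j
  obtain ⟨⟨j', m', b⟩, h1, h2, h3⟩ := T.exists_turn (rev (enter j r)) (by
    rw [hrr]
    refine ⟨enter j₁ r, ?_, ?_⟩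
    · fin_cases r <;> rfl
    · fin_cases r <;> simp [enter, hj₁])
  rw [hrr] at h1 h2
  refine ⟨j', ?_, ?_⟩
  · rintro rfl
    apply h2
    fin_cases r <;> fin_cases m' <;> cases b <;> simp [enter, src, tail, head] at h1 ⊢
  · convert h3 using 2
    fin_cases r <;> fin_cases m' <;> cases b <;> simp [enter, src, tail, head] at h1 ⊢

/-- A subdivision vertex has only two darts, so a face has to go straight on. -/
theorem turn_subdivision (j : Fin n) :
    (α * β).SameCycle (T.dart (j, 2, false)) (T.dart (j, 3, false)) ∧
    (α * β).SameCycle (T.dart (j, 3, false)) (T.dart (j, 4, false)) ∧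
    (α * β).SameCycle (T.dart (j, 4, true)) (T.dart (j, 3, true)) ∧
    (α * β).SameCycle (T.dart (j, 3, true)) (T.dart (j, 2, true)) := by
  refine ⟨?_, ?_, ?_, ?_⟩
  · obtain ⟨⟨j', m', b⟩, h1, h2, h3⟩ := T.exists_turn (j, 2, false)
      ⟨(j, 3, false), rfl, by simp [rev]⟩
    fin_cases m' <;> cases b <;> simp [rev, src, tail, head] at h1 h2 <;> subst h1 <;>
      first
      | exact absurd rfl h2
      | exact h3
  · obtain ⟨⟨j', m', b⟩, h1, h2, h3⟩ := T.exists_turn (j, 3, false)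
      ⟨(j, 4, false), rfl, by simp [rev]⟩
    fin_cases m' <;> cases b <;> simp [rev, src, tail, head] at h1 h2 <;> subst h1 <;>
      first
      | exact absurd rfl h2
      | exact h3
  · obtain ⟨⟨j', m', b⟩, h1, h2, h3⟩ := T.exists_turn (j, 4, true)
      ⟨(j, 3, true), rfl, by simp [rev]⟩
    fin_cases m' <;> cases b <;> simp [rev, src, tail, head] at h1 h2 <;> subst h1 <;>
      first
      | exact absurd rfl h2
      | exact h3
  · obtain ⟨⟨j', m', b⟩, h1, h2, h3⟩ := T.exists_turn (j, 3, true)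
      ⟨(j, 2, true), rfl, by simp [rev]⟩
    fin_cases m' <;> cases b <;> simp [rev, src, tail, head] at h1 h2 <;> subst h1 <;>
      first
      | exact absurd rfl h2
      | exact h3

theorem leave_to_enter (hn : 2 ≤ n) (j : Fin n) (r : Fin 3) :
    ∃ j', j' ≠ j ∧ (α * β).SameCycle (T.dart (leave j r)) (T.dart (enter j' r)) := by
  obtain ⟨j', h, h'⟩ := T.turn_hub hn j r
  refine ⟨j', h, ?_⟩
  fin_cases r
  · exact h'
  · exact h'
  · refine Equiv.Perm.SameCycle.trans ?_ h'
    exact (T.turn_subdivision j).1.trans (T.turn_subdivision j).2.1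

theorem enter_to_leave (j : Fin n) (r : Fin 3) :
    ∃ r', r' ≠ r ∧ (α * β).SameCycle (T.dart (enter j r)) (T.dart (leave j r')) := by
  obtain ⟨r', h, h'⟩ := T.turn_center j r
  refine ⟨r', h, ?_⟩
  fin_cases r
  · exact h'
  · exact h'
  · refine Equiv.Perm.SameCycle.trans ?_ h'
    exact (T.turn_subdivision j).2.2.1.trans (T.turn_subdivision j).2.2.2

theorem exists_leave_of_dart (hn : 2 ≤ n) (t : TripodDart n) :
    ∃ j r, (α * β).SameCycle (T.dart t) (T.dart (leave j r)) := by
  have hE : ∀ j r, ∃ j' r', (α * β).SameCycle (T.dart (enter j r)) (T.dart (leave j' r')) :=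
    fun j r => by
      obtain ⟨r', -, h⟩ := T.enter_to_leave j r
      exact ⟨j, r', h⟩
  have hL : ∀ j r, ∃ j' r', (α * β).SameCycle (T.dart (rev (enter j r)))
      (T.dart (leave j' r')) := fun j r => by
    obtain ⟨j₁, -, h⟩ := T.turn_hub hn j r
    obtain ⟨j', r', h'⟩ := hE j₁ r
    exact ⟨j', r', h.trans h'⟩
  have hC : ∀ j r, ∃ j' r', (α * β).SameCycle (T.dart (rev (leave j r)))
      (T.dart (leave j' r')) := fun j r => by
    obtain ⟨r', -, h⟩ := T.turn_center j r
    exact ⟨j, r', h⟩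
  obtain ⟨j, m, b⟩ := t
  fin_cases m <;> cases b
  · exact ⟨j, 0, Equiv.Perm.SameCycle.refl _ _⟩
  · exact hE j 0
  · exact ⟨j, 1, Equiv.Perm.SameCycle.refl _ _⟩
  · exact hE j 1
  · exact ⟨j, 2, Equiv.Perm.SameCycle.refl _ _⟩
  · exact hC j 2
  · obtain ⟨j', r', h⟩ := hL j 2
    exact ⟨j', r', (T.turn_subdivision j).2.1.trans h⟩
  · obtain ⟨j', r', h⟩ := hC j 2
    exact ⟨j', r', (T.turn_subdivision j).2.2.2.trans h⟩
  · exact hL j 2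
  · exact hE j 2

theorem exists_leave (hn : 2 ≤ n) (x : D) :
    ∃ j r, (α * β).SameCycle x (T.dart (leave j r)) := by
  by_cases hx : ∃ t, T.dart t = x
  · obtain ⟨t, rfl⟩ := hx
    exact T.exists_leave_of_dart hn t
  -- A side off the graph still starts at a vertex of the graph, and its face reaches a dart there.
  · obtain ⟨t, ht⟩ := exists_dart_of_vertex hn (T.label x)
    have hβ := T.map_eq_self x hx
    obtain ⟨y, ⟨t', rfl⟩, -, -, h⟩ := exists_sameCycle_mul α β (fun x => ∃ t, T.dart t = x)
      T.map_eq_self x (T.dart t)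
      (by rw [hβ]; exact T.sameCycle _ _ (by rw [T.label_dart, ht]))
      ⟨t, rfl⟩ (by rw [hβ]; exact fun h => hx ⟨t, h⟩)
    obtain ⟨j, r, h'⟩ := T.exists_leave_of_dart hn t'
    exact ⟨j, r, h.trans h'⟩

/-- Each of the 3n legs is entered from its centre and from its hub, which gives 6n marked darts in
all. A face alternates between the two kinds, changing the tripod at each hub and the hub at each
centre, so it contains at least four marked darts. -/
theorem four_mul_faces_le (T : TripodMap n α β) (hn : 2 ≤ n) : 4 * cycleCount (α * β) ≤ 6 * n := by
  classical
  let X := Fin n × Fin 3 × Bool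
  let sp : X → TripodDart n := fun s => if s.2.2 then enter s.1 s.2.1 else leave s.1 s.2.1
  let face : X → Quot (stepRel (α * β)) := fun s => Quot.mk _ (T.dart (sp s))
  have : Fintype (Quot (stepRel (α * β))) := Fintype.ofFinite _
  have hfib : ∀ q ∈ (Finset.univ : Finset (Quot (stepRel (α * β)))),
      4 ≤ (Finset.univ.filter fun s => face s = q).card := by
    rintro ⟨x⟩ -
    obtain ⟨j, r, h0⟩ := T.exists_leave hn x
    obtain ⟨j', hj, h1⟩ := T.leave_to_enter hn j r
    obtain ⟨r', hr, h2⟩ := T.enter_to_leave j' r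
    obtain ⟨j'', hj', h3⟩ := T.leave_to_enter hn j' r'
    have h1' := h0.trans h1
    have h2' := h1'.trans h2
    have h3' := h2'.trans h3
    have hsub : ({(j, r, false), (j', r, true), (j', r', false), (j'', r', true)} : Finset X)
        ⊆ Finset.univ.filter fun s => face s = Quot.mk _ x := by
      intro s hs
      simp only [Finset.mem_insert, Finset.mem_singleton] at hs
      rw [Finset.mem_filter]
      refine ⟨Finset.mem_univ _, ((quot_stepRel_eq_iff _ _ _).2 ?_).symm⟩
      rcases hs with rfl | rfl | rfl | rfl
      · exact h0
      · exact h1'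
      · exact h2'
      · exact h3'
    refine le_trans (le_of_eq ?_) (Finset.card_le_card hsub)
    rw [Finset.card_insert_of_notMem, Finset.card_insert_of_notMem, Finset.card_insert_of_notMem,
      Finset.card_singleton]
    · simp [X]
    · simp [X, hr.symm]
    · simp [X, hj.symm]
  have hle := Finset.card_nsmul_le_sum _ _ _ hfib
  rw [← Finset.card_eq_sum_card_fiberwise (fun s _ => Finset.mem_univ (face s))] at hle
  have hX : (Finset.univ : Finset X).card = 6 * n := by
    simp [X]
    ring
  rw [hX, Finset.card_univ, ← Nat.card_eq_fintype_card, smul_eq_mul, mul_comm] at hle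
  exact hle

/-- Euler's formula with 3 + 3n vertices, 5n edges, at most 3n/2 faces and at least one component:
the defect is at least 2 - (3 + 3n) + 5n - 3n/2 = n/2 - 1. -/
theorem le_two_mul_defect (T : TripodMap n α β) (hβ : ∀ x, β (β x) = x) (hn : 2 ≤ n) :
    (n : ℤ) - 2 ≤ 2 * defect α β := by
  have hF := T.four_mul_faces_le hn
  have hV : cycleCount α = 3 + n * 3 := by
    rw [cycleCount, classCount_eq_of_label T.label (fun x y h => by rw [← h, T.label_map])
      (fun v => by
        obtain ⟨t, ht⟩ := exists_dart_of_vertex hn v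
        exact ⟨T.dart t, by rw [T.label_dart, ht]⟩)
      (fun x y h => (quot_stepRel_eq_iff _ _ _).2 (T.sameCycle x y h))]
    simp
  have hE := (defect_nonneg α β hβ).2.2
  have hM : Nat.card {x // β x ≠ x} = n * 10 := by
    have : Nat.card (TripodDart n) = n * 10 := by simp
    rw [← this]
    refine (Nat.card_congr (Equiv.ofBijective
      (fun t => (⟨T.dart t, ?_⟩ : {x // β x ≠ x})) ⟨?_, ?_⟩)).symm
    · rw [T.map_dart]
      intro h
      have := congrArg (fun t => t.2.2) (T.dart_injective h)
      simp [rev] at this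
    · intro t t' h
      exact T.dart_injective (congrArg Subtype.val h)
    · rintro ⟨x, hx⟩
      by_contra hcon
      refine hx (T.map_eq_self x fun ⟨t, ht⟩ => hcon ⟨t, ?_⟩)
      exact Subtype.ext ht
  have hc : 1 ≤ classCount (stepRel₂ α β) := by
    have : Nonempty (Quot (stepRel₂ α β)) := ⟨Quot.mk _ (T.dart (⟨0, by omega⟩, 0, false))⟩
    exact Nat.card_pos
  rw [hM] at hE
  rw [defect, hV]
  push_cast at *
  omega

end TripodMap

/-! ### Surfaces as maps -/

namespace PolygonalSurface

variable {D : Type} (S : PolygonalSurface D)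

theorem rot_apply (d : D) : S.rot d = S.next (S.opp d) := rfl

theorem rot_mul_opp : S.rot * S.opp = S.next := by
  ext d
  simp [rot_apply, S.opp_opp]

theorem start_eq_iff (x y : D) : S.start x = S.start y ↔ S.rot.SameCycle x y := by
  constructor
  · exact fun h => Quotient.exact h
  · exact fun h => Quotient.sound h

theorem start_rot (d : D) : S.start (S.rot d) = S.start d :=
  (S.start_eq_iff _ _).2 ⟨-1, by simp⟩

theorem start_next (d : D) : S.start (S.next d) = S.start (S.opp d) := by
  rw [← S.start_rot (S.opp d), S.rot_apply, S.opp_opp]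

theorem start_surjective : Function.Surjective S.start := Quotient.mk_surjective

theorem two_mul_card_edge [Finite D] : 2 * Nat.card S.Edge = Nat.card D := by
  have h := (defect_nonneg S.rot S.opp S.opp_opp).2.2
  have h1 : Nat.card {x // S.opp x ≠ x} = Nat.card D :=
    Nat.card_congr (Equiv.subtypeUnivEquiv S.opp_ne)
  have h2 : Nat.card S.Edge = cycleCount S.opp := card_quotient_sameCycle _
  rw [h1, ← h2] at h
  omega

theorem classCount_stepRel₂ [Finite D] : classCount (stepRel₂ S.rot S.opp) = 1 := by
  obtain ⟨x₀⟩ := S.nonempty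
  have key : ∀ g ∈ Subgroup.closure ({S.next, S.opp} : Set (Equiv.Perm D)), ∀ x,
      Quot.mk (stepRel₂ S.rot S.opp) (g x) = Quot.mk _ x := by
    intro g hg
    induction hg using Subgroup.closure_induction with
    | mem g hg =>
      intro x
      have hopp : ∀ x, Quot.mk (stepRel₂ S.rot S.opp) (S.opp x) = Quot.mk _ x :=
        fun x => (Quot.sound (r := stepRel₂ S.rot S.opp) (Or.inr rfl)).symm
      rcases hg with rfl | rfl
      · rw [← hopp x]
        refine (Quot.sound (r := stepRel₂ S.rot S.opp) (Or.inl ?_)).symm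
        rw [S.rot_apply, S.opp_opp]
      · exact hopp x
    | one => exact fun _ => rfl
    | mul g h _ _ hg hh => exact fun x => by rw [Equiv.Perm.mul_apply, hg, hh]
    | inv g _ hg => exact fun x => by simpa using (hg (g⁻¹ x)).symm
  have : Unique (Quot (stepRel₂ S.rot S.opp)) :=
    { default := Quot.mk _ x₀
      uniq := by
        rintro ⟨x⟩
        obtain ⟨g, hg, rfl⟩ := S.connected x₀ x
        exact key g hg x₀ }
  exact Nat.card_unique

theorem defect_eq [Finite D] : defect S.rot S.opp = 2 - S.eulerChar := by
  have hV : Nat.card S.Vertex = cycleCount S.rot := card_quotient_sameCycle _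
  have hE : Nat.card S.Edge = cycleCount S.opp := card_quotient_sameCycle _
  have hF : Nat.card S.Face = cycleCount S.next := card_quotient_sameCycle _
  have h := S.two_mul_card_edge
  rw [defect, S.rot_mul_opp, S.classCount_stepRel₂, eulerChar, ← hV, ← hE, ← hF]
  push_cast
  omega

/-- The defect is nonnegative and even, so it is twice a natural number. Lower bounds on the Euler
characteristic therefore suffice for the constructions. -/
theorem exists_isGenus_le [Finite D] {g : ℕ} (h : 2 - 2 * (g : ℤ) ≤ S.eulerChar) :
    ∃ h ≤ g, S.IsGenus h := by
  obtain ⟨h1, ⟨k, hk⟩, -⟩ := defect_nonneg S.rot S.opp S.opp_opp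
  rw [S.defect_eq] at h1 hk
  refine ⟨k.toNat, by omega, ?_⟩
  rw [IsGenus]
  omega

/-- Two vertices are joined by an edge of the surface. -/
def Joined (u v : S.Vertex) : Prop := ∃ d, S.start d = u ∧ S.start (S.opp d) = v

variable {S} in
theorem Joined.symm {u v : S.Vertex} (h : S.Joined u v) : S.Joined v u := by
  obtain ⟨d, h1, h2⟩ := h
  exact ⟨S.opp d, h2, by rwa [S.opp_opp]⟩

/-- A simple graph embeds as soon as its vertices can be placed injectively so that adjacent
vertices are joined. -/
theorem nonempty_embedding {V : Type*} (Γ : SimpleGraph V) (f : V → S.Vertex)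
    (hf : Function.Injective f) (hadj : ∀ u v, Γ.Adj u v → S.Joined (f u) (f v)) :
    Nonempty (S.Embedding Γ) := by
  classical
  -- The order picks one direction of each edge; the other direction is then forced to be its
  -- reversal.
  let : LinearOrder V := IsWellOrder.linearOrder WellOrderingRel
  choose c hc using hadj
  let on : Γ.Dart → D := fun e =>
    if e.fst < e.snd then c e.fst e.snd e.adj else S.opp (c e.snd e.fst e.adj.symm)
  have h1 : ∀ e, S.start (on e) = f e.fst := by
    intro e
    by_cases h : e.fst < e.snd
    · simp only [on, h, if_true, hc]
    · simp only [on, h, if_false, hc]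
  have h2 : ∀ e, on e.symm = S.opp (on e) := by
    rintro ⟨⟨u, v⟩, huv⟩
    change (if v < u then c v u huv.symm else S.opp (c u v huv))
      = S.opp (if u < v then c u v huv else S.opp (c v u huv.symm))
    rcases lt_trichotomy u v with h | h | h
    · rw [if_pos h, if_neg h.asymm]
    · exact absurd h huv.ne
    · rw [if_pos h, if_neg h.asymm, S.opp_opp]
  refine ⟨⟨f, on, hf, ?_, h1, h2⟩⟩
  intro e e' he
  have h3 : e.fst = e'.fst := hf (by rw [← h1, ← h1, he])
  have h4 : e.snd = e'.snd := hf (by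
    have := h1 e.symm
    have h' := h1 e'.symm
    rw [h2] at this h'
    rw [he, h'] at this
    exact this.symm)
  exact SimpleGraph.Dart.ext _ _ (Prod.ext h3 h4)

end PolygonalSurface

/-- If the disjoint union of copies of the tripod graph maps injectively to a graph, then the
genus of the graph is at least the sum of the genera of the copies. -/
theorem EmbedsInGenus.card_mul_le {V : Type*} {Γ : SimpleGraph V} {h : ℕ} (H : EmbedsInGenus Γ h)
    {ι : Type*} [Fintype ι] {n m : ℕ} (hn : 2 ≤ n) (hm : 4 * m < n + 2)
    (g : ι × TripodVertex n → V) (hg : Function.Injective g)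
    (hadj : ∀ i t, Γ.Adj (g (i, TripodDart.src t)) (g (i, TripodDart.src (TripodDart.rev t)))) :
    Fintype.card ι * m ≤ h := by
  classical
  obtain ⟨D, _, S, hS, ⟨emb⟩⟩ := H
  have hrr : ∀ t : TripodDart n, TripodDart.rev (TripodDart.rev t) = t := fun t => by
    simp [TripodDart.rev]
  let e : ι → TripodDart n → D := fun i t => emb.onDart ⟨(_, _), hadj i t⟩
  have he_start : ∀ i t, S.start (e i t) = emb.onVertex (g (i, TripodDart.src t)) :=
    fun i t => emb.start_onDart _
  have he_opp : ∀ i t, S.opp (e i t) = e i (TripodDart.rev t) := fun i t => by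
    change S.opp (emb.onDart _) = emb.onDart _
    rw [← emb.onDart_symm]
    congr 1
    apply SimpleGraph.Dart.ext
    simp [hrr]
  have hsrc : ∀ t t' : TripodDart n, TripodDart.src t = TripodDart.src t' →
      TripodDart.src (TripodDart.rev t) = TripodDart.src (TripodDart.rev t') → t = t' := by
    rintro ⟨j, m, b⟩ ⟨j', m', b'⟩
    fin_cases m <;> cases b <;> fin_cases m' <;> cases b' <;>
      simp +contextual [TripodDart.src, TripodDart.rev, TripodDart.head, TripodDart.tail]
  have he_inj : ∀ i, Function.Injective (e i) := by
    intro i t t' ht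
    have h1 := he_start i t
    have h2 := he_start i (TripodDart.rev t)
    rw [← he_opp, ht, he_opp, he_start] at h2
    rw [ht, he_start] at h1
    have h3 := hg (emb.onVertex_injective h1)
    have h4 := hg (emb.onVertex_injective h2)
    simp only [Prod.mk.injEq, true_and] at h3 h4
    exact hsrc _ _ h3.symm h4.symm
  -- The value `none` marks the sides that start at no tripod vertex; they form one more invariant
  -- piece, on which only nonnegativity of the defect is used.
  have hlab : ∀ d : D, ∃ o : Option (ι × TripodVertex n),
      ∀ q, o = some q ↔ emb.onVertex (g q) = S.start d := by
    intro d
    by_cases hd : ∃ q, emb.onVertex (g q) = S.start d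
    · obtain ⟨q, hq⟩ := hd
      refine ⟨some q, fun q' => ⟨?_, ?_⟩⟩
      · rintro ⟨⟩
        exact hq
      · intro hq'
        rw [hg (emb.onVertex_injective (hq.trans hq'.symm))]
    · exact ⟨none, fun q => ⟨fun h => (by cases h), fun h => absurd ⟨q, h⟩ hd⟩⟩
  choose lab hlab using hlab
  have lab_congr : ∀ x y, S.start x = S.start y → lab x = lab y := by
    intro x y hxy
    ext q
    rw [hlab, hlab, hxy]
  let f : D → Option ι := fun d => (lab d).map Prod.fst
  have hf_e : ∀ i t, lab (e i t) = some (i, TripodDart.src t) := fun i t => by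
    rw [hlab, he_start]
  let P : D → Prop := fun d => ∃ i t, e i t = d
  have hP : ∀ d, P d → P (S.opp d) := by
    rintro _ ⟨i, t, rfl⟩
    exact ⟨i, TripodDart.rev t, (he_opp i t).symm⟩
  -- This deletes all edges outside the tripods. Deleted sides remain as fixed points, so that the
  -- rotation need not be changed.
  let β : Equiv.Perm D := Function.Involutive.toPerm (fun d => if P d then S.opp d else d) (by
    intro d
    by_cases hd : P d
    · simp only [hd, hP d hd, if_true, S.opp_opp]
    · simp only [hd, if_false])
  have hβP : ∀ d, P d → β d = S.opp d := fun d hd => if_pos hd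
  have hβn : ∀ d, ¬ P d → β d = d := fun d hd => if_neg hd
  have hββ : ∀ d, β (β d) = d := Function.Involutive.toPerm_involutive _
  have hβe : ∀ i t, β (e i t) = e i (TripodDart.rev t) := fun i t => by
    rw [hβP _ ⟨i, t, rfl⟩, he_opp]
  have hα : ∀ x, f (S.rot x) = f x := fun x =>
    congrArg (Option.map Prod.fst) (lab_congr _ _ (S.start_rot x))
  have hβ : ∀ x, f (β x) = f x := by
    intro x
    by_cases hx : P x
    · obtain ⟨i, t, rfl⟩ := hx
      simp only [f, hβe, hf_e, Option.map_some]
    · rw [hβn x hx]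
  have hle := (defect_mono S.rot β hββ S.opp S.opp_opp (fun x => by
    by_cases hx : P x
    · exact Or.inr (hβP x hx)
    · exact Or.inl (hβn x hx))).1
  rw [S.defect_eq, hS, defect_sum S.rot β f hα hβ, Fintype.sum_option] at hle
  have hnone := (defect_nonneg (S.rot.subtypePerm (p := fun x => f x = none) (fun x => by rw [hα]))
    (β.subtypePerm (p := fun x => f x = none) (fun x => by rw [hβ]))
    (fun x => Subtype.ext (hββ x))).1
  have hsome : ∀ i, 2 * (m : ℤ) ≤
      defect (S.rot.subtypePerm (p := fun x => f x = some i) (fun x => by rw [hα]))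
        (β.subtypePerm (p := fun x => f x = some i) (fun x => by rw [hβ])) := by
    intro i
    have hlabel : ∀ x : {x // f x = some i},
        lab x = some (i, (lab x).elim (Sum.inl 0) Prod.snd) := by
      rintro ⟨x, hx⟩
      obtain ⟨q, hq, rfl⟩ := Option.map_eq_some_iff.1 hx
      simp [hq]
    let T : TripodMap n (S.rot.subtypePerm (p := fun x => f x = some i) (fun x => by rw [hα]))
        (β.subtypePerm (p := fun x => f x = some i) (fun x => by rw [hβ])) :=
      { dart := fun t => ⟨e i t, by simp [f, hf_e]⟩
        -- The default `Sum.inl 0` is never taken, since `lab x` is not `none` on this piece.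
        label := fun x => (lab x).elim (Sum.inl 0) Prod.snd
        dart_injective := fun t t' ht => he_inj i (congrArg Subtype.val ht)
        map_dart := fun t => Subtype.ext (hβe i t)
        map_eq_self := by
          rintro ⟨x, hx⟩ hcon
          refine Subtype.ext (hβn x ?_)
          rintro ⟨i', t, rfl⟩
          simp only [f, hf_e, Option.map_some, Option.some.injEq] at hx
          subst hx
          exact hcon ⟨t, rfl⟩
        label_dart := fun t => by simp [hf_e]
        label_map := fun x => by
          change (lab (S.rot x)).elim _ _ = _
          rw [lab_congr _ _ (S.start_rot x)]
        sameCycle := by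
          intro x y hxy
          rw [Equiv.Perm.sameCycle_subtypePerm, ← S.start_eq_iff]
          have h1 := hlabel x
          have h2 := hlabel y
          rw [hxy] at h1
          rw [hlab] at h1 h2
          rw [← h1, ← h2] }
    have hinv : ∀ x, (β.subtypePerm (p := fun x => f x = some i) (fun x => by rw [hβ]))
        ((β.subtypePerm (p := fun x => f x = some i) (fun x => by rw [hβ])) x) = x :=
      fun x => Subtype.ext (hββ x)
    have h1 := T.le_two_mul_defect hinv hn
    obtain ⟨k, hk⟩ := (defect_nonneg (S.rot.subtypePerm (p := fun x => f x = some i)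
      (fun x => by rw [hα])) _ hinv).2.1
    -- The defect is an even number 2k with 4k ≥ n - 2 > 4m - 4, hence k ≥ m.
    omega
  have hsum := Finset.card_nsmul_le_sum Finset.univ _ _ (fun i _ => hsome i)
  rw [Finset.card_univ, nsmul_eq_mul] at hsum
  have : (Fintype.card ι : ℤ) * (2 * m) ≤ 2 * h := by linarith
  have h2 : Fintype.card ι * (2 * m) ≤ 2 * h := by exact_mod_cast this
  linarith

/-! ### Building surfaces -/

/-- The orbit relation of the group is itself an equivalence stable under both generators.
Connectedness may thus be checked against an arbitrary stable equivalence. -/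
theorem exists_mem_closure_pair {D : Type*} {f g : Equiv.Perm D} {x y : D}
    (h : ∀ E : Setoid D, (∀ z, E (f z) z) → (∀ z, E (g z) z) → E x y) :
    ∃ k ∈ Subgroup.closure ({f, g} : Set (Equiv.Perm D)), k x = y := by
  have hf : f ∈ Subgroup.closure ({f, g} : Set (Equiv.Perm D)) := Subgroup.subset_closure (by simp)
  have hg : g ∈ Subgroup.closure ({f, g} : Set (Equiv.Perm D)) := Subgroup.subset_closure (by simp)
  refine h ⟨fun x y => ∃ k ∈ Subgroup.closure ({f, g} : Set (Equiv.Perm D)), k x = y,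
    fun x => ⟨1, one_mem _, rfl⟩, ?_, ?_⟩ ?_ ?_
  · rintro x _ ⟨k, hk, rfl⟩
    exact ⟨k⁻¹, inv_mem hk, by simp⟩
  · rintro x _ _ ⟨k, hk, rfl⟩ ⟨l, hl, rfl⟩
    exact ⟨l * k, mul_mem hl hk, rfl⟩
  · exact fun z => ⟨f⁻¹, inv_mem hf, by simp⟩
  · exact fun z => ⟨g⁻¹, inv_mem hg, by simp⟩

namespace PolygonalSurface

variable {D : Type} (S : PolygonalSurface D)

/-- The face to the left of a directed side. -/
def face (d : D) : S.Face := Quotient.mk (Equiv.Perm.SameCycle.setoid S.next) d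

theorem face_next (d : D) : S.face (S.next d) = S.face d :=
  Quotient.sound (s := Equiv.Perm.SameCycle.setoid S.next) ⟨-1, by simp⟩

theorem setoid_of_connected (E : Setoid D) (h₁ : ∀ z, E (S.next z) z) (h₂ : ∀ z, E (S.opp z) z)
    (x y : D) : E x y := by
  obtain ⟨g, hg, rfl⟩ := S.connected x y
  induction hg using Subgroup.closure_induction generalizing x with
  | mem g hg =>
    rcases hg with rfl | rfl
    · exact E.symm (h₁ x)
    · exact E.symm (h₂ x)
  | one => exact E.refl x
  | mul g k _ _ hg hk => exact E.trans (hk x) (hg (k x))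
  | inv g _ hg => exact E.symm (by simpa using hg (g⁻¹ x))

/-- Labels of the directed sides that are constant around the vertices, respectively around the
faces, bound the Euler characteristic from below. -/
theorem le_two_mul_eulerChar [Finite D] {N M : Type*} (ν : D → N) (μ : D → M)
    (hν : ∀ d, ν (S.next d) = ν (S.opp d)) (hν' : Function.Surjective ν)
    (hμ : ∀ d, μ (S.next d) = μ d) (hμ' : Function.Surjective μ) :
    2 * (Nat.card N : ℤ) + 2 * Nat.card M - Nat.card D ≤ 2 * S.eulerChar := by
  have hV : Nat.card S.Vertex = cycleCount S.rot := card_quotient_sameCycle _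
  have hF : Nat.card S.Face = cycleCount S.next := card_quotient_sameCycle _
  have h1 : Nat.card N ≤ cycleCount S.rot := classCount_le_of_surjective ν (by
    rintro x _ rfl
    rw [S.rot_apply, hν, S.opp_opp]) hν'
  have h2 : Nat.card M ≤ cycleCount S.next := classCount_le_of_surjective μ (by
    rintro x _ rfl
    rw [hμ]) hμ'
  have h3 := S.two_mul_card_edge
  rw [eulerChar, hV, hF]
  omega

/-! ### Inserting new vertices into corners of faces -/

section Star

variable {J : Type} (d : J → D)

/-- The new directed sides: for each `j`, the third component tells whether the side leaves the
new vertex `j`, and the second one tells which corner of the triangle it leads to. -/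
abbrev StarDart (D J : Type) : Type := D ⊕ J × Fin 3 × Bool

open Classical in
/-- The side `y`, or the first new side inserted in front of it. -/
noncomputable def starOut (y : D) : StarDart D J :=
  if h : ∃ j, d j = y then .inr (h.choose, 0, false) else .inl y

open Classical in
/-- The side following `z` after the new vertices are inserted. -/
noncomputable def starNext : StarDart D J → StarDart D J
  | .inl x =>
    if h : ∃ j, d j = x then .inr (h.choose, 1, false)
    else if h : ∃ j, S.next (d j) = x then .inr (h.choose, 2, false)
    else starOut d (S.next x)
  | .inr (j, 0, false) => .inr (j, 2, true)
  | .inr (j, 1, false) => .inr (j, 0, true)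
  | .inr (j, 2, false) => .inr (j, 1, true)
  | .inr (j, 0, true) => .inl (d j)
  | .inr (j, 1, true) => .inl (S.next (d j))
  | .inr (j, 2, true) => starOut d (S.next (S.next (d j)))

/-- The reversed side. -/
def starOpp : StarDart D J → StarDart D J
  | .inl x => .inl (S.opp x)
  | .inr (j, r, b) => .inr (j, r, !b)

variable {d} (hd : Function.Injective d) (hn : ∀ j j', S.next (d j) ≠ d j')

include hd in
theorem starOut_apply (j : J) : starOut d (d j) = .inr (j, 0, false) := by
  have h : ∃ j', d j' = d j := ⟨j, rfl⟩
  rw [starOut, dif_pos h, hd h.choose_spec]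

theorem starOut_of_ne {y : D} (h : ∀ j, d j ≠ y) : starOut d y = .inl y := by
  rw [starOut, dif_neg]
  rintro ⟨j, hj⟩
  exact h j hj

include hd in
theorem starNext_corner (j : J) : S.starNext d (.inl (d j)) = .inr (j, 1, false) := by
  have h : ∃ j', d j' = d j := ⟨j, rfl⟩
  rw [starNext, dif_pos h, hd h.choose_spec]

include hd hn in
theorem starNext_next_corner (j : J) :
    S.starNext d (.inl (S.next (d j))) = .inr (j, 2, false) := by
  have h : ∃ j', S.next (d j') = S.next (d j) := ⟨j, rfl⟩
  rw [starNext, dif_neg, dif_pos h, hd (S.next.injective h.choose_spec)]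
  rintro ⟨j', hj'⟩
  exact hn j j' hj'.symm

theorem starNext_of_ne {x : D} (h₁ : ∀ j, d j ≠ x) (h₂ : ∀ j, S.next (d j) ≠ x) :
    S.starNext d (.inl x) = starOut d (S.next x) := by
  rw [starNext, dif_neg, dif_neg]
  · rintro ⟨j, hj⟩
    exact h₂ j hj
  · rintro ⟨j, hj⟩
    exact h₁ j hj

include hd hn in
theorem starNext_surjective : Function.Surjective (S.starNext d) := by
  -- The sides `S.next (d j)` are excluded because they now follow a new side, `(j, 1, true)`.
  have hout : ∀ y, (∀ j, S.next (d j) ≠ y) → ∃ z, S.starNext d z = starOut d y := by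
    intro y hy
    have h1 : ∀ j, d j ≠ S.next.symm y := fun j hj => hy j (by simp [hj])
    by_cases h2 : ∃ j, S.next (d j) = S.next.symm y
    · obtain ⟨j, hj⟩ := h2
      exact ⟨.inr (j, 2, true), by simp [starNext, hj]⟩
    · push Not at h2
      exact ⟨.inl (S.next.symm y), by rw [S.starNext_of_ne h1 h2]; simp⟩
  rintro (y | ⟨j, r, b⟩)
  · by_cases h1 : ∃ j, d j = y
    · obtain ⟨j, rfl⟩ := h1
      exact ⟨.inr (j, 0, true), rfl⟩
    · by_cases h2 : ∃ j, S.next (d j) = y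
      · obtain ⟨j, rfl⟩ := h2
        exact ⟨.inr (j, 1, true), rfl⟩
      · push Not at h1 h2
        obtain ⟨z, hz⟩ := hout y h2
        exact ⟨z, by rw [hz, starOut_of_ne h1]⟩
  · fin_cases r <;> cases b
    · obtain ⟨z, hz⟩ := hout (d j) (fun j' => hn j' j)
      exact ⟨z, by rw [hz, starOut_apply hd]; rfl⟩
    · exact ⟨.inr (j, 1, false), rfl⟩
    · exact ⟨.inl (d j), S.starNext_corner hd j⟩
    · exact ⟨.inr (j, 2, false), rfl⟩
    · exact ⟨.inl (S.next (d j)), S.starNext_next_corner hd hn j⟩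
    · exact ⟨.inr (j, 0, false), rfl⟩

theorem starOpp_starOpp (z : StarDart D J) : S.starOpp (S.starOpp z) = z := by
  rcases z with x | ⟨j, r, b⟩ <;> simp [starOpp, S.opp_opp]

include hd hn in
-- New sides are only inserted between consecutive old sides around an old vertex, so going around
-- it still leads from `x` to `S.rot x`. Used with an arbitrary stable equivalence for
-- connectedness, and with the kernel of `start` for the map on vertices.
theorem setoid_starRot (E : Setoid (StarDart D J))
    (hE : ∀ z, E (S.starNext d (S.starOpp z)) z) (x : D) : E (.inl (S.rot x)) (.inl x) := by
  have hout : ∀ y, E (.inl y) (starOut d y) := by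
    intro y
    by_cases h : ∃ j, d j = y
    · obtain ⟨j, rfl⟩ := h
      rw [starOut_apply hd]
      exact hE (.inr (j, 0, false))
    · push Not at h
      rw [starOut_of_ne h]
  have hx : E (S.starNext d (.inl (S.opp x))) (.inl x) := hE (.inl x)
  refine E.trans ?_ hx
  rw [S.rot_apply]
  by_cases h1 : ∃ j, d j = S.opp x
  · obtain ⟨j, hj⟩ := h1
    rw [← hj, S.starNext_corner hd]
    exact hE (.inr (j, 1, false))
  · by_cases h2 : ∃ j, S.next (d j) = S.opp x
    · obtain ⟨j, hj⟩ := h2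
      rw [← hj, S.starNext_next_corner hd hn]
      exact E.trans (hout _) (hE (.inr (j, 2, false)))
    · push Not at h1 h2
      rw [S.starNext_of_ne h1 h2]
      exact hout _

/-- The surface `S` with a new vertex `j` in the face of each corner `d j`, `S.next (d j)`, joined
to the three vertices of the two sides of this corner. -/
noncomputable def star [Finite D] [Finite J] : PolygonalSurface (StarDart D J) where
  next := Equiv.ofBijective (S.starNext d)
    (Finite.surjective_iff_bijective.1 (S.starNext_surjective hd hn))
  opp := Function.Involutive.toPerm S.starOpp S.starOpp_starOpp
  opp_opp := S.starOpp_starOpp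
  opp_ne := by
    rintro (x | ⟨j, r, b⟩) h
    · exact S.opp_ne x (Sum.inl_injective h)
    · have := congrArg (fun t => t.2.2) (Sum.inr_injective h)
      simp at this
  nonempty := S.nonempty.map .inl
  connected := by
    intro x y
    refine exists_mem_closure_pair fun E h₁ h₂ => ?_
    change ∀ z, E (S.starNext d z) z at h₁
    change ∀ z, E (S.starOpp z) z at h₂
    have hrot := S.setoid_starRot hd hn E fun z => E.trans (h₁ _) (h₂ _)
    have hold : ∀ x y, E (.inl x) (.inl y) :=
      S.setoid_of_connected (E.comap Sum.inl)
        (fun z => by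
          have h3 := hrot (S.opp z)
          rw [S.rot_apply, S.opp_opp] at h3
          exact E.trans h3 (h₂ (.inl z)))
        (fun z => h₂ (.inl z))
    have hall : ∀ z, ∃ x, E z (.inl x) := by
      have hrev : ∀ z, (∃ x, E z (.inl x)) → ∃ x, E (S.starOpp z) (.inl x) :=
        fun z ⟨x, hx⟩ => ⟨x, E.trans (h₂ z) hx⟩
      have h0 : ∀ j, ∃ x, E (.inr (j, 0, true)) (.inl x) :=
        fun j => ⟨d j, E.symm (h₁ (.inr (j, 0, true)))⟩
      have h1 : ∀ j, ∃ x, E (.inr (j, 1, true)) (.inl x) :=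
        fun j => ⟨S.next (d j), E.symm (h₁ (.inr (j, 1, true)))⟩
      have h2 : ∀ j, ∃ x, E (.inr (j, 2, false)) (.inl x) :=
        fun j => ⟨S.next (d j), by
          rw [← S.starNext_next_corner hd hn]
          exact h₁ _⟩
      rintro (x | ⟨j, r, b⟩)
      · exact ⟨x, E.refl _⟩
      · fin_cases r <;> cases b
        · exact hrev _ (h0 j)
        · exact h0 j
        · exact hrev _ (h1 j)
        · exact h1 j
        · exact h2 j
        · exact hrev _ (h2 j)
    obtain ⟨x', hx⟩ := hall x
    obtain ⟨y', hy⟩ := hall y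
    exact E.trans hx (E.trans (hold x' y') (E.symm hy))

/-- The vertex of `S`, or the new vertex, at which a directed side of `S.star` starts. -/
def starLabel (d : J → D) : StarDart D J → S.Vertex ⊕ J
  | .inl x => .inl (S.start x)
  | .inr (j, r, false) =>
    .inl (![S.start (d j), S.start (S.next (d j)), S.start (S.next (S.next (d j)))] r)
  | .inr (j, _, true) => .inr j

include hd hn in
theorem starLabel_starNext (z : StarDart D J) :
    S.starLabel d (S.starNext d z) = S.starLabel d (S.starOpp z) := by
  have hout : ∀ y, S.starLabel d (starOut d y) = .inl (S.start y) := by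
    intro y
    by_cases h : ∃ j, d j = y
    · obtain ⟨j, rfl⟩ := h
      rw [starOut_apply hd]
      rfl
    · push Not at h
      rw [starOut_of_ne h]
      rfl
  rcases z with x | ⟨j, r, b⟩
  · by_cases h1 : ∃ j, d j = x
    · obtain ⟨j, rfl⟩ := h1
      rw [S.starNext_corner hd]
      exact congrArg Sum.inl (S.start_next _)
    · by_cases h2 : ∃ j, S.next (d j) = x
      · obtain ⟨j, rfl⟩ := h2
        rw [S.starNext_next_corner hd hn]
        exact congrArg Sum.inl (S.start_next _)
      · push Not at h1 h2
        rw [S.starNext_of_ne h1 h2, hout]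
        exact congrArg Sum.inl (S.start_next _)
  · fin_cases r <;> cases b <;> first | rfl | exact hout _

section

variable [Finite D] [Finite J]

theorem star_next (z : StarDart D J) : (S.star hd hn).next z = S.starNext d z := rfl

theorem star_opp (z : StarDart D J) : (S.star hd hn).opp z = S.starOpp z := rfl

/-- Each insertion adds one vertex, three edges and two triangles, with total contribution 0. An
inequality is enough, so it suffices to exhibit surjective labels of vertices and faces. -/
theorem eulerChar_le_star : S.eulerChar ≤ (S.star hd hn).eulerChar := by
  classical
  -- `(j, false)` and `(j, true)` are the triangles cut off at `d j` and `S.next (d j)`; the rest of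
  -- each face keeps its old label.
  let μ : StarDart D J → S.Face ⊕ J × Bool := fun z =>
    match z with
    | .inl x => if h : ∃ j, d j = x then .inr (h.choose, false)
        else if h : ∃ j, S.next (d j) = x then .inr (h.choose, true) else .inl (S.face x)
    | .inr (j, 0, false) => .inl (S.face (d j))
    | .inr (j, 1, false) => .inr (j, false)
    | .inr (j, 2, false) => .inr (j, true)
    | .inr (j, 0, true) => .inr (j, false)
    | .inr (j, 1, true) => .inr (j, true)
    | .inr (j, 2, true) => .inl (S.face (d j))
  have μ1 : ∀ j, μ (.inl (d j)) = .inr (j, false) := by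
    intro j
    have h : ∃ j', d j' = d j := ⟨j, rfl⟩
    simp only [μ]
    rw [dif_pos h, hd h.choose_spec]
  have μ2 : ∀ j, μ (.inl (S.next (d j))) = .inr (j, true) := by
    intro j
    have h : ∃ j', S.next (d j') = S.next (d j) := ⟨j, rfl⟩
    simp only [μ]
    rw [dif_neg, dif_pos h, hd (S.next.injective h.choose_spec)]
    rintro ⟨j', hj'⟩
    exact hn j j' hj'.symm
  have μ3 : ∀ x, (∀ j, d j ≠ x) → (∀ j, S.next (d j) ≠ x) → μ (.inl x) = .inl (S.face x) := by
    intro x h1 h2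
    simp only [μ]
    rw [dif_neg (fun ⟨j, hj⟩ => h1 j hj), dif_neg (fun ⟨j, hj⟩ => h2 j hj)]
  have hout : ∀ y, (∀ j, S.next (d j) ≠ y) → μ (starOut d y) = .inl (S.face y) := by
    intro y hy
    by_cases h : ∃ j, d j = y
    · obtain ⟨j, rfl⟩ := h
      rw [starOut_apply hd]
    · push Not at h
      rw [starOut_of_ne h, μ3 y h hy]
  have h := (S.star hd hn).le_two_mul_eulerChar (S.starLabel d) μ
    (S.starLabel_starNext hd hn)
    (by
      rintro (v | j)
      · obtain ⟨x, rfl⟩ := S.start_surjective v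
        exact ⟨.inl x, rfl⟩
      · exact ⟨.inr (j, 0, true), rfl⟩)
    (by
      intro z
      rw [star_next]
      rcases z with x | ⟨j, r, b⟩
      · by_cases h1 : ∃ j, d j = x
        · obtain ⟨j, rfl⟩ := h1
          rw [S.starNext_corner hd, μ1]
        · by_cases h2 : ∃ j, S.next (d j) = x
          · obtain ⟨j, rfl⟩ := h2
            rw [S.starNext_next_corner hd hn, μ2]
          · push Not at h1 h2
            rw [S.starNext_of_ne h1 h2, hout _ (fun j hj => h1 j (S.next.injective hj)), μ3 x h1 h2,
              S.face_next]
      · fin_cases r <;> cases b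
        · rfl
        · exact μ1 j
        · rfl
        · exact μ2 j
        · rfl
        · refine (hout _ fun j' hj' => hn j j' (S.next.injective hj').symm).trans ?_
          rw [S.face_next, S.face_next])
    (by
      rintro (f | ⟨j, b⟩)
      · obtain ⟨x, rfl⟩ : ∃ x, S.face x = f := Quotient.mk_surjective f
        by_cases h1 : ∃ j, d j = x
        · obtain ⟨j, rfl⟩ := h1
          exact ⟨.inr (j, 0, false), rfl⟩
        · by_cases h2 : ∃ j, S.next (d j) = x
          · obtain ⟨j, rfl⟩ := h2
            exact ⟨.inr (j, 0, false), by rw [S.face_next]⟩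
          · push Not at h1 h2
            exact ⟨.inl x, μ3 x h1 h2⟩
      · cases b
        · exact ⟨.inr (j, 1, false), rfl⟩
        · exact ⟨.inr (j, 2, false), rfl⟩)
  have hVfin : Finite S.Vertex := Finite.of_surjective _ S.start_surjective
  have hFfin : Finite S.Face := Finite.of_surjective S.face Quotient.mk_surjective
  simp only [Nat.card_sum, Nat.card_prod, Nat.card_eq_fintype_card (α := Bool),
    Nat.card_eq_fintype_card (α := Fin 3), Fintype.card_bool, Fintype.card_fin] at h
  have hE := S.two_mul_card_edge
  rw [eulerChar]
  push_cast at h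
  omega

/-- Old vertices survive by `setoid_starRot`. They stay distinct from each other and from the new
ones because `starLabel` descends to a left inverse. -/
theorem exists_star :
    ∃ (up : S.Vertex → (S.star hd hn).Vertex) (w : J → (S.star hd hn).Vertex),
      Function.Injective (Sum.elim up w) ∧
      (∀ x, (S.star hd hn).start (.inl x) = up (S.start x)) ∧
      ∀ j r b, (S.star hd hn).start (.inr (j, r, b)) = bif b then w j else
        up (![S.start (d j), S.start (S.next (d j)), S.start (S.next (S.next (d j)))] r) := by
  have hstep : ∀ z, (S.star hd hn).start (S.starNext d (S.starOpp z)) = (S.star hd hn).start z :=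
    fun z => (S.star hd hn).start_rot z
  have hrot := S.setoid_starRot hd hn (Setoid.ker (S.star hd hn).start) hstep
  have hpow : ∀ x (k : ℕ), (S.star hd hn).start (.inl ((S.rot ^ k) x))
      = (S.star hd hn).start (.inl x) := by
    intro x k
    induction k with
    | zero => rfl
    | succ k ih => rw [pow_succ', Equiv.Perm.mul_apply, ← ih]; exact hrot _
  let up : S.Vertex → (S.star hd hn).Vertex :=
    Quotient.lift (fun x => (S.star hd hn).start (.inl x)) (by
      intro x y hxy
      obtain ⟨k, rfl⟩ := Equiv.Perm.SameCycle.exists_nat_pow_eq hxy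
      exact (hpow x k).symm)
  have hup : ∀ x, up (S.start x) = (S.star hd hn).start (.inl x) := fun x => rfl
  have hlab : ∀ z, S.starLabel d ((S.star hd hn).rot z) = S.starLabel d z := by
    intro z
    rw [rot_apply, star_next, star_opp, S.starLabel_starNext hd hn, S.starOpp_starOpp]
  have hlabpow : ∀ z (k : ℕ), S.starLabel d (((S.star hd hn).rot ^ k) z) = S.starLabel d z := by
    intro z k
    induction k with
    | zero => rfl
    | succ k ih => rw [pow_succ', Equiv.Perm.mul_apply, hlab, ih]
  let L : (S.star hd hn).Vertex → S.Vertex ⊕ J := Quotient.lift (S.starLabel d) (by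
    intro x y hxy
    obtain ⟨k, rfl⟩ := Equiv.Perm.SameCycle.exists_nat_pow_eq hxy
    exact (hlabpow x k).symm)
  refine ⟨up, fun j => (S.star hd hn).start (.inr (j, 0, true)), ?_, fun x => rfl, ?_⟩
  · refine Function.LeftInverse.injective (g := L) ?_
    rintro (v | j)
    · obtain ⟨x, rfl⟩ := S.start_surjective v
      rfl
    · rfl
  · have h0 : ∀ j, (S.star hd hn).start (.inr (j, 2, true))
        = (S.star hd hn).start (.inr (j, 0, true)) := fun j => hstep (.inr (j, 0, true))
    have h1 : ∀ j, (S.star hd hn).start (.inr (j, 0, true))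
        = (S.star hd hn).start (.inr (j, 1, true)) := fun j => hstep (.inr (j, 1, true))
    intro j r b
    cases b
    · fin_cases r
      · exact (hstep (.inr (j, 0, false))).symm
      · exact (hstep (.inr (j, 1, false))).symm
      · have h2 := hstep (.inl (S.opp (S.next (d j))))
        change (S.star hd hn).start (S.starNext d (.inl (S.opp (S.opp (S.next (d j))))))
          = up (S.start _) at h2
        rw [S.opp_opp, S.starNext_next_corner hd hn, ← S.start_next] at h2
        exact h2
    · fin_cases r
      · rfl
      · exact (h1 j).symm
      · exact h0 j

end

end Star

end PolygonalSurface

namespace PolygonalSurface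

/-- Any number of paths of length two can be drawn parallel to each side of a family. -/
theorem exists_parallel_paths {J : Type} [Finite J] (T : ℕ) : ∀ {D : Type} [Finite D]
    (S : PolygonalSurface D) (d : J → D), Function.Injective d → (∀ j j', S.next (d j) ≠ d j') →
    ∃ (D' : Type) (_ : Finite D') (S' : PolygonalSurface D') (up : S.Vertex → S'.Vertex)
      (mid : J × Fin T → S'.Vertex), S.eulerChar ≤ S'.eulerChar ∧
      Function.Injective (Sum.elim up mid) ∧
      (∀ u v, S.Joined u v → S'.Joined (up u) (up v)) ∧
      ∀ j t, S'.Joined (mid (j, t)) (up (S.start (d j))) ∧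
        S'.Joined (mid (j, t)) (up (S.start (S.opp (d j)))) := by
  induction T with
  | zero =>
    intro D _ S d _ _
    refine ⟨D, inferInstance, S, id, fun q => q.2.elim0, le_rfl, ?_, fun _ _ h => h,
      fun _ t => t.elim0⟩
    rintro (u | ⟨_, t⟩) (v | ⟨_, t'⟩) h
    · exact congrArg Sum.inl h
    · exact t'.elim0
    · exact t.elim0
    · exact t.elim0
  | succ T ih =>
    intro D _ S d hd hn
    obtain ⟨up, w, hinj, hold, hnew⟩ := S.exists_star hd hn
    -- A new vertex beside `d j` is the middle of one path along it; its third edge is superfluous.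
    -- The old side is now followed by a new one, so the hypotheses persist and the step can be
    -- repeated.
    obtain ⟨D', hD', S', up', mid, hχ, hinj', hup', hmid⟩ := ih (S.star hd hn) (fun j => .inl (d j))
      (fun j j' h => hd (Sum.inl_injective h))
      (fun j j' h => by rw [star_next, S.starNext_corner hd] at h; cases h)
    refine ⟨D', hD', S', up' ∘ up, fun q => Fin.cases (up' (w q.1)) (fun t => mid (q.1, t)) q.2,
      (S.eulerChar_le_star hd hn).trans hχ, ?_, ?_, ?_⟩
    · have h1 : ∀ a b, up' a = up' b → a = b := fun a b h =>
        Sum.inl_injective (hinj' (a₁ := .inl a) (a₂ := .inl b) h)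
      have h2 : ∀ a b, up' a ≠ mid b := fun a b h => by
        cases hinj' (a₁ := .inl a) (a₂ := .inr b) h
      have h3 : ∀ a b, mid a = mid b → a = b := fun a b h =>
        Sum.inr_injective (hinj' (a₁ := .inr a) (a₂ := .inr b) h)
      have h4 : ∀ a b, up a = up b → a = b := fun a b h =>
        Sum.inl_injective (hinj (a₁ := .inl a) (a₂ := .inl b) h)
      have h5 : ∀ a b, up a ≠ w b := fun a b h => by
        cases hinj (a₁ := .inl a) (a₂ := .inr b) h
      have h6 : ∀ a b, w a = w b → a = b := fun a b h =>
        Sum.inr_injective (hinj (a₁ := .inr a) (a₂ := .inr b) h)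
      rintro (u | ⟨j, t⟩) (v | ⟨j', t'⟩) h
      · exact congrArg Sum.inl (h4 _ _ (h1 _ _ h))
      · induction t' using Fin.cases with
        | zero => exact absurd (h1 _ _ h) (h5 _ _)
        | succ t' => exact absurd h (h2 _ _)
      · induction t using Fin.cases with
        | zero => exact absurd (h1 _ _ h).symm (h5 _ _)
        | succ t => exact absurd h.symm (h2 _ _)
      · induction t using Fin.cases with
        | zero =>
          induction t' using Fin.cases with
          | zero =>
            have h' : j = j' := h6 _ _ (h1 _ _ h)
            rw [h']
          | succ t' => exact absurd h (h2 _ _)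
        | succ t =>
          induction t' using Fin.cases with
          | zero => exact absurd h.symm (h2 _ _)
          | succ t' =>
            have h' : (j, t) = (j', t') := h3 _ _ h
            cases h'
            rfl
    · rintro _ _ ⟨x, rfl, rfl⟩
      exact hup' _ _ ⟨.inl x, hold x, hold _⟩
    · intro j t
      have h1 := hmid j
      rw [star_opp] at h1
      rw [show S.starOpp (.inl (d j)) = .inl (S.opp (d j)) from rfl, hold, hold] at h1
      induction t using Fin.cases with
      | zero =>
        refine ⟨hup' _ _ ⟨.inr (j, 0, true), hnew j 0 true, hnew j 0 false⟩,
          hup' _ _ ⟨.inr (j, 1, true), hnew j 1 true, ?_⟩⟩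
        rw [← S.start_next]
        exact hnew j 1 false
      | succ t => exact h1 t

end PolygonalSurface

/-! ### The model of the subgroup lattice graph -/

/-- The vertices of the model: on each of two sides there are three hubs and `p` gadgets. A gadget
has a centre and a corner, and `p` midpoints of paths from the one to the other. -/
inductive LatticeVertex (p : ℕ) : Type
  | hub (σ : Bool) (r : Fin 3)
  | centre (σ : Bool) (j : Fin p)
  | corner (σ : Bool) (j : Fin p)
  | mid (σ : Bool) (j t : Fin p)

namespace LatticeVertex

/-- The edges of the model, each in one direction. -/
inductive Link {p : ℕ} : LatticeVertex p → LatticeVertex p → Prop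
  | corner_hub_zero (σ j) : Link (corner σ j) (hub σ 0)
  | corner_hub_one (σ j) : Link (corner σ j) (hub σ 1)
  | centre_hub_one (σ j) : Link (centre σ j) (hub σ 1)
  | centre_hub_two (σ j) : Link (centre σ j) (hub σ 2)
  | mid_corner (σ j t) : Link (mid σ j t) (corner σ j)
  | mid_centre (σ j t) : Link (mid σ j t) (centre σ j)
  | rung (r) : Link (hub false r) (hub true r)
  | diagonal_zero : Link (hub true 0) (hub false 1)
  | diagonal_one : Link (hub true 1) (hub false 2)

end LatticeVertex

/-- A surface on which the hubs and the centres of the model are drawn. Each gadget has a corner at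
its centre between the sides to the hubs `0` and `1`. -/
structure LatticeBase (p : ℕ) {D : Type} (S : PolygonalSurface D) where
  hub : Bool × Fin 3 → S.Vertex
  centre : Bool × Fin p → S.Vertex
  dart : Bool × Fin p → D
  injective : Function.Injective (Sum.elim hub centre)
  corner : ∀ q, (S.start (dart q) = hub (q.1, 0) ∧
      S.start (S.next (S.next (dart q))) = hub (q.1, 1)) ∨
    (S.start (dart q) = hub (q.1, 1) ∧ S.start (S.next (S.next (dart q))) = hub (q.1, 0))
  start_next : ∀ q, S.start (S.next (dart q)) = centre q
  joined_one : ∀ q, S.Joined (centre q) (hub (q.1, 1))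
  joined_two : ∀ q, S.Joined (centre q) (hub (q.1, 2))
  rung : ∀ r, S.Joined (hub (false, r)) (hub (true, r))
  diagonal_zero : S.Joined (hub (true, 0)) (hub (false, 1))
  diagonal_one : S.Joined (hub (true, 1)) (hub (false, 2))

open LatticeVertex in
theorem LatticeBase.exists_surface {p : ℕ} {D : Type} [Finite D] {S : PolygonalSurface D}
    (B : LatticeBase p S) :
    ∃ (D' : Type) (_ : Finite D') (S' : PolygonalSurface D') (f : LatticeVertex p → S'.Vertex),
      S.eulerChar ≤ S'.eulerChar ∧ Function.Injective f ∧
      ∀ u v, Link u v → S'.Joined (f u) (f v) := by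
  have hB : ∀ a b, B.hub a ≠ B.centre b := fun a b h => by
    cases B.injective (a₁ := .inl a) (a₂ := .inr b) h
  have hB1 : ∀ a b, B.hub a = B.hub b → a = b := fun a b h =>
    Sum.inl_injective (B.injective (a₁ := .inl a) (a₂ := .inl b) h)
  have hB2 : ∀ a b, B.centre a = B.centre b → a = b := fun a b h =>
    Sum.inr_injective (B.injective (a₁ := .inr a) (a₂ := .inr b) h)
  have hd : Function.Injective B.dart := fun q q' h => hB2 _ _ (by
    rw [← B.start_next, ← B.start_next, h])
  -- The one side starts at a centre, the other at a hub.
  have hn : ∀ q q', S.next (B.dart q) ≠ B.dart q' := fun q q' h => by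
    have h1 := B.start_next q
    rw [h] at h1
    rcases B.corner q' with h2 | h2
    · exact hB _ _ (h2.1.symm.trans h1)
    · exact hB _ _ (h2.1.symm.trans h1)
  obtain ⟨up, w, hinj, hold, hnew⟩ := S.exists_star hd hn
  obtain ⟨D', hD', S', up', mid, hχ, hinj', hup', hmid⟩ :=
    -- The inserted vertices are the corners of the gadgets, and `(q, 1, false)` is the side from
    -- centre to corner, along which the p paths are drawn.
    (S.star hd hn).exists_parallel_paths p (fun q : Bool × Fin p => .inr (q, 1, false))
      (fun q q' h => congrArg Prod.fst (Sum.inr_injective h))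
      (fun q q' h => by
        have := congrArg (fun t => t.2.2) (Sum.inr_injective h)
        exact Bool.noConfusion this)
  have hup : ∀ u v, S.Joined u v → (S.star hd hn).Joined (up u) (up v) := by
    rintro _ _ ⟨x, rfl, rfl⟩
    exact ⟨.inl x, hold x, hold _⟩
  have hw : ∀ q (r : Fin 3), (S.star hd hn).Joined (w q) (up (![S.start (B.dart q),
      S.start (S.next (B.dart q)), S.start (S.next (S.next (B.dart q)))] r)) :=
    fun q r => ⟨.inr (q, r, true), hnew q r true, hnew q r false⟩
  have hw0 : ∀ q, (S.star hd hn).Joined (w q) (up (B.hub (q.1, 0))) ∧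
      (S.star hd hn).Joined (w q) (up (B.hub (q.1, 1))) := fun q => by
    rcases B.corner q with h | h
    · rw [← h.1, ← h.2]
      exact ⟨hw q 0, hw q 2⟩
    · rw [← h.1, ← h.2]
      exact ⟨hw q 2, hw q 0⟩
  have hm : ∀ q t, S'.Joined (mid (q, t)) (up' (up (B.centre q))) ∧
      S'.Joined (mid (q, t)) (up' (w q)) := by
    intro q t
    obtain ⟨h1, h2⟩ := hmid q t
    rw [PolygonalSurface.star_opp] at h2
    rw [hnew q 1 false] at h1
    rw [show S.starOpp (Sum.inr (q, 1, false)) = .inr (q, 1, true) from rfl, hnew q 1 true] at h2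
    refine ⟨?_, h2⟩
    rw [← B.start_next]
    exact h1
  have h1 : ∀ a b, up' a = up' b → a = b := fun a b h =>
    Sum.inl_injective (hinj' (a₁ := .inl a) (a₂ := .inl b) h)
  have h2 : ∀ a b, up' a ≠ mid b := fun a b h => by
    cases hinj' (a₁ := .inl a) (a₂ := .inr b) h
  have h3 : ∀ a b, mid a = mid b → a = b := fun a b h =>
    Sum.inr_injective (hinj' (a₁ := .inr a) (a₂ := .inr b) h)
  have h4 : ∀ a b, up a = up b → a = b := fun a b h =>
    Sum.inl_injective (hinj (a₁ := .inl a) (a₂ := .inl b) h)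
  have h5 : ∀ a b, up a ≠ w b := fun a b h => by
    cases hinj (a₁ := .inl a) (a₂ := .inr b) h
  have h6 : ∀ a b, w a = w b → a = b := fun a b h =>
    Sum.inr_injective (hinj (a₁ := .inr a) (a₂ := .inr b) h)
  refine ⟨D', hD', S', fun v => match v with
    | .hub σ r => up' (up (B.hub (σ, r)))
    | .centre σ j => up' (up (B.centre (σ, j)))
    | .corner σ j => up' (w (σ, j))
    | .mid σ j t => mid ((σ, j), t), (S.eulerChar_le_star hd hn).trans hχ, ?_, ?_⟩
  · rintro (⟨σ, r⟩ | ⟨σ, j⟩ | ⟨σ, j⟩ | ⟨σ, j, t⟩) (⟨σ', r'⟩ | ⟨σ', j'⟩ | ⟨σ', j'⟩ | ⟨σ', j', t'⟩) h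
    · cases hB1 _ _ (h4 _ _ (h1 _ _ h))
      rfl
    · exact absurd (h4 _ _ (h1 _ _ h)) (hB _ _)
    · exact absurd (h1 _ _ h) (h5 _ _)
    · exact absurd h (h2 _ _)
    · exact absurd (h4 _ _ (h1 _ _ h)).symm (hB _ _)
    · cases hB2 _ _ (h4 _ _ (h1 _ _ h))
      rfl
    · exact absurd (h1 _ _ h) (h5 _ _)
    · exact absurd h (h2 _ _)
    · exact absurd (h1 _ _ h).symm (h5 _ _)
    · exact absurd (h1 _ _ h).symm (h5 _ _)
    · cases h6 _ _ (h1 _ _ h)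
      rfl
    · exact absurd h (h2 _ _)
    · exact absurd h.symm (h2 _ _)
    · exact absurd h.symm (h2 _ _)
    · exact absurd h.symm (h2 _ _)
    · cases h3 _ _ h
      rfl
  · intro u v h
    cases h with
    | corner_hub_zero σ j => exact hup' _ _ (hw0 (σ, j)).1
    | corner_hub_one σ j => exact hup' _ _ (hw0 (σ, j)).2
    | centre_hub_one σ j => exact hup' _ _ (hup _ _ (B.joined_one (σ, j)))
    | centre_hub_two σ j => exact hup' _ _ (hup _ _ (B.joined_two (σ, j)))
    | mid_corner σ j t => exact (hm (σ, j) t).2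
    | mid_centre σ j t => exact (hm (σ, j) t).1
    | rung r => exact hup' _ _ (hup _ _ (B.rung r))
    | diagonal_zero => exact hup' _ _ (hup _ _ B.diagonal_zero)
    | diagonal_one => exact hup' _ _ (hup _ _ B.diagonal_one)

open LatticeVertex in
/-- A graph whose vertices map injectively to the model, with edges going to edges, embeds in a
surface of genus at most `g` as soon as the base of the model is drawn on such a surface. -/
theorem LatticeBase.exists_embedsInGenus {p g : ℕ} {D : Type} [Finite D] {S : PolygonalSurface D}
    (B : LatticeBase p S) (hg : 2 - 2 * (g : ℤ) ≤ S.eulerChar) {V : Type*} {Γ : SimpleGraph V}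
    (f : V → LatticeVertex p) (hf : Function.Injective f)
    (hadj : ∀ u v, Γ.Adj u v → Link (f u) (f v) ∨ Link (f v) (f u)) :
    ∃ h ≤ g, EmbedsInGenus Γ h := by
  obtain ⟨D', hD', S', F, hχ, hF, hjoin⟩ := B.exists_surface
  obtain ⟨h, hh, hS⟩ := S'.exists_isGenus_le (hg.trans hχ)
  refine ⟨h, hh, D', hD', S', hS, S'.nonempty_embedding Γ (F ∘ f) (hF.comp hf) ?_⟩
  intro u v huv
  rcases hadj u v huv with h' | h'
  · exact hjoin _ _ h'
  · exact (hjoin _ _ h').symm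

/-! ### A surface for odd primes

Two quadrangulations by the graph `K_{3,2k}`, with one of the `2 k` vertices of degree three removed
from each, are connected by a tube. -/

namespace TubeSurface

/-- The directed sides: a surface `σ`, a flag telling whether the side leaves a vertex of
degree three, a hub `r`, and a vertex `(s, i)` of degree three. The sides of the removed vertices
`(σ, 0)` run through the tube. -/
abbrev Side (k : ℕ) : Type := Bool × Bool × Fin 3 × (Bool × ZMod k)

variable {k : ℕ}

/-- The offsets in the rotations at the hubs. -/
def offset (k : ℕ) : Fin 3 → ZMod k := ![0, 1, 2]

/-- The rotation at the hub `r`. -/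
def turn (r : Fin 3) : Equiv.Perm (Bool × ZMod k) where
  toFun x := if x.1 then (false, x.2 - offset k (r + 1)) else (true, x.2 + offset k r)
  invFun x := if x.1 then (false, x.2 - offset k r) else (true, x.2 + offset k (r + 1))
  left_inv := by rintro ⟨_ | _, i⟩ <;> simp
  right_inv := by rintro ⟨_ | _, i⟩ <;> simp

/-- The next hub around a vertex of degree three. -/
def shift (s : Bool) (r : Fin 3) : Fin 3 := bif s then r - 1 else r + 1

/-- The rotation around the vertices. -/
def rotFun : Side k → Side k
  | (σ, false, r, x) => if x = (σ, 0) then (σ, true, r, x) else (σ, false, r, turn r x)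
  | (σ, true, r, x) => if x = (σ, 0) then (σ, false, r, turn r x) else (σ, true, shift x.1 r, x)

/-- The reversal of the sides. -/
def oppFun : Side k → Side k
  | (σ, false, r, x) => if x = (σ, 0) then (!σ, false, r, (!σ, 0)) else (σ, true, r, x)
  | (σ, true, r, x) =>
    if x = (σ, 0) then (!σ, true, shift (!σ) r, (!σ, 0)) else (σ, false, r, x)

theorem oppFun_oppFun (z : Side k) : oppFun (oppFun z) = z := by
  obtain ⟨σ, _ | _, r, x⟩ := z <;> by_cases hx : x = (σ, 0)
  · simp [oppFun, hx]
  · simp [oppFun, hx]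
  · cases σ <;> simp [oppFun, hx, shift]
  · simp [oppFun, hx]

theorem oppFun_ne (z : Side k) : oppFun z ≠ z := by
  obtain ⟨σ, _ | _, r, x⟩ := z <;> by_cases hx : x = (σ, 0) <;> simp [oppFun, hx]

theorem rotFun_surjective : Function.Surjective (rotFun : Side k → Side k) := by
  rintro ⟨σ, _ | _, r, x⟩
  · by_cases hx : (turn r).symm x = (σ, 0)
    · exact ⟨(σ, true, r, (turn r).symm x), by rw [rotFun, if_pos hx, Equiv.apply_symm_apply]⟩
    · exact ⟨(σ, false, r, (turn r).symm x), by rw [rotFun, if_neg hx, Equiv.apply_symm_apply]⟩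
  · by_cases hx : x = (σ, 0)
    · exact ⟨(σ, false, r, x), by rw [rotFun, if_pos hx]⟩
    · refine ⟨(σ, true, shift (!x.1) r, x), ?_⟩
      rw [rotFun, if_neg hx]
      cases x.1 <;> simp [shift]

/-- Two turns at hub `r` translate by the difference of consecutive offsets, which is -1, -1 or 2.
Each hub is a single vertex precisely because these are units; oddness of `k` is needed for 2, whose
inverse modulo 2m+1 is m+1. -/
theorem exists_mul_offset_sub_eq_one (hk : Odd k) (r : Fin 3) :
    ∃ c : ZMod k, c * (offset k r - offset k (r + 1)) = 1 := by
  fin_cases r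
  · exact ⟨-1, by simp [offset]⟩
  · refine ⟨-1, ?_⟩
    simp [offset]
    norm_num
  · obtain ⟨m, rfl⟩ := hk
    refine ⟨(m + 1 : ℕ), ?_⟩
    have h : ((2 * m + 1 : ℕ) : ZMod (2 * m + 1)) = 0 := ZMod.natCast_self _
    have h2 : offset (2 * m + 1) (2 : Fin 3) - offset (2 * m + 1) ((2 : Fin 3) + 1) = 2 := by
      simp [offset]
    push_cast at h ⊢
    change _ * (offset (2 * m + 1) (2 : Fin 3) - offset (2 * m + 1) ((2 : Fin 3) + 1)) = 1
    rw [h2]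
    linear_combination h

/-! ### Sides with a common starting point on the tube surface -/

section

variable (hk : Odd k) (E : Setoid (Side k)) (hE : ∀ z, E (rotFun z) z)

include hE in
theorem setoid_turn (σ : Bool) (r : Fin 3) (x : Bool × ZMod k) :
    E (σ, false, r, turn r x) (σ, false, r, x) := by
  have h := hE (σ, false, r, x)
  by_cases hx : x = (σ, 0)
  · rw [rotFun, if_pos hx] at h
    have h' := hE (σ, true, r, x)
    rw [rotFun, if_pos hx] at h'
    exact E.trans h' h
  · rwa [rotFun, if_neg hx] at h

include hE in
theorem setoid_special (σ : Bool) (r : Fin 3) :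
    E (σ, true, r, (σ, 0)) (σ, false, r, (σ, 0)) := by
  have h := hE (σ, false, r, (σ, 0))
  rwa [rotFun, if_pos rfl] at h

include hk hE in
theorem setoid_hub [NeZero k] (σ : Bool) (r : Fin 3) (x y : Bool × ZMod k) :
    E (σ, false, r, x) (σ, false, r, y) := by
  have hE' := setoid_turn E hE σ r
  have h1 : ∀ n : ℕ, E (σ, false, r, (false, n * (offset k r - offset k (r + 1))))
      (σ, false, r, (false, 0)) := by
    intro n
    induction n with
    | zero => simp
    | succ n ih =>
      refine E.trans ?_ ih
      have h2 := E.trans (hE' (turn r (false, n * (offset k r - offset k (r + 1))))) (hE' _)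
      have h3 : ∀ t, turn r (turn r (false, t)) = (false, t + (offset k r - offset k (r + 1))) :=
        fun t => Prod.ext rfl (add_sub_assoc _ _ _)
      rw [h3] at h2
      rwa [Nat.cast_succ, add_mul, one_mul]
  obtain ⟨c, hc⟩ := exists_mul_offset_sub_eq_one hk r
  have h2 : ∀ i, E (σ, false, r, (false, i)) (σ, false, r, (false, 0)) := by
    intro i
    have h3 := h1 (i * c).val
    rwa [ZMod.natCast_zmod_val, mul_assoc, hc, mul_one] at h3
  have h3 : ∀ x, E (σ, false, r, x) (σ, false, r, (false, 0)) := by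
    rintro ⟨_ | _, i⟩
    · exact h2 i
    · have h4 := E.symm (hE' (true, i))
      exact E.trans h4 (h2 _)
  exact E.trans (h3 x) (E.symm (h3 y))

include hE in
theorem setoid_centre (σ : Bool) (x : Bool × ZMod k) (hx : x ≠ (σ, 0)) (r r' : Fin 3) :
    E (σ, true, r, x) (σ, true, r', x) := by
  have h : ∀ r, E (σ, true, shift x.1 r, x) (σ, true, r, x) := by
    intro r
    have h1 := hE (σ, true, r, x)
    rwa [rotFun, if_neg hx] at h1
  have h0 : ∀ r, E (σ, true, r, x) (σ, true, 0, x) := by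
    intro r
    have h1 := h 0
    have h2 := h (shift x.1 0)
    generalize x.1 = s at h1 h2
    fin_cases r <;> cases s
    · exact E.refl _
    · exact E.refl _
    · exact h1
    · exact E.trans h2 h1
    · exact E.trans h2 h1
    · exact h1
  exact E.trans (h0 r) (E.symm (h0 r'))

end

/-- The permutation `rotFun`. -/
noncomputable def rotPerm (k : ℕ) [NeZero k] : Equiv.Perm (Side k) :=
  Equiv.ofBijective rotFun (Finite.surjective_iff_bijective.1 rotFun_surjective)

/-- The permutation `oppFun`. -/
def oppPerm (k : ℕ) : Equiv.Perm (Side k) := Function.Involutive.toPerm oppFun oppFun_oppFun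

/-- The two quadrangulated surfaces, connected by the tube. -/
noncomputable def surface [NeZero k] (hk : Odd k) : PolygonalSurface (Side k) where
  next := rotPerm k * oppPerm k
  opp := oppPerm k
  opp_opp := oppFun_oppFun
  opp_ne := oppFun_ne
  nonempty := ⟨(false, false, 0, (false, 0))⟩
  connected := by
    intro x y
    refine exists_mem_closure_pair fun E h₁ h₂ => ?_
    change ∀ z, E (rotFun (oppFun z)) z at h₁
    change ∀ z, E (oppFun z) z at h₂
    have hE : ∀ z, E (rotFun z) z := fun z => by
      have := h₁ (oppFun z)
      rw [oppFun_oppFun] at this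
      exact E.trans this (h₂ z)
    have hub := setoid_hub hk E hE
    -- The rungs join equal hubs of the two copies, and the diagonals join hub `r` of the copy
    -- `true` to hub `r + 1` of the copy `false`; together they connect all six hubs.
    have h1 : ∀ r, E (true, false, r, (true, 0)) (false, false, r, (false, 0)) := by
      intro r
      have h := h₂ (false, false, r, (false, 0))
      rwa [oppFun, if_pos rfl] at h
    have h2 : ∀ r, E (false, false, r + 1, (false, 0)) (true, false, r, (true, 0)) := by
      intro r
      have h := h₂ (true, true, r, (true, 0))
      rw [oppFun, if_pos rfl] at h
      exact E.trans (E.symm (setoid_special E hE false (r + 1)))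
        (E.trans h (setoid_special E hE true r))
    have h3 : ∀ r, E (false, false, r, (false, 0)) (false, false, 0, (false, 0)) := by
      intro r
      have h4 := E.trans (h2 0) (h1 0)
      have h5 := E.trans (h2 1) (h1 1)
      fin_cases r
      · exact E.refl _
      · exact h4
      · exact E.trans h5 h4
    have h4 : ∀ σ r x, E (σ, false, r, x) (false, false, 0, (false, 0)) := by
      intro σ r x
      refine E.trans (hub σ r x (σ, 0)) ?_
      cases σ
      · exact h3 r
      · exact E.trans (h1 r) (h3 r)
    have h5 : ∀ z, E z (false, false, 0, (false, 0)) := by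
      rintro ⟨σ, _ | _, r, x⟩
      · exact h4 σ r x
      · by_cases hx : x = (σ, 0)
        · subst hx
          exact E.trans (setoid_special E hE σ r) (h4 _ _ _)
        · have h := h₂ (σ, true, r, x)
          rw [oppFun, if_neg hx] at h
          exact E.trans (E.symm h) (h4 _ _ _)
    exact E.trans (h5 x) (E.symm (h5 y))

/-- The hub or the vertex of degree three at which a side starts. -/
def vertexLabel : Side k → (Bool × Fin 3) ⊕ Σ σ : Bool, {x : Bool × ZMod k // x ≠ (σ, 0)}
  | (σ, false, r, _) => .inl (σ, r)
  | (σ, true, r, x) => if h : x = (σ, 0) then .inl (σ, r) else .inr ⟨σ, x, h⟩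

/-- The face to the left of a side. -/
def faceLabel : Side k → Bool × Fin 3 × ZMod k
  | (σ, false, r, (false, i)) => (σ, r, i)
  | (σ, false, r, (true, i)) => (σ, r - 1, i - offset k r)
  | (σ, true, r, (false, i)) =>
    if (false, i) = (σ, 0) then (true, r - 1, -offset k r) else (σ, r - 1, i)
  | (σ, true, r, (true, i)) =>
    if (true, i) = (σ, 0) then (false, r, 0) else (σ, r, i - offset k (r + 1))

theorem vertexLabel_rotFun (z : Side k) : vertexLabel (rotFun z) = vertexLabel z := by
  obtain ⟨σ, _ | _, r, x⟩ := z <;> by_cases hx : x = (σ, 0) <;> simp [vertexLabel, rotFun, hx]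

/-- There are 3k labels for each copy. The vertices `(false, i)` and `(true, i)` turn through the
hubs in opposite directions; the removed vertices are of opposite kinds, so the two hexagons fit
together with orientation. The six tube edges cut the tube into six faces, replacing the three faces
lost at each removed vertex. -/
theorem faceLabel_rotFun_oppFun (z : Side k) : faceLabel (rotFun (oppFun z)) = faceLabel z := by
  obtain ⟨σ, b, r, x⟩ := z
  by_cases hx : x = (σ, 0)
  · subst hx
    cases σ <;> cases b <;> simp [oppFun, rotFun, faceLabel, shift, turn]
  · obtain ⟨s, i⟩ := x
    cases b <;> cases s <;> simp [oppFun, rotFun, hx, faceLabel, shift, turn]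

/-- There are 6 + 2(2k-1) vertices, 12k edges and 6k faces. -/
theorem le_eulerChar [NeZero k] (hk : Odd k) : 4 - 2 * (k : ℤ) ≤ (surface hk).eulerChar := by
  have h := (surface hk).le_two_mul_eulerChar vertexLabel faceLabel
    (fun z => vertexLabel_rotFun (oppFun z))
    (by
      rintro (⟨σ, r⟩ | ⟨σ, x, hx⟩)
      · exact ⟨(σ, false, r, (σ, 0)), rfl⟩
      · exact ⟨(σ, true, 0, x), dif_neg hx⟩)
    faceLabel_rotFun_oppFun
    (by
      rintro ⟨σ, r, i⟩
      exact ⟨(σ, false, r, (false, i)), rfl⟩)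
  have h1 : ∀ σ : Bool, Fintype.card {x : Bool × ZMod k // x ≠ (σ, 0)} = 2 * k - 1 := by
    intro σ
    have := Set.card_ne_eq (σ, (0 : ZMod k))
    rw [Fintype.card_prod, ZMod.card, Fintype.card_bool] at this
    exact this
  have hpos : 0 < k := Nat.pos_of_ne_zero (NeZero.ne k)
  simp only [Nat.card_eq_fintype_card, Fintype.card_sum, Fintype.card_prod, Fintype.card_bool,
    Fintype.card_fin, Fintype.card_sigma, h1, ZMod.card, Finset.sum_const, Finset.card_univ,
    smul_eq_mul] at h
  zify [show 1 ≤ 2 * k by omega] at h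
  push_cast at h
  omega

theorem exists_latticeBase [NeZero k] (hk : Odd k) {p : ℕ} (hp : p < 2 * k) :
    Nonempty (LatticeBase p (surface hk)) := by
  set S := surface hk with hS
  have hrot : ∀ z, S.start (rotFun z) = S.start z := fun z => by
    have := S.start_rot z
    rw [S.rot_apply] at this
    rw [← this]
    change _ = S.start (rotFun (oppFun (oppFun z)))
    rw [oppFun_oppFun]
  have hub := setoid_hub hk (Setoid.ker S.start) hrot
  have special := setoid_special (Setoid.ker S.start) hrot
  have centre := setoid_centre (Setoid.ker S.start) hrot
  have hlab : ∀ z w, S.start z = S.start w → vertexLabel z = vertexLabel w := by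
    intro z w hzw
    obtain ⟨n, rfl⟩ := ((S.start_eq_iff z w).1 hzw).exists_nat_pow_eq
    clear hzw
    induction n with
    | zero => rfl
    | succ n ih =>
      rw [pow_succ', Equiv.Perm.mul_apply, ih, S.rot_apply]
      change _ = vertexLabel (rotFun (oppFun (oppFun _)))
      rw [oppFun_oppFun, vertexLabel_rotFun]
  have hemb : ∀ σ : Bool, Nonempty (Fin p ↪ {x : Bool × ZMod k // x ≠ (σ, 0)}) := by
    intro σ
    refine Function.Embedding.nonempty_of_card_le ?_
    have := Set.card_ne_eq (σ, (0 : ZMod k))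
    rw [Fintype.card_prod, ZMod.card, Fintype.card_bool] at this
    rw [Fintype.card_fin]
    refine le_trans ?_ this.ge
    omega
  let c : ∀ σ : Bool, Fin p ↪ {x : Bool × ZMod k // x ≠ (σ, 0)} := fun σ => (hemb σ).some
  have hc : ∀ q : Bool × Fin p, (c q.1 q.2).1 ≠ (q.1, 0) := fun q => (c q.1 q.2).2
  have hnext : ∀ z, S.next z = rotFun (oppFun z) := fun z => rfl
  have hopp : ∀ z, S.opp z = oppFun z := fun z => rfl
  have hCX : ∀ σ r x, x ≠ (σ, 0) →
      S.start (S.next (σ, false, r, x)) = S.start (σ, true, 0, x) := by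
    intro σ r x hx
    rw [S.start_next, hopp, oppFun, if_neg hx]
    exact centre σ x hx r 0
  have hCC : ∀ σ r x, x ≠ (σ, 0) → S.start (S.next (S.next (σ, false, r, x)))
      = S.start (σ, false, shift x.1 r, (σ, 0)) := by
    intro σ r x hx
    rw [S.start_next, hopp, hnext, oppFun, if_neg hx, rotFun, if_neg hx, oppFun, if_neg hx]
    exact hub σ _ _ _
  refine ⟨{
    hub := fun q => S.start (q.1, false, q.2, (q.1, 0))
    centre := fun q => S.start (q.1, true, 0, (c q.1 q.2).1)
    -- Around a vertex of degree three, `shift` leads from hub 0 to hub 1 or from hub 1 to hub 0,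
    -- depending on its kind. The starting hub is chosen so that the corner lies between these two.
    dart := fun q => (q.1, false, bif (c q.1 q.2).1.1 then 1 else 0, (c q.1 q.2).1)
    injective := ?_
    corner := ?_
    start_next := fun q => hCX _ _ _ (hc q)
    joined_one := ?_
    joined_two := ?_
    rung := ?_
    diagonal_zero := ?_
    diagonal_one := ?_ }⟩
  · rintro (⟨σ, r⟩ | ⟨σ, j⟩) (⟨σ', r'⟩ | ⟨σ', j'⟩) h
    · have := hlab _ _ h
      simpa [vertexLabel] using this
    · have := hlab _ _ h
      simp [vertexLabel, hc (σ', j')] at this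
    · have := hlab _ _ h
      simp [vertexLabel, hc (σ, j)] at this
    · have := hlab _ _ h
      rw [vertexLabel, vertexLabel, dif_neg (hc (σ, j)), dif_neg (hc (σ', j'))] at this
      have h' := Sum.inr_injective this
      obtain ⟨rfl, h2⟩ := Sigma.mk.inj_iff.1 h'
      have h3 : j = j' := (c σ).injective (eq_of_heq h2)
      rw [h3]
  · intro q
    rw [hCC _ _ _ (hc q)]
    cases (c q.1 q.2).1.1
    · exact Or.inl ⟨hub _ _ _ _, rfl⟩
    · exact Or.inr ⟨hub _ _ _ _, rfl⟩
  · intro q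
    refine ⟨(q.1, true, 1, (c q.1 q.2).1), centre _ _ (hc q) _ _, ?_⟩
    rw [hopp, oppFun, if_neg (hc q)]
    exact hub _ _ _ _
  · intro q
    refine ⟨(q.1, true, 2, (c q.1 q.2).1), centre _ _ (hc q) _ _, ?_⟩
    rw [hopp, oppFun, if_neg (hc q)]
    exact hub _ _ _ _
  · intro r
    exact ⟨(false, false, r, (false, 0)), rfl, by rw [hopp, oppFun, if_pos rfl]; rfl⟩
  · refine ⟨(true, true, 0, (true, 0)), special true 0, ?_⟩
    rw [hopp, oppFun, if_pos rfl]
    exact special false 1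
  · refine ⟨(true, true, 1, (true, 0)), special true 1, ?_⟩
    rw [hopp, oppFun, if_pos rfl]
    exact special false 2

end TubeSurface

/-! ### A torus for the prime two -/

namespace TorusSurface

/-- The side following a side. -/
def nextFun : Fin 34 → Fin 34 :=
  ![4, 7, 10, 1, 14, 18, 2, 17, 16, 0, 15, 22, 25, 5, 11, 6, 28, 3, 27, 32, 8, 12, 29, 31, 9, 33,
    30, 13, 23, 24, 19, 20, 26, 21]

/-- The side preceding a side. -/
def prevFun : Fin 34 → Fin 34 :=
  ![9, 3, 6, 17, 0, 13, 15, 1, 20, 24, 2, 14, 21, 27, 4, 10, 8, 7, 5, 30, 31, 33, 11, 28, 29, 12,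
    32, 18, 16, 22, 26, 23, 19, 25]

/-- The reversed side. -/
def oppFun : Fin 34 → Fin 34 :=
  ![3, 6, 9, 0, 13, 17, 1, 20, 15, 2, 14, 21, 24, 4, 10, 8, 27, 5, 30, 31, 7, 11, 28, 33, 12, 32,
    29, 16, 22, 26, 18, 19, 25, 23]

/-- The starting point of a side. -/
def vertexLabel : Fin 34 → Fin 10 :=
  ![0, 0, 0, 1, 1, 1, 2, 2, 2, 3, 3, 3, 3, 4, 4, 4, 4, 5, 5, 5, 5, 6, 6, 6, 7, 7, 7, 8, 8, 8, 8, 9,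
    9, 9]

/-- The face to the left of a side. -/
def faceLabel : Fin 34 → Fin 7 :=
  ![0, 6, 1, 6, 0, 3, 1, 6, 5, 0, 1, 0, 2, 3, 0, 1, 5, 6, 3, 4, 5, 2, 0, 5, 0, 2, 4, 3, 5, 0, 4, 5,
    4, 2]

/-- A side starting at a given vertex. -/
def vertexRep : Fin 10 → Fin 34 := ![0, 3, 6, 9, 13, 17, 21, 24, 27, 31]

/-- A side of a given face. -/
def faceRep : Fin 7 → Fin 34 := ![0, 2, 12, 5, 19, 8, 1]

theorem oppFun_oppFun : ∀ z, oppFun (oppFun z) = z := by decide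

theorem nextFun_prevFun : ∀ z, nextFun (prevFun z) = z := by decide

theorem prevFun_nextFun : ∀ z, prevFun (nextFun z) = z := by decide

theorem vertexLabel_nextFun : ∀ z, vertexLabel (nextFun z) = vertexLabel (oppFun z) := by decide

theorem faceLabel_nextFun : ∀ z, faceLabel (nextFun z) = faceLabel z := by decide

/-- The sides are numbered so that each one except 0 is linked to a smaller one, which makes
connectedness an induction. -/
theorem oppFun_lt : ∀ z, z = 0 ∨ oppFun z < z ∨ oppFun (prevFun z) < z := by decide

/-- `oppFun ∘ prevFun` is the inverse rotation: a side that does not represent its vertex is reached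
by one rotation from a smaller side at the same vertex. -/
theorem eq_vertexRep : ∀ z, z = vertexRep (vertexLabel z) ∨
    (oppFun (prevFun z) < z ∧ vertexLabel (oppFun (prevFun z)) = vertexLabel z) := by decide

/-- A cell structure of the torus. -/
def surface : PolygonalSurface (Fin 34) where
  next := ⟨nextFun, prevFun, prevFun_nextFun, nextFun_prevFun⟩
  opp := ⟨oppFun, oppFun, oppFun_oppFun, oppFun_oppFun⟩
  opp_opp := oppFun_oppFun
  opp_ne := by
    change ∀ z, oppFun z ≠ z
    decide
  nonempty := ⟨0⟩
  connected := by
    intro x y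
    refine exists_mem_closure_pair fun E h₁ h₂ => ?_
    change ∀ z, E (nextFun z) z at h₁
    change ∀ z, E (oppFun z) z at h₂
    have h : ∀ z, E z 0 := by
      intro z
      induction z using WellFoundedLT.induction with
      | _ z ih =>
        rcases oppFun_lt z with rfl | hz | hz
        · exact E.refl _
        · exact E.trans (E.symm (h₂ z)) (ih _ hz)
        · have h3 := h₁ (prevFun z)
          rw [nextFun_prevFun] at h3
          exact E.trans h3 (E.trans (E.symm (h₂ _)) (ih _ hz))
    exact E.trans (h x) (E.symm (h y))

theorem start_eq {z w : Fin 34} (h : vertexLabel z = vertexLabel w) :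
    surface.start z = surface.start w := by
  have key : ∀ z, surface.start z = surface.start (vertexRep (vertexLabel z)) := by
    intro z
    induction z using WellFoundedLT.induction with
    | _ z ih =>
      rcases eq_vertexRep z with hz | ⟨hz, hz'⟩
      · rw [← hz]
      · rw [← hz', ← ih _ hz, ← surface.start_rot (oppFun (prevFun z))]
        change _ = surface.start (nextFun (oppFun (oppFun (prevFun z))))
        rw [oppFun_oppFun, nextFun_prevFun]
  rw [key z, key w, h]

theorem vertexLabel_eq {z w : Fin 34} (h : surface.start z = surface.start w) :
    vertexLabel z = vertexLabel w := by
  obtain ⟨n, rfl⟩ := ((surface.start_eq_iff z w).1 h).exists_nat_pow_eq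
  clear h
  induction n with
  | zero => rfl
  | succ n ih =>
    rw [pow_succ', Equiv.Perm.mul_apply, ih]
    change _ = vertexLabel (nextFun (oppFun ((surface.rot ^ n) z)))
    rw [vertexLabel_nextFun, oppFun_oppFun]

/-- 10 - 17 + 7 = 0. -/
theorem eulerChar_nonneg : 0 ≤ surface.eulerChar := by
  have h := surface.le_two_mul_eulerChar vertexLabel faceLabel vertexLabel_nextFun
    (fun v => ⟨vertexRep v, by revert v; decide⟩) faceLabel_nextFun
    (fun f => ⟨faceRep f, by revert f; decide⟩)
  simp only [Nat.card_eq_fintype_card, Fintype.card_fin] at h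
  omega

/-- A side starting at a given hub. -/
def hubRep : Bool × Fin 3 → Fin 34
  | (σ, r) => bif σ then ![9, 27, 31] r else ![0, 13, 17] r

/-- A side starting at a given centre. -/
def centreRep : Bool × Fin 2 → Fin 34
  | (σ, j) => bif σ then ![21, 24] j else ![3, 6] j

/-- The first side of the corner at a given centre. -/
def cornerRep : Bool × Fin 2 → Fin 34
  | (σ, j) => bif σ then ![11, 29] j else ![0, 15] j

/-- The drawing of the base of the model on the torus. -/
def latticeBase : LatticeBase 2 surface where
  hub q := surface.start (hubRep q)
  centre q := surface.start (centreRep q)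
  dart := cornerRep
  injective := by
    have key : Function.Injective (fun a => vertexLabel (Sum.elim hubRep centreRep a)) := by decide
    rintro (a | a) (b | b) h <;> exact key (vertexLabel_eq h)
  corner q := by
    have key : ∀ q, (vertexLabel (cornerRep q) = vertexLabel (hubRep (q.1, 0)) ∧
        vertexLabel (nextFun (nextFun (cornerRep q))) = vertexLabel (hubRep (q.1, 1))) ∨
        (vertexLabel (cornerRep q) = vertexLabel (hubRep (q.1, 1)) ∧
        vertexLabel (nextFun (nextFun (cornerRep q))) = vertexLabel (hubRep (q.1, 0))) := by decide
    exact (key q).imp (fun h => ⟨start_eq h.1, start_eq h.2⟩) (fun h => ⟨start_eq h.1, start_eq h.2⟩)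
  start_next q := start_eq (by revert q; decide)
  joined_one q := by
    have key : ∀ q, ∃ d, vertexLabel d = vertexLabel (centreRep q) ∧
      vertexLabel (oppFun d) = vertexLabel (hubRep (q.1, 1)) := by decide
    obtain ⟨d, h1, h2⟩ := key q
    exact ⟨d, start_eq h1, start_eq h2⟩
  joined_two q := by
    have key : ∀ q, ∃ d, vertexLabel d = vertexLabel (centreRep q) ∧
      vertexLabel (oppFun d) = vertexLabel (hubRep (q.1, 2)) := by decide
    obtain ⟨d, h1, h2⟩ := key q
    exact ⟨d, start_eq h1, start_eq h2⟩
  rung r := by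
    have key : ∀ r, ∃ d, vertexLabel d = vertexLabel (hubRep (false, r)) ∧
      vertexLabel (oppFun d) = vertexLabel (hubRep (true, r)) := by decide
    obtain ⟨d, h1, h2⟩ := key r
    exact ⟨d, start_eq h1, start_eq h2⟩
  diagonal_zero := ⟨10, start_eq (by decide), start_eq (by decide)⟩
  diagonal_one := ⟨30, start_eq (by decide), start_eq (by decide)⟩

end TorusSurface

/-! ### Lattices between `ℤ²` and `p³ℤ × p²ℤ` -/

/-- The pairs of integers satisfying three divisibilities. -/
def congruenceLattice (A B C s t : ℤ) : AddSubgroup (ℤ × ℤ) where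
  carrier := {v | A ∣ v.1 ∧ B ∣ v.2 ∧ C ∣ s * v.1 + t * v.2}
  add_mem' := by
    rintro v w ⟨h1, h2, h3⟩ ⟨h4, h5, h6⟩
    refine ⟨dvd_add h1 h4, dvd_add h2 h5, ?_⟩
    have : s * (v + w).1 + t * (v + w).2 = (s * v.1 + t * v.2) + (s * w.1 + t * w.2) := by
      simp only [Prod.fst_add, Prod.snd_add]
      ring
    rw [this]
    exact dvd_add h3 h6
  zero_mem' := ⟨dvd_zero _, dvd_zero _, by simp⟩
  neg_mem' := by
    rintro v ⟨h1, h2, h3⟩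
    refine ⟨(dvd_neg).2 h1, (dvd_neg).2 h2, ?_⟩
    have : s * (-v).1 + t * (-v).2 = -(s * v.1 + t * v.2) := by
      simp only [Prod.fst_neg, Prod.snd_neg]
      ring
    rw [this]
    exact (dvd_neg).2 h3

theorem mem_congruenceLattice {A B C s t x y : ℤ} :
    (x, y) ∈ congruenceLattice A B C s t ↔ A ∣ x ∧ B ∣ y ∧ C ∣ s * x + t * y := Iff.rfl

namespace LatticeVertex

variable {p : ℕ}

/-- The lattice of a vertex of the model. -/
def lattice : LatticeVertex p → AddSubgroup (ℤ × ℤ)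
  | hub false 0 => congruenceLattice (p ^ 3) (p ^ 2) 1 0 0
  | hub false 1 => congruenceLattice (p ^ 2) p 1 0 0
  | hub false 2 => congruenceLattice p 1 1 0 0
  | hub true 0 => congruenceLattice (p ^ 2) (p ^ 2) 1 0 0
  | hub true 1 => congruenceLattice p p 1 0 0
  | hub true 2 => congruenceLattice 1 1 1 0 0
  | corner false j => congruenceLattice 1 p (p ^ 3) 1 (-(p * j))
  | centre false j => congruenceLattice 1 1 (p ^ 2) 1 (-(p * j))
  | mid false j t => congruenceLattice 1 1 (p ^ 3) 1 (-(p * (j + p * t)))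
  | corner true j => congruenceLattice p 1 (p ^ 2) (-j) 1
  | centre true j => congruenceLattice 1 1 p (-j) 1
  | mid true j t => congruenceLattice 1 1 (p ^ 2) (-(j + p * t)) 1

/-- The logarithm of the order of the subgroup of a vertex of the model. -/
def rank : LatticeVertex p → ℕ
  | hub false 0 => 0
  | hub false 1 => 2
  | hub false 2 => 4
  | hub true 0 => 1
  | hub true 1 => 3
  | hub true 2 => 5
  | corner false _ => 1
  | centre false _ => 3
  | mid false _ _ => 2
  | corner true _ => 2
  | centre true _ => 4
  | mid true _ _ => 3

end LatticeVertex

theorem fin_eq_of_dvd_sub {p : ℕ} {j j' : Fin p} (h : (p : ℤ) ∣ j - j') : j = j' := by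
  have := Int.eq_zero_of_abs_lt_dvd h (by
    rw [abs_lt]
    have := j.2
    have := j'.2
    constructor <;> omega)
  exact Fin.ext (by omega)

/-! ### Residues, and subgroups of ℤ containing a power of p -/

section Residues

variable {p : ℕ} (hp : p.Prime)

include hp

theorem exists_fin_dvd_sub (u : ℤ) : ∃ j : Fin p, (p : ℤ) ∣ u - j := by
  have hp0 : (0 : ℤ) < p := by exact_mod_cast hp.pos
  have h1 := Int.emod_nonneg u hp0.ne'
  have h2 := Int.emod_lt_of_pos u hp0
  refine ⟨⟨(u % p).toNat, by omega⟩, ?_⟩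
  have : ((⟨(u % p).toNat, by omega⟩ : Fin p) : ℕ) = (u % p).toNat := rfl
  rw [this, Int.toNat_of_nonneg h1]
  exact Int.dvd_self_sub_emod

theorem exists_fin_sq_dvd_sub (u : ℤ) : ∃ j t : Fin p, (p : ℤ) ^ 2 ∣ u - (j + p * t) := by
  obtain ⟨j, m, hm⟩ := exists_fin_dvd_sub hp u
  obtain ⟨t, n, hn⟩ := exists_fin_dvd_sub hp m
  exact ⟨j, t, n, by linear_combination hm + p * hn⟩

theorem exists_forall_mem_iff_pow_dvd {n : ℕ} (K : AddSubgroup ℤ) (hK : (p : ℤ) ^ n ∈ K) :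
    ∃ i ≤ n, ∀ x, x ∈ K ↔ (p : ℤ) ^ i ∣ x := by
  obtain ⟨a, rfl⟩ := Int.subgroup_cyclic K
  rw [AddSubgroup.mem_closure_singleton] at hK
  obtain ⟨m, hm⟩ := hK
  have hdvd : a.natAbs ∣ p ^ n := by
    have : a ∣ (p : ℤ) ^ n := ⟨m, by rw [← hm, smul_eq_mul, mul_comm]⟩
    have h2 := Int.natAbs_dvd_natAbs.2 this
    rwa [Int.natAbs_pow, Int.natAbs_natCast] at h2
  obtain ⟨i, hi, hai⟩ := (Nat.dvd_prime_pow hp).1 hdvd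
  refine ⟨i, hi, fun x => ?_⟩
  have h3 : (p : ℤ) ^ i = a.natAbs := by rw [hai]; push_cast; rfl
  rw [AddSubgroup.mem_closure_singleton, h3, Int.natAbs_dvd]
  constructor
  · rintro ⟨m, rfl⟩
    exact ⟨m, by rw [smul_eq_mul, mul_comm]⟩
  · rintro ⟨m, rfl⟩
    exact ⟨m, by rw [smul_eq_mul, mul_comm]⟩

theorem exists_mul_add_pow_mul_eq_one {x : ℤ} (hx : ¬ (p : ℤ) ∣ x) (n : ℕ) :
    ∃ a b : ℤ, a * x + b * (p : ℤ) ^ n = 1 := by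
  have hc : IsCoprime (p : ℤ) x :=
    (Prime.coprime_iff_not_dvd (Nat.prime_iff_prime_int.1 hp)).2 hx
  obtain ⟨a, b, h⟩ := (hc.pow_left (m := n)).symm
  exact ⟨a, b, h⟩

end Residues

/-! ### Classification of the lattices by divisibility of coordinates -/

section Classification

variable {p : ℕ} (hp : p.Prime) (H : AddSubgroup (ℤ × ℤ)) (h₁ : ((p : ℤ) ^ 3, (0 : ℤ)) ∈ H)
  (h₂ : ((0 : ℤ), (p : ℤ) ^ 2) ∈ H)

open LatticeVertex

theorem AddSubgroup.zsmul_pair_mem {H : AddSubgroup (ℤ × ℤ)} {x y : ℤ} (h : (x, y) ∈ H) (m : ℤ) :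
    (m * x, m * y) ∈ H := by
  simpa using H.zsmul_mem h m

theorem AddSubgroup.pair_mem_iff {H : AddSubgroup (ℤ × ℤ)} {x y : ℤ} (x' y' : ℤ)
    (h : (x', y') ∈ H) : (x, y) ∈ H ↔ (x - x', y - y') ∈ H := by
  refine ⟨fun h' => H.sub_mem h' h, fun h' => ?_⟩
  have := H.add_mem h' h
  rwa [Prod.mk_add_mk, sub_add_cancel, sub_add_cancel] at this

include hp h₂ in
-- Subtracting a multiple of (1, u) reduces membership to vectors on the second axis, so `H` is
-- determined by `u` and by the power of p generating its part there. Only the residue of `u` modulo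
-- that power matters. The next lemmas repeat this with other leading vectors.
theorem exists_eq_lattice_of_one_mem {u : ℤ} (hu : (1, u) ∈ H) :
    ∃ v : LatticeVertex p, H = v.lattice := by
  obtain ⟨i, hi, hK⟩ := exists_forall_mem_iff_pow_dvd hp
    (H.comap (AddMonoidHom.inr ℤ ℤ)) (n := 2) h₂
  have hH : ∀ x y, (x, y) ∈ H ↔ (p : ℤ) ^ i ∣ y - u * x := by
    intro x y
    rw [← hK, AddSubgroup.pair_mem_iff (x * 1) (x * u) (H.zsmul_pair_mem hu x)]
    simp [mul_comm]
  interval_cases i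
  · refine ⟨hub true 2, ?_⟩
    ext ⟨x, y⟩
    rw [hH, lattice, mem_congruenceLattice]
    simp
  · obtain ⟨j, hj⟩ := exists_fin_dvd_sub hp u
    refine ⟨centre true j, ?_⟩
    ext ⟨x, y⟩
    rw [hH, lattice, mem_congruenceLattice, pow_one]
    simp only [one_dvd, true_and]
    refine dvd_iff_dvd_of_dvd_sub ?_
    have : y - u * x - (-(j : ℤ) * x + 1 * y) = (u - j) * (-x) := by ring
    rw [this]
    exact dvd_mul_of_dvd_left hj _
  · obtain ⟨j, t, hj⟩ := exists_fin_sq_dvd_sub hp u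
    refine ⟨mid true j t, ?_⟩
    ext ⟨x, y⟩
    rw [hH, lattice, mem_congruenceLattice]
    simp only [one_dvd, true_and]
    refine dvd_iff_dvd_of_dvd_sub ?_
    have : y - u * x - (-(j + p * t : ℤ) * x + 1 * y) = (u - (j + p * t)) * (-x) := by ring
    rw [this]
    exact dvd_mul_of_dvd_left hj _

include hp h₁ in
theorem exists_eq_lattice_of_dvd_fst (hx : ∀ x y, (x, y) ∈ H → (p : ℤ) ∣ x) {u : ℤ}
    (hu : (p * u, 1) ∈ H) : ∃ v : LatticeVertex p, H = v.lattice := by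
  obtain ⟨i, hi, hK⟩ := exists_forall_mem_iff_pow_dvd hp
    (H.comap (AddMonoidHom.inl ℤ ℤ)) (n := 3) h₁
  have hH : ∀ x y, (x, y) ∈ H ↔ (p : ℤ) ^ i ∣ x - p * u * y := by
    intro x y
    rw [← hK, AddSubgroup.pair_mem_iff (y * (p * u)) (y * 1) (H.zsmul_pair_mem hu y)]
    simp [mul_comm]
  interval_cases i
  · have := hx 1 0 ((hH _ _).2 (by simp))
    exact absurd this (Nat.prime_iff_prime_int.1 hp).not_dvd_one
  · refine ⟨hub false 2, ?_⟩
    ext ⟨x, y⟩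
    rw [hH, lattice, mem_congruenceLattice, pow_one]
    simp only [one_dvd, and_true]
    exact dvd_sub_left (Dvd.intro _ (mul_assoc _ _ _).symm)
  · obtain ⟨j, m, hm⟩ := exists_fin_dvd_sub hp u
    refine ⟨centre false j, ?_⟩
    ext ⟨x, y⟩
    rw [hH, lattice, mem_congruenceLattice]
    simp only [one_dvd, true_and]
    refine dvd_iff_dvd_of_dvd_sub ⟨-m * y, ?_⟩
    linear_combination (-p * y) * hm
  · obtain ⟨j, t, m, hm⟩ := exists_fin_sq_dvd_sub hp u
    refine ⟨mid false j t, ?_⟩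
    ext ⟨x, y⟩
    rw [hH, lattice, mem_congruenceLattice]
    simp only [one_dvd, true_and]
    refine dvd_iff_dvd_of_dvd_sub ⟨-m * y, ?_⟩
    linear_combination (-p * y) * hm

include hp h₂ in
theorem exists_eq_lattice_of_dvd_of_mem (hx : ∀ x y, (x, y) ∈ H → (p : ℤ) ∣ x)
    (hy : ∀ x y, (x, y) ∈ H → (p : ℤ) ∣ y) {u : ℤ} (hu : ((p : ℤ), p * u) ∈ H) :
    ∃ v : LatticeVertex p, H = v.lattice := by
  obtain ⟨i, hi, hK⟩ := exists_forall_mem_iff_pow_dvd hp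
    (H.comap (AddMonoidHom.inr ℤ ℤ)) (n := 2) h₂
  have hH : ∀ x y, (x, y) ∈ H ↔ (p : ℤ) ∣ x ∧ (p : ℤ) ^ i ∣ y - u * x := by
    intro x y
    have key : ∀ m : ℤ, ((p : ℤ) * m, y) ∈ H ↔ (p : ℤ) ^ i ∣ y - u * (p * m) := by
      intro m
      have e : y - u * (p * m) = y - m * ((p : ℤ) * u) := by ring
      rw [← hK, AddSubgroup.pair_mem_iff _ _ (H.zsmul_pair_mem hu m), e, mul_comm (p : ℤ) m,
        sub_self]
      rfl
    refine ⟨fun h => ⟨hx x y h, ?_⟩, ?_⟩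
    · obtain ⟨m, rfl⟩ := hx x y h
      exact (key m).1 h
    · rintro ⟨⟨m, rfl⟩, h⟩
      exact (key m).2 h
  interval_cases i
  · have := hy 0 1 ((hH _ _).2 (by simp))
    exact absurd this (Nat.prime_iff_prime_int.1 hp).not_dvd_one
  · refine ⟨hub true 1, ?_⟩
    ext ⟨x, y⟩
    rw [hH, lattice, mem_congruenceLattice, pow_one]
    simp only [one_dvd, and_true]
    refine and_congr_right fun h => ?_
    exact dvd_sub_left (dvd_mul_of_dvd_right h _)
  · obtain ⟨j, m, hm⟩ := exists_fin_dvd_sub hp u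
    refine ⟨corner true j, ?_⟩
    ext ⟨x, y⟩
    rw [hH, lattice, mem_congruenceLattice]
    simp only [one_dvd, true_and]
    refine and_congr_right fun ⟨n, hn⟩ => dvd_iff_dvd_of_dvd_sub ⟨-m * n, ?_⟩
    linear_combination -x * hm - p * m * hn

include hp h₁ in
theorem exists_eq_lattice_of_sq_dvd_of_mem (hx : ∀ x y, (x, y) ∈ H → (p : ℤ) ^ 2 ∣ x)
    (hy : ∀ x y, (x, y) ∈ H → (p : ℤ) ∣ y) {u : ℤ} (hu : ((p : ℤ) ^ 2 * u, (p : ℤ)) ∈ H) :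
    ∃ v : LatticeVertex p, H = v.lattice := by
  obtain ⟨i, hi, hK⟩ := exists_forall_mem_iff_pow_dvd hp
    (H.comap (AddMonoidHom.inl ℤ ℤ)) (n := 3) h₁
  have hH : ∀ x y, (x, y) ∈ H ↔ (p : ℤ) ∣ y ∧ (p : ℤ) ^ i ∣ x - p * u * y := by
    intro x y
    have key : ∀ m : ℤ, (x, (p : ℤ) * m) ∈ H ↔ (p : ℤ) ^ i ∣ x - p * u * (p * m) := by
      intro m
      have e : x - p * u * (p * m) = x - m * ((p : ℤ) ^ 2 * u) := by ring
      rw [← hK, AddSubgroup.pair_mem_iff _ _ (H.zsmul_pair_mem hu m), e, mul_comm (p : ℤ) m,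
        sub_self]
      rfl
    refine ⟨fun h => ⟨hy x y h, ?_⟩, ?_⟩
    · obtain ⟨m, rfl⟩ := hy x y h
      exact (key m).1 h
    · rintro ⟨⟨m, rfl⟩, h⟩
      exact (key m).2 h
  have hi2 : 2 ≤ i := by
    have h := hx ((p : ℤ) ^ i) 0 ((hH _ _).2 (by simp))
    exact (Nat.pow_dvd_pow_iff_le_right hp.one_lt).1 (by exact_mod_cast h)
  interval_cases i
  · refine ⟨hub false 1, ?_⟩
    ext ⟨x, y⟩
    rw [hH, lattice, mem_congruenceLattice, and_comm]
    simp only [one_dvd, and_true]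
    refine and_congr_left fun ⟨m, hm⟩ => ?_
    exact dvd_sub_left ⟨u * m, by rw [hm]; ring⟩
  · obtain ⟨j, m, hm⟩ := exists_fin_dvd_sub hp u
    refine ⟨corner false j, ?_⟩
    ext ⟨x, y⟩
    rw [hH, lattice, mem_congruenceLattice]
    simp only [one_dvd, true_and]
    refine and_congr_right fun ⟨n, hn⟩ => dvd_iff_dvd_of_dvd_sub ⟨-m * n, ?_⟩
    linear_combination (-p * y) * hm - p * p * m * hn

include hp h₁ h₂ in
theorem exists_eq_lattice_of_sq_dvd (hx : ∀ x y, (x, y) ∈ H → (p : ℤ) ^ 2 ∣ x)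
    (hy : ∀ x y, (x, y) ∈ H → (p : ℤ) ^ 2 ∣ y) : ∃ v : LatticeVertex p, H = v.lattice := by
  obtain ⟨i, hi, hK⟩ := exists_forall_mem_iff_pow_dvd hp
    (H.comap (AddMonoidHom.inl ℤ ℤ)) (n := 3) h₁
  have hH : ∀ x y, (x, y) ∈ H ↔ (p : ℤ) ^ 2 ∣ y ∧ (p : ℤ) ^ i ∣ x := by
    intro x y
    have key : ∀ m : ℤ, (x, (p : ℤ) ^ 2 * m) ∈ H ↔ (p : ℤ) ^ i ∣ x := by
      intro m
      rw [← hK, AddSubgroup.pair_mem_iff _ _ (H.zsmul_pair_mem h₂ m)]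
      simp [mul_comm]
    refine ⟨fun h => ⟨hy x y h, ?_⟩, ?_⟩
    · obtain ⟨m, rfl⟩ := hy x y h
      exact (key m).1 h
    · rintro ⟨⟨m, rfl⟩, h⟩
      exact (key m).2 h
  have hi2 : 2 ≤ i := by
    have h := hx ((p : ℤ) ^ i) 0 ((hH _ _).2 (by simp))
    exact (Nat.pow_dvd_pow_iff_le_right hp.one_lt).1 (by exact_mod_cast h)
  interval_cases i
  · refine ⟨hub true 0, ?_⟩
    ext ⟨x, y⟩
    rw [hH, lattice, mem_congruenceLattice, and_comm]
    simp
  · refine ⟨hub false 0, ?_⟩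
    ext ⟨x, y⟩
    rw [hH, lattice, mem_congruenceLattice, and_comm]
    simp

include hp h₁ h₂ in
/-- The lattices between `p³ℤ × p²ℤ` and `ℤ²` are those of the vertices of the model. -/
theorem exists_eq_lattice : ∃ v : LatticeVertex p, H = v.lattice := by
  have hmem := fun {x y : ℤ} (h : (x, y) ∈ H) (a b c : ℤ) =>
    H.add_mem (H.add_mem (H.zsmul_pair_mem h a) (H.zsmul_pair_mem h₁ b)) (H.zsmul_pair_mem h₂ c)
  -- Each failure of divisibility provides a coordinate that is a unit modulo p, up to a known
  -- factor. A Bézout combination with the vectors of `h₁` or `h₂` normalises it to 1 or p.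
  by_cases hx : ∀ x y, (x, y) ∈ H → (p : ℤ) ∣ x
  swap
  · push Not at hx
    obtain ⟨x, y, h, hpx⟩ := hx
    obtain ⟨a, b, hab⟩ := exists_mul_add_pow_mul_eq_one hp hpx 3
    refine exists_eq_lattice_of_one_mem hp H h₂ (u := a * y) ?_
    convert hmem h a b 0 using 1
    exact Prod.ext (by simp [hab]) (by simp)
  by_cases hy : ∀ x y, (x, y) ∈ H → (p : ℤ) ∣ y
  swap
  · push Not at hy
    obtain ⟨x, y, h, hpy⟩ := hy
    obtain ⟨u, rfl⟩ := hx x y h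
    obtain ⟨a, b, hab⟩ := exists_mul_add_pow_mul_eq_one hp hpy 2
    refine exists_eq_lattice_of_dvd_fst hp H h₁ hx (u := a * u) ?_
    convert hmem h a 0 b using 1
    exact Prod.ext (by simp; ring) (by simp [hab])
  by_cases hx2 : ∀ x y, (x, y) ∈ H → (p : ℤ) ^ 2 ∣ x
  swap
  · push Not at hx2
    obtain ⟨x, y, h, hpx⟩ := hx2
    obtain ⟨x, rfl⟩ := hx x y h
    obtain ⟨u, rfl⟩ := hy _ y h
    -- The exponent is 2 because the relation is multiplied by p before p³ is used.
    obtain ⟨a, b, hab⟩ := exists_mul_add_pow_mul_eq_one hp (x := x) (fun ⟨m, hm⟩ =>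
      hpx ⟨m, by rw [hm]; ring⟩) 2
    refine exists_eq_lattice_of_dvd_of_mem hp H h₂ hx hy (u := a * u) ?_
    convert hmem h a b 0 using 1
    exact Prod.ext (by simp; linear_combination (-(p : ℤ)) * hab) (by simp; ring)
  by_cases hy2 : ∀ x y, (x, y) ∈ H → (p : ℤ) ^ 2 ∣ y
  · exact exists_eq_lattice_of_sq_dvd hp H h₁ h₂ hx2 hy2
  · push Not at hy2
    obtain ⟨x, y, h, hpy⟩ := hy2
    obtain ⟨u, rfl⟩ := hx2 x y h
    obtain ⟨y, rfl⟩ := hy _ y h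
    obtain ⟨a, b, hab⟩ := exists_mul_add_pow_mul_eq_one hp (x := y) (fun ⟨m, hm⟩ =>
      hpy ⟨m, by rw [hm]; ring⟩) 1
    refine exists_eq_lattice_of_sq_dvd_of_mem hp H h₁ hx2 hy (u := a * u) ?_
    convert hmem h a 0 b using 1
    exact Prod.ext (by simp; ring) (by simp; linear_combination (-(p : ℤ)) * hab)

end Classification

/-! ### Inclusions between the lattices of the model -/

namespace LatticeVertex

variable {p : ℕ} {u v : LatticeVertex p}

theorem hub_zero_le (v : LatticeVertex p) : lattice (hub (p := p) false 0) ≤ lattice v := by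
  rintro ⟨x, y⟩ h
  obtain ⟨⟨a, rfl⟩, ⟨b, rfl⟩, -⟩ := mem_congruenceLattice.1 h
  rcases v with ⟨_ | _, r⟩ | ⟨_ | _, j⟩ | ⟨_ | _, j⟩ | ⟨_ | _, j, t⟩
  · fin_cases r
    · exact h
    · exact mem_congruenceLattice.2 ⟨⟨p * a, by ring⟩, ⟨p * b, by ring⟩, one_dvd _⟩
    · exact mem_congruenceLattice.2 ⟨⟨p ^ 2 * a, by ring⟩, one_dvd _, one_dvd _⟩
  · fin_cases r
    · exact mem_congruenceLattice.2 ⟨⟨p * a, by ring⟩, ⟨b, by ring⟩, one_dvd _⟩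
    · exact mem_congruenceLattice.2 ⟨⟨p ^ 2 * a, by ring⟩, ⟨p * b, by ring⟩, one_dvd _⟩
    · exact mem_congruenceLattice.2 ⟨one_dvd _, one_dvd _, one_dvd _⟩
  · exact mem_congruenceLattice.2 ⟨one_dvd _, one_dvd _, ⟨p * a - p * j * b, by ring⟩⟩
  · exact mem_congruenceLattice.2 ⟨one_dvd _, one_dvd _, ⟨-j * p ^ 2 * a + p * b, by ring⟩⟩
  · exact mem_congruenceLattice.2 ⟨one_dvd _, ⟨p * b, by ring⟩, ⟨a - j * b, by ring⟩⟩
  · exact mem_congruenceLattice.2 ⟨⟨p ^ 2 * a, by ring⟩, one_dvd _, ⟨-j * p * a + b, by ring⟩⟩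
  · exact mem_congruenceLattice.2 ⟨one_dvd _, one_dvd _, ⟨a - (j + p * t) * b, by ring⟩⟩
  · exact mem_congruenceLattice.2 ⟨one_dvd _, one_dvd _, ⟨-(j + p * t) * p * a + b, by ring⟩⟩

/-! ### Test vectors that refute inclusions and compare parameters -/

section Generators

theorem mem_corner_false (j : Fin p) :
    ((p : ℤ) ^ 2 * j, (p : ℤ)) ∈ lattice (corner false j) :=
  mem_congruenceLattice.2 ⟨one_dvd _, dvd_rfl, ⟨0, by ring⟩⟩

theorem mem_corner_true (j : Fin p) : ((p : ℤ), (p : ℤ) * j) ∈ lattice (corner true j) :=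
  mem_congruenceLattice.2 ⟨dvd_rfl, one_dvd _, ⟨0, by ring⟩⟩

theorem mem_mid_false (j t : Fin p) :
    ((p : ℤ) * (j + p * t), (1 : ℤ)) ∈ lattice (mid false j t) :=
  mem_congruenceLattice.2 ⟨one_dvd _, one_dvd _, ⟨0, by ring⟩⟩

theorem mem_mid_true (j t : Fin p) : ((1 : ℤ), (j : ℤ) + p * t) ∈ lattice (mid true j t) :=
  mem_congruenceLattice.2 ⟨one_dvd _, one_dvd _, ⟨0, by ring⟩⟩

theorem mem_centre_false (j : Fin p) : ((p : ℤ) * j, (1 : ℤ)) ∈ lattice (centre false j) :=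
  mem_congruenceLattice.2 ⟨one_dvd _, one_dvd _, ⟨0, by ring⟩⟩

theorem mem_centre_true (j : Fin p) : ((1 : ℤ), (j : ℤ)) ∈ lattice (centre true j) :=
  mem_congruenceLattice.2 ⟨one_dvd _, one_dvd _, ⟨0, by ring⟩⟩

theorem mem_hub_false_one_left : ((p : ℤ) ^ 2, (0 : ℤ)) ∈ lattice (hub (p := p) false 1) :=
  mem_congruenceLattice.2 ⟨dvd_rfl, dvd_zero _, one_dvd _⟩

theorem mem_hub_false_one_right : ((0 : ℤ), (p : ℤ)) ∈ lattice (hub (p := p) false 1) :=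
  mem_congruenceLattice.2 ⟨dvd_zero _, dvd_rfl, one_dvd _⟩

theorem mem_hub_true_zero : ((p : ℤ) ^ 2, (0 : ℤ)) ∈ lattice (hub (p := p) true 0) :=
  mem_congruenceLattice.2 ⟨dvd_rfl, dvd_zero _, one_dvd _⟩

end Generators

section Prime

variable (hp : p.Prime)

include hp

theorem not_dvd_one : ¬ (p : ℤ) ∣ 1 := (Nat.prime_iff_prime_int.1 hp).not_dvd_one

theorem not_pow_succ_dvd_pow (n : ℕ) : ¬ (p : ℤ) ^ (n + 1) ∣ (p : ℤ) ^ n := by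
  intro h
  have h' : p ^ (n + 1) ∣ p ^ n := by exact_mod_cast h
  have := (Nat.pow_dvd_pow_iff_le_right hp.one_lt).1 h'
  omega

theorem not_sq_dvd : ¬ (p : ℤ) ^ 2 ∣ (p : ℤ) := by
  simpa using not_pow_succ_dvd_pow hp 1

theorem cast_ne_zero : (p : ℤ) ≠ 0 := by exact_mod_cast hp.ne_zero

/-- The direction of a link is that of the drawing, not of inclusion: side `true` and side `false`
have the same links, and in both the order climbs from hub 0 through corner, midpoint and centre to
hub 2. Hence the two alternatives. -/
theorem lattice_lt_of_link (h : Link u v) :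
    (lattice u < lattice v ∧ rank v = rank u + 1) ∨
      (lattice v < lattice u ∧ rank u = rank v + 1) := by
  have n1 := not_dvd_one hp
  have n2 := not_sq_dvd hp
  have n3 := not_pow_succ_dvd_pow hp 2
  cases h with
  | corner_hub_zero σ j =>
    refine Or.inr ⟨?_, by cases σ <;> rfl⟩
    cases σ
    · exact lt_of_le_not_ge (hub_zero_le _) fun h =>
        n2 (mem_congruenceLattice.1 (h (mem_corner_false j))).2.1
    · refine lt_of_le_not_ge ?_ fun h => n2 (mem_congruenceLattice.1 (h (mem_corner_true j))).1
      rintro ⟨x, y⟩ h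
      obtain ⟨⟨a, rfl⟩, ⟨b, rfl⟩, -⟩ := mem_congruenceLattice.1 h
      exact mem_congruenceLattice.2 ⟨⟨p * a, by ring⟩, one_dvd _, ⟨-j * a + b, by ring⟩⟩
  | corner_hub_one σ j =>
    refine Or.inl ⟨?_, by cases σ <;> rfl⟩
    cases σ
    · refine lt_of_le_not_ge ?_ fun h => n3 (by
        simpa using (mem_congruenceLattice.1 (h mem_hub_false_one_left)).2.2)
      rintro ⟨x, y⟩ h
      obtain ⟨-, ⟨b, rfl⟩, ⟨c, hc⟩⟩ := mem_congruenceLattice.1 h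
      exact mem_congruenceLattice.2 ⟨⟨p * c + j * b, by linear_combination hc⟩, ⟨b, rfl⟩, one_dvd _⟩
    · refine lt_of_le_not_ge ?_ fun h => n2 (by
        have h' : ((0 : ℤ), (p : ℤ)) ∈ lattice (hub (p := p) true 1) :=
          mem_congruenceLattice.2 ⟨dvd_zero _, dvd_rfl, one_dvd _⟩
        simpa using (mem_congruenceLattice.1 (h h')).2.2)
      rintro ⟨x, y⟩ h
      obtain ⟨⟨a, rfl⟩, -, ⟨c, hc⟩⟩ := mem_congruenceLattice.1 h
      exact mem_congruenceLattice.2 ⟨⟨a, rfl⟩, ⟨p * c + j * a, by linear_combination hc⟩, one_dvd _⟩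
  | centre_hub_one σ j =>
    refine Or.inr ⟨?_, by cases σ <;> rfl⟩
    cases σ
    · refine lt_of_le_not_ge ?_ fun h => n1 (mem_congruenceLattice.1 (h (mem_centre_false j))).2.1
      rintro ⟨x, y⟩ h
      obtain ⟨⟨a, rfl⟩, ⟨b, rfl⟩, -⟩ := mem_congruenceLattice.1 h
      exact mem_congruenceLattice.2 ⟨one_dvd _, one_dvd _, ⟨a - j * b, by ring⟩⟩
    · refine lt_of_le_not_ge ?_ fun h => n1 (mem_congruenceLattice.1 (h (mem_centre_true j))).1
      rintro ⟨x, y⟩ h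
      obtain ⟨⟨a, rfl⟩, ⟨b, rfl⟩, -⟩ := mem_congruenceLattice.1 h
      exact mem_congruenceLattice.2 ⟨one_dvd _, one_dvd _, ⟨-j * a + b, by ring⟩⟩
  | centre_hub_two σ j =>
    refine Or.inl ⟨?_, by cases σ <;> rfl⟩
    cases σ
    · refine lt_of_le_not_ge ?_ fun h => n2 (by
        have h' : ((p : ℤ), (0 : ℤ)) ∈ lattice (hub (p := p) false 2) :=
          mem_congruenceLattice.2 ⟨dvd_rfl, one_dvd _, one_dvd _⟩
        simpa using (mem_congruenceLattice.1 (h h')).2.2)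
      rintro ⟨x, y⟩ h
      obtain ⟨-, -, ⟨c, hc⟩⟩ := mem_congruenceLattice.1 h
      exact mem_congruenceLattice.2
        ⟨⟨p * c + j * y, by linear_combination hc⟩, one_dvd _, one_dvd _⟩
    · refine lt_of_le_not_ge ?_ fun h => n1 (by
        have h' : ((0 : ℤ), (1 : ℤ)) ∈ lattice (hub (p := p) true 2) :=
          mem_congruenceLattice.2 ⟨one_dvd _, one_dvd _, one_dvd _⟩
        simpa using (mem_congruenceLattice.1 (h h')).2.2)
      exact fun _ _ => mem_congruenceLattice.2 ⟨one_dvd _, one_dvd _, one_dvd _⟩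
  | mid_corner σ j t =>
    refine Or.inr ⟨?_, by cases σ <;> rfl⟩
    cases σ
    · refine lt_of_le_not_ge ?_ fun h => n1 (mem_congruenceLattice.1 (h (mem_mid_false j t))).2.1
      rintro ⟨x, y⟩ h
      obtain ⟨-, ⟨b, rfl⟩, ⟨c, hc⟩⟩ := mem_congruenceLattice.1 h
      exact mem_congruenceLattice.2
        ⟨one_dvd _, one_dvd _, ⟨c - t * b, by linear_combination hc⟩⟩
    · refine lt_of_le_not_ge ?_ fun h => n1 (mem_congruenceLattice.1 (h (mem_mid_true j t))).1
      rintro ⟨x, y⟩ h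
      obtain ⟨⟨a, rfl⟩, -, ⟨c, hc⟩⟩ := mem_congruenceLattice.1 h
      exact mem_congruenceLattice.2
        ⟨one_dvd _, one_dvd _, ⟨c - t * a, by linear_combination hc⟩⟩
  | mid_centre σ j t =>
    refine Or.inl ⟨?_, by cases σ <;> rfl⟩
    cases σ
    · refine lt_of_le_not_ge ?_ fun h => n3 (by
        have h' : ((p : ℤ) ^ 2, (0 : ℤ)) ∈ lattice (centre false j) :=
          mem_congruenceLattice.2 ⟨one_dvd _, one_dvd _, ⟨1, by ring⟩⟩
        simpa using (mem_congruenceLattice.1 (h h')).2.2)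
      rintro ⟨x, y⟩ h
      obtain ⟨-, -, ⟨c, hc⟩⟩ := mem_congruenceLattice.1 h
      exact mem_congruenceLattice.2
        ⟨one_dvd _, one_dvd _, ⟨p * c + t * y, by linear_combination hc⟩⟩
    · refine lt_of_le_not_ge ?_ fun h => n2 (by
        have h' : ((0 : ℤ), (p : ℤ)) ∈ lattice (centre true j) :=
          mem_congruenceLattice.2 ⟨one_dvd _, one_dvd _, ⟨1, by ring⟩⟩
        simpa using (mem_congruenceLattice.1 (h h')).2.2)
      rintro ⟨x, y⟩ h
      obtain ⟨-, -, ⟨c, hc⟩⟩ := mem_congruenceLattice.1 h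
      exact mem_congruenceLattice.2
        ⟨one_dvd _, one_dvd _, ⟨p * c + t * x, by linear_combination hc⟩⟩
  | rung r =>
    refine Or.inl ⟨?_, by fin_cases r <;> rfl⟩
    fin_cases r
    · exact lt_of_le_not_ge (hub_zero_le _) fun h =>
        n3 (mem_congruenceLattice.1 (h mem_hub_true_zero)).1
    · refine lt_of_le_not_ge ?_ fun h => n2 (by
        have h' : ((p : ℤ), (0 : ℤ)) ∈ lattice (hub (p := p) true 1) :=
          mem_congruenceLattice.2 ⟨dvd_rfl, dvd_zero _, one_dvd _⟩
        exact (mem_congruenceLattice.1 (h h')).1)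
      rintro ⟨x, y⟩ h
      obtain ⟨⟨a, rfl⟩, h2, -⟩ := mem_congruenceLattice.1 h
      exact mem_congruenceLattice.2 ⟨⟨p * a, by ring⟩, h2, one_dvd _⟩
    · refine lt_of_le_not_ge ?_ fun h => n1 (by
        have h' : ((1 : ℤ), (0 : ℤ)) ∈ lattice (hub (p := p) true 2) :=
          mem_congruenceLattice.2 ⟨one_dvd _, one_dvd _, one_dvd _⟩
        exact (mem_congruenceLattice.1 (h h')).1)
      exact fun _ _ => mem_congruenceLattice.2 ⟨one_dvd _, one_dvd _, one_dvd _⟩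
  | diagonal_zero =>
    refine Or.inl ⟨?_, rfl⟩
    refine lt_of_le_not_ge ?_ fun h =>
      n2 (mem_congruenceLattice.1 (h mem_hub_false_one_right)).2.1
    rintro ⟨x, y⟩ h
    obtain ⟨h1, ⟨b, rfl⟩, -⟩ := mem_congruenceLattice.1 h
    exact mem_congruenceLattice.2 ⟨h1, ⟨p * b, by ring⟩, one_dvd _⟩
  | diagonal_one =>
    refine Or.inl ⟨?_, rfl⟩
    refine lt_of_le_not_ge ?_ fun h => n1 (by
      have h' : ((0 : ℤ), (1 : ℤ)) ∈ lattice (hub (p := p) false 2) :=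
        mem_congruenceLattice.2 ⟨dvd_zero _, one_dvd _, one_dvd _⟩
      exact (mem_congruenceLattice.1 (h h')).2.1)
    rintro ⟨x, y⟩ h
    exact mem_congruenceLattice.2 ⟨(mem_congruenceLattice.1 h).1, one_dvd _, one_dvd _⟩

end Prime

theorem rank_le_five (v : LatticeVertex p) : rank v ≤ 5 := by
  rcases v with ⟨_ | _, r⟩ | ⟨_ | _, j⟩ | ⟨_ | _, j⟩ | ⟨_ | _, j, t⟩ <;>
    (try fin_cases r) <;> simp [rank]

theorem eq_of_rank_eq_zero (h : rank v = 0) : v = hub false 0 := by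
  rcases v with ⟨_ | _, r⟩ | ⟨_ | _, j⟩ | ⟨_ | _, j⟩ | ⟨_ | _, j, t⟩ <;>
    (try fin_cases r) <;> simp [rank] at h ⊢

theorem eq_of_rank_eq_one (h : rank v = 1) : v = hub true 0 ∨ ∃ j, v = corner false j := by
  rcases v with ⟨_ | _, r⟩ | ⟨_ | _, j⟩ | ⟨_ | _, j⟩ | ⟨_ | _, j, t⟩ <;>
    (try fin_cases r) <;> simp [rank] at h ⊢

theorem eq_of_rank_eq_two (h : rank v = 2) :
    v = hub false 1 ∨ (∃ j, v = corner true j) ∨ ∃ j t, v = mid false j t := by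
  rcases v with ⟨_ | _, r⟩ | ⟨_ | _, j⟩ | ⟨_ | _, j⟩ | ⟨_ | _, j, t⟩ <;>
    (try fin_cases r) <;> simp [rank] at h ⊢

theorem eq_of_rank_eq_three (h : rank v = 3) :
    v = hub true 1 ∨ (∃ j, v = centre false j) ∨ ∃ j t, v = mid true j t := by
  rcases v with ⟨_ | _, r⟩ | ⟨_ | _, j⟩ | ⟨_ | _, j⟩ | ⟨_ | _, j, t⟩ <;>
    (try fin_cases r) <;> simp [rank] at h ⊢

theorem eq_of_rank_eq_four (h : rank v = 4) : v = hub false 2 ∨ ∃ j, v = centre true j := by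
  rcases v with ⟨_ | _, r⟩ | ⟨_ | _, j⟩ | ⟨_ | _, j⟩ | ⟨_ | _, j, t⟩ <;>
    (try fin_cases r) <;> simp [rank] at h ⊢

theorem eq_of_rank_eq_five (h : rank v = 5) : v = hub true 2 := by
  rcases v with ⟨_ | _, r⟩ | ⟨_ | _, j⟩ | ⟨_ | _, j⟩ | ⟨_ | _, j, t⟩ <;>
    (try fin_cases r) <;> simp [rank] at h ⊢

section Prime

variable (hp : p.Prime)

include hp

/-- Cancelling p^n leaves a congruence modulo p between two parameters in the range 0, …, p-1. The
term p·a absorbs the second digit of a midpoint. -/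
theorem eq_of_mul_sub_eq {a c : ℤ} {n : ℕ} {j j' : Fin p}
    (h : (p : ℤ) ^ n * (j - j' + p * a) = (p : ℤ) ^ (n + 1) * c) : j = j' := by
  refine fin_eq_of_dvd_sub ⟨c - a, ?_⟩
  have h0 := pow_ne_zero n (cast_ne_zero hp)
  have : (j : ℤ) - j' + p * a = p * c := mul_left_cancel₀ h0 (by rw [h]; ring)
  linear_combination this

/-- Within one rank at most three families occur. A test vector of one lattice separates it from the
other families, and its congruence in an equal lattice of the same family recovers the parameters
digit by digit. -/
theorem eq_of_lattice_eq (h : lattice u = lattice v) (hr : rank u = rank v) : u = v := by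
  have n1 := not_dvd_one hp
  have n2 := not_sq_dvd hp
  have n3 := not_pow_succ_dvd_pow hp 2
  have x1 : ∀ j : Fin p, lattice (hub true 0) ≠ lattice (corner false j) := fun j h => n3 (by
    simpa using (mem_congruenceLattice.1 (h.le mem_hub_true_zero)).2.2)
  have x2 : ∀ j : Fin p, lattice (hub false 1) ≠ lattice (corner true j) := fun j h => n2 (by
    simpa using (mem_congruenceLattice.1 (h.le mem_hub_false_one_right)).2.2)
  have x3 : ∀ j t : Fin p, lattice (hub false 1) ≠ lattice (mid false j t) := fun j t h => n3 (by
    simpa using (mem_congruenceLattice.1 (h.le mem_hub_false_one_left)).2.2)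
  have x4 : ∀ i j t : Fin p, lattice (corner true i) ≠ lattice (mid false j t) := fun i j t h => by
    obtain ⟨c, hc⟩ := (mem_congruenceLattice.1 (h.le (mem_corner_true i))).2.2
    exact n2 ⟨p * c + (j + p * t) * i, by linear_combination hc⟩
  have x5 : ∀ j : Fin p, lattice (centre false j) ≠ lattice (hub true 1) := fun j h =>
    n1 (mem_congruenceLattice.1 (h.le (mem_centre_false j))).2.1
  have x6 : ∀ j t : Fin p, lattice (mid true j t) ≠ lattice (hub true 1) := fun j t h =>
    n1 (mem_congruenceLattice.1 (h.le (mem_mid_true j t))).1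
  have x7 : ∀ j t i : Fin p, lattice (mid true j t) ≠ lattice (centre false i) := fun j t i h => by
    obtain ⟨c, hc⟩ := (mem_congruenceLattice.1 (h.le (mem_mid_true j t))).2.2
    exact n1 ⟨p * c + i * (j + p * t), by linear_combination hc⟩
  have x8 : ∀ j : Fin p, lattice (centre true j) ≠ lattice (hub false 2) := fun j h =>
    n1 (mem_congruenceLattice.1 (h.le (mem_centre_true j))).1
  have hp0 := cast_ne_zero hp
  have hv := rank_le_five v
  obtain ⟨n, hn⟩ : ∃ n, rank v = n := ⟨_, rfl⟩
  rw [hn] at hr hv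
  interval_cases n
  · rw [eq_of_rank_eq_zero hr, eq_of_rank_eq_zero hn]
  · rcases eq_of_rank_eq_one hr with rfl | ⟨j, rfl⟩ <;>
      rcases eq_of_rank_eq_one hn with rfl | ⟨j', rfl⟩
    · rfl
    · exact absurd h (x1 _)
    · exact absurd h.symm (x1 _)
    · obtain ⟨c, hc⟩ := (mem_congruenceLattice.1 (h.le (mem_corner_false j))).2.2
      rw [eq_of_mul_sub_eq hp (n := 2) (a := 0) (j := j) (j' := j') (c := c)
        (by linear_combination hc)]
  · rcases eq_of_rank_eq_two hr with rfl | ⟨j, rfl⟩ | ⟨j, t, rfl⟩ <;>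
      rcases eq_of_rank_eq_two hn with rfl | ⟨j', rfl⟩ | ⟨j', t', rfl⟩
    · rfl
    · exact absurd h (x2 _)
    · exact absurd h (x3 _ _)
    · exact absurd h.symm (x2 _)
    · obtain ⟨c, hc⟩ := (mem_congruenceLattice.1 (h.le (mem_corner_true j))).2.2
      rw [eq_of_mul_sub_eq hp (n := 1) (a := 0) (j := j) (j' := j') (c := c)
        (by linear_combination hc)]
    · exact absurd h (x4 _ _ _)
    · exact absurd h.symm (x3 _ _)
    · exact absurd h.symm (x4 _ _ _)
    · obtain ⟨c, hc⟩ := (mem_congruenceLattice.1 (h.le (mem_mid_false j t))).2.2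
      obtain rfl := eq_of_mul_sub_eq hp (n := 1) (a := t - t') (j := j) (j' := j') (c := p * c)
        (by linear_combination hc)
      rw [eq_of_mul_sub_eq hp (n := 2) (a := 0) (j := t) (j' := t') (c := c)
        (by linear_combination hc)]
  · rcases eq_of_rank_eq_three hr with rfl | ⟨j, rfl⟩ | ⟨j, t, rfl⟩ <;>
      rcases eq_of_rank_eq_three hn with rfl | ⟨j', rfl⟩ | ⟨j', t', rfl⟩
    · rfl
    · exact absurd h.symm (x5 _)
    · exact absurd h.symm (x6 _ _)
    · exact absurd h (x5 _)
    · obtain ⟨c, hc⟩ := (mem_congruenceLattice.1 (h.le (mem_centre_false j))).2.2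
      rw [eq_of_mul_sub_eq hp (n := 1) (a := 0) (j := j) (j' := j') (c := c)
        (by linear_combination hc)]
    · exact absurd h.symm (x7 _ _ _)
    · exact absurd h (x6 _ _)
    · exact absurd h (x7 _ _ _)
    · obtain ⟨c, hc⟩ := (mem_congruenceLattice.1 (h.le (mem_mid_true j t))).2.2
      obtain rfl := eq_of_mul_sub_eq hp (n := 0) (a := t - t') (j := j) (j' := j') (c := p * c)
        (by linear_combination hc)
      rw [eq_of_mul_sub_eq hp (n := 1) (a := 0) (j := t) (j' := t') (c := c)
        (by linear_combination hc)]
  · rcases eq_of_rank_eq_four hr with rfl | ⟨j, rfl⟩ <;>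
      rcases eq_of_rank_eq_four hn with rfl | ⟨j', rfl⟩
    · rfl
    · exact absurd h.symm (x8 _)
    · exact absurd h (x8 _)
    · obtain ⟨c, hc⟩ := (mem_congruenceLattice.1 (h.le (mem_centre_true j))).2.2
      rw [eq_of_mul_sub_eq hp (n := 0) (a := 0) (j := j) (j' := j') (c := c)
        (by linear_combination hc)]
  · rw [eq_of_rank_eq_five hr, eq_of_rank_eq_five hn]

/-- A test vector of the smaller lattice must satisfy the congruence of the larger one; this either
forces the first digits to agree or is absurd. -/
theorem link_of_lattice_le (h : lattice u ≤ lattice v) (hr : rank v = rank u + 1) :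
    Link u v ∨ Link v u := by
  have n1 := not_dvd_one hp
  have n2 := not_sq_dvd hp
  have n3 := not_pow_succ_dvd_pow hp 2
  have hv := rank_le_five v
  obtain ⟨n, hn⟩ : ∃ n, rank u = n := ⟨_, rfl⟩
  rw [hn] at hr
  have hn4 : n ≤ 4 := by omega
  interval_cases n
  · obtain rfl := eq_of_rank_eq_zero hn
    rcases eq_of_rank_eq_one hr with rfl | ⟨j, rfl⟩
    · exact Or.inl (.rung 0)
    · exact Or.inr (.corner_hub_zero _ _)
  · rcases eq_of_rank_eq_one hn with rfl | ⟨j, rfl⟩ <;>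
      rcases eq_of_rank_eq_two hr with rfl | ⟨j', rfl⟩ | ⟨j', t', rfl⟩
    · exact Or.inl .diagonal_zero
    · exact Or.inr (.corner_hub_zero _ _)
    · exact absurd (by simpa using (mem_congruenceLattice.1 (h mem_hub_true_zero)).2.2) n3
    · exact Or.inl (.corner_hub_one _ _)
    · obtain ⟨c, hc⟩ := (mem_congruenceLattice.1 (h (mem_corner_false j))).2.2
      exact absurd ⟨c + j' * j, by linear_combination hc⟩ n2
    · obtain ⟨c, hc⟩ := (mem_congruenceLattice.1 (h (mem_corner_false j))).2.2
      obtain rfl := eq_of_mul_sub_eq hp (n := 2) (a := -t') (j := j) (j' := j') (c := c)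
        (by linear_combination hc)
      exact Or.inr (.mid_corner _ _ _)
  · rcases eq_of_rank_eq_two hn with rfl | ⟨j, rfl⟩ | ⟨j, t, rfl⟩ <;>
      rcases eq_of_rank_eq_three hr with rfl | ⟨j', rfl⟩ | ⟨j', t', rfl⟩
    · exact Or.inl (.rung 1)
    · exact Or.inr (.centre_hub_one _ _)
    · exact absurd (by simpa using (mem_congruenceLattice.1 (h mem_hub_false_one_right)).2.2) n2
    · exact Or.inl (.corner_hub_one _ _)
    · obtain ⟨c, hc⟩ := (mem_congruenceLattice.1 (h (mem_corner_true j))).2.2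
      exact absurd ⟨c + j' * j, by linear_combination hc⟩ n2
    · obtain ⟨c, hc⟩ := (mem_congruenceLattice.1 (h (mem_corner_true j))).2.2
      obtain rfl := eq_of_mul_sub_eq hp (n := 1) (a := -t') (j := j) (j' := j') (c := c)
        (by linear_combination hc)
      exact Or.inr (.mid_corner _ _ _)
    · exact absurd (mem_congruenceLattice.1 (h (mem_mid_false j t))).2.1 n1
    · obtain ⟨c, hc⟩ := (mem_congruenceLattice.1 (h (mem_mid_false j t))).2.2
      obtain rfl := eq_of_mul_sub_eq hp (n := 1) (a := t) (j := j) (j' := j') (c := c)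
        (by linear_combination hc)
      exact Or.inl (.mid_centre _ _ _)
    · obtain ⟨c, hc⟩ := (mem_congruenceLattice.1 (h (mem_mid_false j t))).2.2
      exact absurd ⟨p * c + (j' + p * t') * (j + p * t), by linear_combination hc⟩ n1
  · rcases eq_of_rank_eq_three hn with rfl | ⟨j, rfl⟩ | ⟨j, t, rfl⟩ <;>
      rcases eq_of_rank_eq_four hr with rfl | ⟨j', rfl⟩
    · exact Or.inl .diagonal_one
    · exact Or.inr (.centre_hub_one _ _)
    · exact Or.inl (.centre_hub_two _ _)
    · obtain ⟨c, hc⟩ := (mem_congruenceLattice.1 (h (mem_centre_false j))).2.2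
      exact absurd ⟨c + j' * j, by linear_combination hc⟩ n1
    · exact absurd (mem_congruenceLattice.1 (h (mem_mid_true j t))).1 n1
    · obtain ⟨c, hc⟩ := (mem_congruenceLattice.1 (h (mem_mid_true j t))).2.2
      obtain rfl := eq_of_mul_sub_eq hp (n := 0) (a := t) (j := j) (j' := j') (c := c)
        (by linear_combination hc)
      exact Or.inl (.mid_centre _ _ _)
  · obtain rfl := eq_of_rank_eq_five hr
    rcases eq_of_rank_eq_four hn with rfl | ⟨j, rfl⟩
    · exact Or.inl (.rung 2)
    · exact Or.inl (.centre_hub_two _ _)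

/-- Every vertex of the model lies on a maximal chain. -/
theorem exists_chain (v : LatticeVertex p) : ∃ c : Fin 6 → LatticeVertex p,
    StrictMono (fun i => lattice (c i)) ∧ ∃ i : Fin 6, (i : ℕ) = rank v ∧ c i = v := by
  have hup : ∀ {a b : LatticeVertex p}, Link a b ∨ Link b a → rank b = rank a + 1 →
      lattice a < lattice b := by
    intro a b hl hr
    rcases hl with h | h <;> rcases lattice_lt_of_link hp h with h' | h'
    · exact h'.1
    · omega
    · omega
    · exact h'.1
  have hchain : ∀ c : Fin 6 → LatticeVertex p,
      (∀ i : Fin 5, lattice (c i.castSucc) < lattice (c i.succ)) →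
      (∃ i : Fin 6, (i : ℕ) = rank v ∧ c i = v) →
      ∃ c : Fin 6 → LatticeVertex p, StrictMono (fun i => lattice (c i)) ∧
        ∃ i : Fin 6, (i : ℕ) = rank v ∧ c i = v :=
    fun c h1 h2 => ⟨c, Fin.strictMono_iff_lt_succ.2 h1, h2⟩
  -- The chains `A` and `B` pass through a gadget of the side `false` or `true`, and `C` passes
  -- through the six hubs.
  have A : ∀ j t : Fin p, ∀ i : Fin 5,
      lattice ((![hub false 0, corner false j, mid false j t, centre false j, hub false 2,
        hub true 2] : Fin 6 → LatticeVertex p) i.castSucc)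
      < lattice ((![hub false 0, corner false j, mid false j t, centre false j, hub false 2,
        hub true 2] : Fin 6 → LatticeVertex p) i.succ) := by
    intro j t i
    fin_cases i
    · exact hup (Or.inr (.corner_hub_zero false j)) rfl
    · exact hup (Or.inr (.mid_corner false j t)) rfl
    · exact hup (Or.inl (.mid_centre false j t)) rfl
    · exact hup (Or.inl (.centre_hub_two false j)) rfl
    · exact hup (Or.inl (.rung 2)) rfl
  have B : ∀ j t : Fin p, ∀ i : Fin 5,
      lattice ((![hub false 0, hub true 0, corner true j, mid true j t, centre true j,
        hub true 2] : Fin 6 → LatticeVertex p) i.castSucc)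
      < lattice ((![hub false 0, hub true 0, corner true j, mid true j t, centre true j,
        hub true 2] : Fin 6 → LatticeVertex p) i.succ) := by
    intro j t i
    fin_cases i
    · exact hup (Or.inl (.rung 0)) rfl
    · exact hup (Or.inr (.corner_hub_zero true j)) rfl
    · exact hup (Or.inr (.mid_corner true j t)) rfl
    · exact hup (Or.inl (.mid_centre true j t)) rfl
    · exact hup (Or.inl (.centre_hub_two true j)) rfl
  have C : ∀ i : Fin 5,
      lattice ((![hub false 0, hub true 0, hub false 1, hub true 1, hub false 2,
        hub true 2] : Fin 6 → LatticeVertex p) i.castSucc)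
      < lattice ((![hub false 0, hub true 0, hub false 1, hub true 1, hub false 2,
        hub true 2] : Fin 6 → LatticeVertex p) i.succ) := by
    intro i
    fin_cases i
    · exact hup (Or.inl (.rung 0)) rfl
    · exact hup (Or.inl .diagonal_zero) rfl
    · exact hup (Or.inl (.rung 1)) rfl
    · exact hup (Or.inl .diagonal_one) rfl
    · exact hup (Or.inl (.rung 2)) rfl
  rcases v with ⟨_ | _, r⟩ | ⟨_ | _, j⟩ | ⟨_ | _, j⟩ | ⟨_ | _, j, t⟩
  · refine hchain _ C ?_
    fin_cases r
    · exact ⟨0, rfl, rfl⟩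
    · exact ⟨2, rfl, rfl⟩
    · exact ⟨4, rfl, rfl⟩
  · refine hchain _ C ?_
    fin_cases r
    · exact ⟨1, rfl, rfl⟩
    · exact ⟨3, rfl, rfl⟩
    · exact ⟨5, rfl, rfl⟩
  · exact hchain _ (A j j) ⟨3, rfl, rfl⟩
  · exact hchain _ (B j j) ⟨4, rfl, rfl⟩
  · exact hchain _ (A j j) ⟨1, rfl, rfl⟩
  · exact hchain _ (B j j) ⟨2, rfl, rfl⟩
  · exact hchain _ (A j t) ⟨2, rfl, rfl⟩
  · exact hchain _ (B j t) ⟨3, rfl, rfl⟩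

end Prime

end LatticeVertex

/-! ### Subgroup lattice graphs of finite abelian `p`-groups -/

section FiniteGroup

variable {G : Type*} [AddCommGroup G] [Finite G] {p : ℕ}

theorem AddSubgroup.card_lt_card {H K : AddSubgroup G} (h : H < K) : Nat.card H < Nat.card K :=
  lt_of_not_ge fun h' => h.ne (AddSubgroup.eq_of_le_of_card_ge h.le h')

/-- The multiples 0, …, (p-1)z represent all cosets of `H` in the join. -/
theorem AddSubgroup.card_sup_zmultiples_le (H : AddSubgroup G) {z : G} (hp : 0 < p)
    (hz : p • z ∈ H) : Nat.card (H ⊔ zmultiples z : AddSubgroup G) ≤ p * Nat.card H := by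
  have hmem : ∀ q : Fin p × H, (q.2 : G) + (q.1 : ℕ) • z ∈ H ⊔ zmultiples z := fun q =>
    add_mem (mem_sup_left q.2.2) (mem_sup_right (nsmul_mem (mem_zmultiples z) _))
  have hsurj : Function.Surjective
      (fun q => ⟨_, hmem q⟩ : Fin p × H → (H ⊔ zmultiples z : AddSubgroup G)) := by
    rintro ⟨x, hx⟩
    obtain ⟨h, hh, w, hw, rfl⟩ := mem_sup.1 hx
    obtain ⟨m, rfl⟩ := mem_zmultiples_iff.1 hw
    have hp' : (0 : ℤ) < p := by exact_mod_cast hp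
    have h1 := Int.emod_nonneg m hp'.ne'
    have h2 := Int.emod_lt_of_pos m hp'
    refine ⟨(⟨(m % p).toNat, by omega⟩, ⟨h + (m / p) • (p • z), add_mem hh (zsmul_mem hz _)⟩), ?_⟩
    refine Subtype.ext ?_
    show h + (m / p) • (p • z) + (m % p).toNat • z = h + m • z
    rw [add_assoc, ← natCast_zsmul z (m % p).toNat, Int.toNat_of_nonneg h1, ← natCast_zsmul z p,
      smul_smul, ← add_smul, Int.ediv_mul_add_emod]
  have := Nat.card_le_card_of_surjective _ hsurj
  rwa [Nat.card_prod, Nat.card_fin] at this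

/-- In a finite abelian `p`-group the index of a maximal proper subgroup is `p`. -/
theorem AddSubgroup.card_le_mul_card_of_covBy (hp : 0 < p) {n : ℕ} (hG : Nat.card G = p ^ n)
    {H K : AddSubgroup G} (h : H < K) (hHK : ¬ ∃ L : AddSubgroup G, H < L ∧ L < K) :
    Nat.card K ≤ p * Nat.card H := by
  obtain ⟨hle, z, hzK, hzH⟩ := SetLike.lt_iff_le_and_exists.1 h
  have hex : ∃ i, p ^ i • z ∈ H := ⟨n, by rw [← hG, card_nsmul_eq_zero']; exact H.zero_mem⟩
  classical
  -- The last p-power multiple of `z` outside `H` already generates `K` over `H`, by maximality, and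
  -- p times it lies in `H`.
  obtain ⟨i, hi⟩ : ∃ i, Nat.find hex = i + 1 := Nat.exists_eq_succ_of_ne_zero fun h0 => by
    have := Nat.find_spec hex
    rw [h0, pow_zero, one_smul] at this
    exact hzH this
  have h1 : p ^ i • z ∉ H := Nat.find_min hex (by omega)
  have h2 : p • p ^ i • z ∈ H := by
    have := Nat.find_spec hex
    rwa [hi, pow_succ', mul_smul] at this
  have h3 : H < H ⊔ zmultiples (p ^ i • z) :=
    lt_of_le_not_ge le_sup_left fun h' => h1 (h' (mem_sup_right (mem_zmultiples _)))
  have h4 : H ⊔ zmultiples (p ^ i • z) ≤ K :=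
    sup_le hle ((zmultiples_le_of_mem) (nsmul_mem hzK _))
  have h5 : H ⊔ zmultiples (p ^ i • z) = K := by
    by_contra h6
    exact hHK ⟨_, h3, lt_of_le_of_ne h4 h6⟩
  rw [← h5]
  exact card_sup_zmultiples_le H hp h2

/-- The exponents of the orders are six strictly increasing integers between 0 and 5. A maximal
chain through a lattice thus gives the order of its image without computing an index. -/
theorem AddSubgroup.card_eq_pow_of_strictMono (hp : p.Prime) (hG : Nat.card G = p ^ 5)
    {c : Fin 6 → AddSubgroup G} (hc : StrictMono c) (i : Fin 6) : Nat.card (c i) = p ^ (i : ℕ) := by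
  have h1 : ∀ i, ∃ e ≤ 5, Nat.card (c i) = p ^ e := fun i =>
    (Nat.dvd_prime_pow hp).1 (hG ▸ card_addSubgroup_dvd_card (c i))
  choose e he hce using h1
  have h2 : ∀ i j, i < j → e i < e j := fun i j hij => by
    have := card_lt_card (hc hij)
    rwa [hce, hce, Nat.pow_lt_pow_iff_right hp.one_lt] at this
  have a0 := h2 0 1 (by decide)
  have a1 := h2 1 2 (by decide)
  have a2 := h2 2 3 (by decide)
  have a3 := h2 3 4 (by decide)
  have a4 := h2 4 5 (by decide)
  have a5 := he 5
  rw [hce]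
  congr 1
  fin_cases i <;> simp <;> omega

/-- In an abelian p-group covering means index p, which turns adjacency into an inclusion together
with a comparison of orders. -/
theorem subgroupLatticeGraph_adj_iff (hp : p.Prime) {n : ℕ} (hG : Nat.card G = p ^ n)
    {H K : AddSubgroup G} : (subgroupLatticeGraph G).Adj H K ↔
      (H ≤ K ∧ Nat.card K = p * Nat.card H) ∨ (K ≤ H ∧ Nat.card H = p * Nat.card K) := by
  have key : ∀ H K : AddSubgroup G, (H < K ∧ ¬ ∃ L : AddSubgroup G, H < L ∧ L < K) ↔
      (H ≤ K ∧ Nat.card K = p * Nat.card H) := by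
    intro H K
    obtain ⟨i, -, hi⟩ := (Nat.dvd_prime_pow hp).1 (hG ▸ AddSubgroup.card_addSubgroup_dvd_card H)
    obtain ⟨k, -, hk⟩ := (Nat.dvd_prime_pow hp).1 (hG ▸ AddSubgroup.card_addSubgroup_dvd_card K)
    constructor
    · rintro ⟨h1, h2⟩
      have h3 := AddSubgroup.card_le_mul_card_of_covBy hp.pos hG h1 h2
      have h4 := AddSubgroup.card_lt_card h1
      rw [hi, hk] at h4
      rw [hi, hk, ← pow_succ', Nat.pow_le_pow_iff_right hp.one_lt] at h3
      rw [Nat.pow_lt_pow_iff_right hp.one_lt] at h4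
      exact ⟨h1.le, by rw [hi, hk, ← pow_succ']; congr 1; omega⟩
    · rintro ⟨h1, h2⟩
      rw [hi, hk, ← pow_succ'] at h2
      have h3 := Nat.pow_right_injective hp.two_le h2
      refine ⟨lt_of_le_of_ne h1 ?_, ?_⟩
      · rintro rfl
        rw [hi] at hk
        have := Nat.pow_right_injective hp.two_le hk
        omega
      · rintro ⟨L, h4, h5⟩
        obtain ⟨l, -, hl⟩ := (Nat.dvd_prime_pow hp).1
          (hG ▸ AddSubgroup.card_addSubgroup_dvd_card L)
        have h6 := AddSubgroup.card_lt_card h4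
        have h7 := AddSubgroup.card_lt_card h5
        rw [hi, hl, Nat.pow_lt_pow_iff_right hp.one_lt] at h6
        rw [hk, hl, Nat.pow_lt_pow_iff_right hp.one_lt] at h7
        omega
  exact or_congr (key H K) (key K H)

namespace LatticeVertex

/-- This is the correspondence theorem for `φ`: every lattice of the model contains the kernel,
every lattice containing the kernel is in the model, and the order of the image is p to the power
`rank`. -/
theorem exists_equiv_of_surjective (hp : p.Prime) (hG : Nat.card G = p ^ 5) (φ : ℤ × ℤ →+ G)
    (hφ : Function.Surjective φ) (hker : φ.ker = lattice (hub (p := p) false 0)) :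
    ∃ M : LatticeVertex p ≃ AddSubgroup G,
      ∀ u v, (subgroupLatticeGraph G).Adj (M u) (M v) ↔ Link u v ∨ Link v u := by
  have hcomap : ∀ v : LatticeVertex p, ((lattice v).map φ).comap φ = lattice v := fun v => by
    rw [AddSubgroup.comap_map_eq, hker, sup_eq_left]
    exact hub_zero_le v
  have hle : ∀ u v : LatticeVertex p, (lattice u).map φ ≤ (lattice v).map φ ↔
      lattice u ≤ lattice v := fun u v => by
    rw [AddSubgroup.map_le_iff_le_comap, hcomap]
  have hcard : ∀ v : LatticeVertex p, Nat.card ((lattice v).map φ) = p ^ rank v := fun v => by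
    obtain ⟨c, hc, i, hi, rfl⟩ := exists_chain hp v
    rw [← hi]
    refine AddSubgroup.card_eq_pow_of_strictMono (c := fun i => (lattice (c i)).map φ) hp hG ?_ i
    intro i j hij
    have := hc hij
    rw [lt_iff_le_not_ge] at this ⊢
    rwa [hle, hle]
  have hinj : Function.Injective fun v : LatticeVertex p => (lattice v).map φ := by
    intro u v h
    refine eq_of_lattice_eq hp ?_ (Nat.pow_right_injective hp.two_le ?_)
    · rw [← hcomap u, ← hcomap v]
      exact congrArg _ h
    · show p ^ rank u = p ^ rank v
      rw [← hcard, ← hcard]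
      exact congrArg (fun H : AddSubgroup G => Nat.card H) h
  have hsurj : Function.Surjective fun v : LatticeVertex p => (lattice v).map φ := by
    intro H
    have hk : φ.ker ≤ H.comap φ := fun x hx => by
      rw [AddSubgroup.mem_comap, AddMonoidHom.mem_ker.1 hx]
      exact H.zero_mem
    rw [hker] at hk
    obtain ⟨v, hv⟩ := exists_eq_lattice hp (H.comap φ)
      (hk (mem_congruenceLattice.2 ⟨dvd_rfl, dvd_zero _, one_dvd _⟩))
      (hk (mem_congruenceLattice.2 ⟨dvd_zero _, dvd_rfl, one_dvd _⟩))
    refine ⟨v, ?_⟩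
    show (lattice v).map φ = H
    rw [← hv, AddSubgroup.map_comap_eq_self_of_surjective hφ]
  refine ⟨Equiv.ofBijective _ ⟨hinj, hsurj⟩, fun u v => ?_⟩
  have hstep : ∀ u v : LatticeVertex p,
      ((lattice u).map φ ≤ (lattice v).map φ ∧
        Nat.card ((lattice v).map φ) = p * Nat.card ((lattice u).map φ)) ↔
      (lattice u ≤ lattice v ∧ rank v = rank u + 1) := fun u v => by
    rw [hle, hcard, hcard, ← pow_succ', (Nat.pow_right_injective hp.two_le).eq_iff]
  rw [subgroupLatticeGraph_adj_iff hp hG]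
  show (((lattice u).map φ ≤ (lattice v).map φ ∧
        Nat.card ((lattice v).map φ) = p * Nat.card ((lattice u).map φ)) ∨
      ((lattice v).map φ ≤ (lattice u).map φ ∧
        Nat.card ((lattice u).map φ) = p * Nat.card ((lattice v).map φ))) ↔ _
  rw [hstep, hstep]
  constructor
  · rintro (⟨h1, h2⟩ | ⟨h1, h2⟩)
    · exact link_of_lattice_le hp h1 h2
    · exact (link_of_lattice_le hp h1 h2).symm
  · rintro (h | h)
    · exact (lattice_lt_of_link hp h).imp (fun h => ⟨h.1.le, h.2⟩) fun h => ⟨h.1.le, h.2⟩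
    · exact ((lattice_lt_of_link hp h).imp (fun h => ⟨h.1.le, h.2⟩) fun h => ⟨h.1.le, h.2⟩).symm

end LatticeVertex

end FiniteGroup

/-- The subgroup lattice graph of `ℤ/p³ × ℤ/p²` is the model. -/
theorem LatticeVertex.exists_equiv {p a b : ℕ} (hp : p.Prime) (ha : a = p ^ 3) (hb : b = p ^ 2) :
    ∃ M : LatticeVertex p ≃ AddSubgroup (ZMod a × ZMod b),
      ∀ u v, (subgroupLatticeGraph (ZMod a × ZMod b)).Adj (M u) (M v) ↔ Link u v ∨ Link v u := by
  have : NeZero a := ⟨by rw [ha]; exact pow_ne_zero _ hp.ne_zero⟩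
  have : NeZero b := ⟨by rw [hb]; exact pow_ne_zero _ hp.ne_zero⟩
  refine exists_equiv_of_surjective hp ?_
    ((Int.castAddHom (ZMod a)).prodMap (Int.castAddHom (ZMod b))) ?_ ?_
  · rw [Nat.card_prod, Nat.card_zmod, Nat.card_zmod, ha, hb, ← pow_add]
  · rintro ⟨x, y⟩
    obtain ⟨m, rfl⟩ := ZMod.intCast_surjective x
    obtain ⟨n, rfl⟩ := ZMod.intCast_surjective y
    exact ⟨(m, n), rfl⟩
  · ext ⟨x, y⟩
    rw [lattice, mem_congruenceLattice, AddMonoidHom.mem_ker]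
    show ((x : ZMod a), (y : ZMod b)) = 0 ↔ _
    rw [Prod.mk_eq_zero, ZMod.intCast_zmod_eq_zero_iff_dvd, ZMod.intCast_zmod_eq_zero_iff_dvd, ha,
      hb]
    push_cast
    simp

/-! ### Tripods in the model -/

namespace LatticeVertex

variable {p : ℕ}

/-- Two disjoint families of tripods, one on each side of the model. -/
def tripods : Bool × TripodVertex p → LatticeVertex p
  | (false, .inl r) => hub false r
  | (false, .inr (j, 0)) => corner false j
  | (false, .inr (j, 1)) => mid false j j
  | (false, .inr (j, 2)) => centre false j
  -- On this side the tripods branch at the vertices `centre`, adjacent to hubs 2 and 1, and the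
  -- long leg ends in hub 0; so the hubs are listed in reverse.
  | (true, .inl r) => hub true r.rev
  | (true, .inr (j, 0)) => centre true j
  | (true, .inr (j, 1)) => mid true j j
  | (true, .inr (j, 2)) => corner true j

theorem tripods_injective : Function.Injective (tripods (p := p)) := by
  rintro ⟨_ | _, r | ⟨j, i⟩⟩ ⟨_ | _, r' | ⟨j', i'⟩⟩ h <;> (try fin_cases i) <;>
    (try fin_cases i') <;> simp_all [tripods]

theorem tripods_link (i : Bool) (t : TripodDart p) :
    Link (tripods (i, t.src)) (tripods (i, t.rev.src)) ∨
      Link (tripods (i, t.rev.src)) (tripods (i, t.src)) := by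
  have key : ∀ (i : Bool) (j : Fin p) (m : Fin 5),
      Link (tripods (i, TripodDart.tail j m)) (tripods (i, TripodDart.head j m)) ∨
      Link (tripods (i, TripodDart.head j m)) (tripods (i, TripodDart.tail j m)) := by
    intro i j m
    cases i <;> fin_cases m
    · exact Or.inl (.corner_hub_zero _ _)
    · exact Or.inl (.corner_hub_one _ _)
    · exact Or.inr (.mid_corner _ _ _)
    · exact Or.inl (.mid_centre _ _ _)
    · exact Or.inl (.centre_hub_two _ _)
    · exact Or.inl (.centre_hub_two _ _)
    · exact Or.inl (.centre_hub_one _ _)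
    · exact Or.inr (.mid_centre _ _ _)
    · exact Or.inl (.mid_corner _ _ _)
    · exact Or.inl (.corner_hub_zero _ _)
  obtain ⟨j, m, b⟩ := t
  cases b
  · exact key i j m
  · exact (key i j m).symm

/-- Three tripods in the model for `p = 2`. -/
def threeTripods : Unit × TripodVertex 3 → LatticeVertex 2
  | ((), .inl r) => hub false r
  | ((), .inr (0, 0)) => corner false 0
  | ((), .inr (0, 1)) => mid false 0 0
  | ((), .inr (0, 2)) => centre false 0
  | ((), .inr (1, 0)) => corner false 1
  | ((), .inr (1, 1)) => mid false 1 0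
  | ((), .inr (1, 2)) => centre false 1
  -- The third tripod uses the other side: it branches at `hub true 0`, and its long leg returns
  -- along the diagonal from `hub true 1` to `hub false 2`.
  | ((), .inr (2, 0)) => hub true 0
  | ((), .inr (2, 1)) => corner true 0
  | ((), .inr (2, 2)) => hub true 1

theorem threeTripods_injective : Function.Injective threeTripods := by
  rintro ⟨_, r | ⟨j, i⟩⟩ ⟨_, r' | ⟨j', i'⟩⟩ h <;> (try fin_cases j <;> fin_cases i) <;>
    (try fin_cases j' <;> fin_cases i') <;> simp_all [threeTripods]

theorem threeTripods_link (i : Unit) (t : TripodDart 3) :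
    Link (threeTripods (i, t.src)) (threeTripods (i, t.rev.src)) ∨
      Link (threeTripods (i, t.rev.src)) (threeTripods (i, t.src)) := by
  have key : ∀ (j : Fin 3) (m : Fin 5),
      Link (threeTripods (i, TripodDart.tail j m)) (threeTripods (i, TripodDart.head j m)) ∨
      Link (threeTripods (i, TripodDart.head j m)) (threeTripods (i, TripodDart.tail j m)) := by
    intro j m
    fin_cases j <;> fin_cases m
    · exact Or.inl (.corner_hub_zero _ _)
    · exact Or.inl (.corner_hub_one _ _)
    · exact Or.inr (.mid_corner _ _ _)
    · exact Or.inl (.mid_centre _ _ _)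
    · exact Or.inl (.centre_hub_two _ _)
    · exact Or.inl (.corner_hub_zero _ _)
    · exact Or.inl (.corner_hub_one _ _)
    · exact Or.inr (.mid_corner _ _ _)
    · exact Or.inl (.mid_centre _ _ _)
    · exact Or.inl (.centre_hub_two _ _)
    · exact Or.inr (.rung 0)
    · exact Or.inl .diagonal_zero
    · exact Or.inr (.corner_hub_zero _ _)
    · exact Or.inl (.corner_hub_one _ _)
    · exact Or.inl .diagonal_one
  obtain ⟨j, m, b⟩ := t
  cases b
  · exact key j m
  · exact (key j m).symm

end LatticeVertex

/-! ### The genus of the subgroup lattice graph -/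

theorem hasGenus_of_exists_le {V : Type*} {Γ : SimpleGraph V} {g : ℕ}
    (h₁ : ∃ h ≤ g, EmbedsInGenus Γ h) (h₂ : ∀ h, EmbedsInGenus Γ h → g ≤ h) : HasGenus Γ g := by
  obtain ⟨h, hg, H⟩ := h₁
  exact ⟨hg.antisymm (h₂ h H) ▸ H, fun h => h₂ h⟩

theorem proposition3p5 :
    (∀ p : ℕ, p.Prime → Odd p →
      HasGenus (subgroupLatticeGraph (ZMod (p ^ 3) × ZMod (p ^ 2))) (2 * ⌈((p : ℚ) - 2) / 4⌉₊)) ∧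
    HasGenus (subgroupLatticeGraph (ZMod 8 × ZMod 4)) 1 := by
  constructor
  · intro p hp hodd
    obtain ⟨M, hM⟩ := LatticeVertex.exists_equiv (a := p ^ 3) (b := p ^ 2) hp rfl rfl
    have hp2 : 2 < p := lt_of_le_of_ne hp.two_le fun h => by
      rw [← h] at hodd
      exact absurd hodd (by decide)
    have hp2' : (2 : ℚ) < p := by exact_mod_cast hp2
    have hceil := Nat.ceil_lt_add_one (a := ((p : ℚ) - 2) / 4) (by linarith)
    have hle := Nat.le_ceil (((p : ℚ) - 2) / 4)
    set m := ⌈((p : ℚ) - 2) / 4⌉₊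
    -- The upper bound on the ceiling feeds the lower bound on the genus, and the lower bound `h2`
    -- makes room for p centres in the construction.
    have h1 : 4 * m < p + 2 := by
      have : 4 * (m : ℚ) < p + 2 := by linarith
      exact_mod_cast this
    have h2 : p ≤ 4 * m + 2 := by
      have : (p : ℚ) ≤ 4 * m + 2 := by linarith
      exact_mod_cast this
    refine hasGenus_of_exists_le ?_ fun h H => ?_
    · have hk : Odd (2 * m + 1) := ⟨m, rfl⟩
      -- Oddness of p excludes p = 4m + 2, which leaves room although one vertex of degree three has
      -- been removed.
      have hpk : p < 2 * (2 * m + 1) := by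
        obtain ⟨l, rfl⟩ := hodd
        omega
      have : NeZero (2 * m + 1) := ⟨by omega⟩
      obtain ⟨B⟩ := TubeSurface.exists_latticeBase hk hpk
      refine B.exists_embedsInGenus (le_trans ?_ (TubeSurface.le_eulerChar hk)) M.symm
        M.symm.injective fun u v h => ?_
      · push_cast
        linarith
      · rwa [← hM, M.apply_symm_apply, M.apply_symm_apply]
    · have := H.card_mul_le hp.two_le h1 (M ∘ LatticeVertex.tripods) (M.injective.comp LatticeVertex.tripods_injective)
        fun i t => (hM _ _).2 (LatticeVertex.tripods_link i t)
      rwa [Fintype.card_bool] at this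
  · obtain ⟨M, hM⟩ := LatticeVertex.exists_equiv (a := 8) (b := 4) Nat.prime_two rfl rfl
    refine hasGenus_of_exists_le ?_ fun h H => ?_
    · refine TorusSurface.latticeBase.exists_embedsInGenus
        (le_trans (by norm_num) TorusSurface.eulerChar_nonneg) M.symm
        M.symm.injective fun u v h => ?_
      rwa [← hM, M.apply_symm_apply, M.apply_symm_apply]
    · have := H.card_mul_le (m := 1) (n := 3) (by norm_num) (by norm_num) (M ∘ LatticeVertex.threeTripods)
        (M.injective.comp LatticeVertex.threeTripods_injective)
        fun i t => (hM _ _).2 (LatticeVertex.threeTripods_link i t)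
      rwa [Fintype.card_unit] at this
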